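/- Let $d\ge 2$, let $\xi^-\ne\xi^+$ be unit vectors of $\mathbb R^d$ and let $V_{\min}>0$. Let $\mathcal P$ be the set of pairs $(V,\alpha)$ with $\alpha\in(0,2)$ and $V\in C^2(\mathbb S^{d-1})$ such that $V(s)\ge V(\xi^\pm)=V_{\min}$ for all $s\in\mathbb S^{d-1}$ and, for some $\delta,\mu>0$, $V(s)-V(\xi^\pm)\ge\mu|s-\xi^\pm|^2$ whenever $s\in\mathbb S^{d-1}$ and $|s-\xi^\pm|<\delta$. Identify $(V,\alpha)\in\mathcal P$ with the homogeneous extension $V(x)=V(x/|x|)/|x|^{\alpha}$, $x\neq0$, $V(0)=+\infty$, and for $x\in H^1((a,b);\mathbb R^d)$ put $\mathcal A([a,b];x)=\int_a^b\big(\tfrac12|\dot x|^2+V(x)\big)\,dt\in[0,+\infty]$. Let $$c(V)=\inf\{\mathcal A([a,b];x): a<b,\ x\in H^1((a,b);\mathbb R^d),\ x(a)=\xi^-,\ x(b)=\xi^+\},$$ $$\mathrm{In}=\Big\{V\in\mathcal P: c(V)=\tfrac{4\sqrt{2V_{\min}}}{2-\alpha}\Big\},\qquad \mathrm{Out}=\Big\{V\in\mathcal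 P: c(V)<\tfrac{4\sqrt{2V_{\min}}}{2-\alpha}\Big\}.$$ For $\varepsilon>0$, an $\varepsilon$-constrained Morse minimizer for $V$ is a path $x\in H^1_{\mathrm{loc}}(\mathbb R;\mathbb R^d)$ with $\min_{t}|x(t)|=\varepsilon$, with $|x(t)|\to+\infty$ and $x(t)/|x(t)|\to\xi^\pm$ as $t\to\pm\infty$, and such that $\mathcal A([a,b];x)\le\mathcal A([a',b'];z)$ for all $a<b$, $a'<b'$ and $z\in H^1((a',b');\mathbb R^d)$ with $z(a')=x(a)$, $z(b')=x(b)$ and $\min_{[a',b']}|z|=\min_{[a,b]}|x|$. If the contact set $\{t:|x(t)|=\varepsilon\}$ of such a path is a compact interval $[t_*,t_{**}]$ (with $t_*\le t_{**}$), $x$ is differentiable off it and the one-sided limits $\dot x(t_*^-)$, $\dot x(t_{**}^+)$ of the velocity exist, its (normalized) velocity-jump is $$\Delta_{\mathrm{vel}}(x)=\frac{\dot x(t_{**}^+)\cdot x(t_{**})-\dot x(t_*^-)\cdot x(t_*)}{\varepsilon^{-\alpha/2}\,\varepsilon}.$$ Let $V\in\mathcal P$. For every $\varepsilon>0$ there exist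 $\varepsilon$-constrained Morse minimizers for $V$; the velocity-jump is defined for each of them, and its value is the same for all $\varepsilon>0$ and all $\varepsilon$-constrained Morse minimizers. Denoting this common value by $\Delta_{\mathrm{vel}}(V)$, $$V\in\mathrm{In}\iff\Delta_{\mathrm{vel}}(V)=0,\qquad\qquad V\in\mathrm{Out}\iff\Delta_{\mathrm{vel}}(V)>0.$$ -/

import Mathlib

open Set Filter Topology MeasureTheory
open scoped ENNReal

noncomputable section

namespace ParabolicMin

/-- The Euclidean space `ℝ^d`. -/
abbrev E (d : ℕ) : Type := EuclideanSpace ℝ (Fin d)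

variable {d : ℕ}

/-- The class `𝒫`, for fixed unit vectors `ξm = ξ⁻`, `ξp = ξ⁺` and a fixed number `Vmin`.
Its elements are pairs `(V, α)` with `α ∈ (0,2)`; a `C²` function on the unit sphere is
identified with its `-α`-homogeneous extension `V ∈ C²(ℝ^d ∖ {0})`,
`V x = V (x/|x|) / |x|^α`.  The value of `V` at the origin is irrelevant. -/
structure IsPotential (ξm ξp : E d) (Vmin : ℝ) (V : E d → ℝ) (α : ℝ) : Prop where
  alpha_pos : 0 < α
  alpha_lt_two : α < 2
  contDiffOn : ContDiffOn ℝ 2 V {0}ᶜ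
  homogeneous : ∀ x : E d, x ≠ 0 → V x = V (‖x‖⁻¹ • x) / ‖x‖ ^ α
  val_ξm : V ξm = Vmin
  val_ξp : V ξp = Vmin
  le_val : ∀ s : E d, ‖s‖ = 1 → Vmin ≤ V s
  nondegenerate : ∃ δ > 0, ∃ μ > 0, ∀ s : E d, ‖s‖ = 1 →
    (‖s - ξm‖ < δ → μ * ‖s - ξm‖ ^ 2 ≤ V s - V ξm) ∧
    (‖s - ξp‖ < δ → μ * ‖s - ξp‖ ^ 2 ≤ V s - V ξp)

/-- The class `𝒫` as a set of pairs. -/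
def potentialClass (ξm ξp : E d) (Vmin : ℝ) : Set ((E d → ℝ) × ℝ) :=
  {p | IsPotential ξm ξp Vmin p.1 p.2}

/-- `x ∈ H¹((a,b); ℝ^d)`, for the continuous representative on `[a,b]`: `x` is the primitive of
a square integrable function (its weak derivative, which is `deriv x` almost everywhere). -/
def IsH1 (a b : ℝ) (x : ℝ → E d) : Prop :=
  ∃ v : ℝ → E d, MemLp v 2 (volume.restrict (Icc a b)) ∧
    ∀ t ∈ Icc a b, x t = x a + ∫ τ in a..t, v τ

/-- `x ∈ H¹_loc(ℝ; ℝ^d)`. -/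
def IsH1loc (x : ℝ → E d) : Prop := ∀ a b : ℝ, a < b → IsH1 a b x

open Classical in
/-- The potential with values in `[0,∞]`: it is `+∞` at the collision `x = 0`. -/
def singularPotential (V : E d → ℝ) (x : E d) : ℝ≥0∞ :=
  if x = 0 then ⊤ else ENNReal.ofReal (V x)

/-- The (possibly infinite) action `∫_a^b (|x'|²/2 + V(x)) dt`. -/
def action (V : E d → ℝ) (a b : ℝ) (x : ℝ → E d) : ℝ≥0∞ :=
  ∫⁻ t in Icc a b, (ENNReal.ofReal (‖deriv x t‖ ^ 2 / 2) + singularPotential V (x t))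

/-- `c(V)`, the infimum of the action over all `H¹` paths from `ξm` to `ξp`, with free
time interval and with collisions allowed. -/
def bolzaLevel (ξm ξp : E d) (V : E d → ℝ) : ℝ≥0∞ :=
  sInf {A | ∃ (a b : ℝ) (x : ℝ → E d), a < b ∧ IsH1 a b x ∧ x a = ξm ∧ x b = ξp ∧
    A = action V a b x}

/-- The set `In`. -/
def inSet (ξm ξp : E d) (Vmin : ℝ) : Set ((E d → ℝ) × ℝ) :=
  {p | p ∈ potentialClass ξm ξp Vmin ∧
    bolzaLevel ξm ξp p.1 = ENNReal.ofReal (4 * √(2 * Vmin) / (2 - p.2))}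

/-- The set `Out`. -/
def outSet (ξm ξp : E d) (Vmin : ℝ) : Set ((E d → ℝ) × ℝ) :=
  {p | p ∈ potentialClass ξm ξp Vmin ∧
    bolzaLevel ξm ξp p.1 < ENNReal.ofReal (4 * √(2 * Vmin) / (2 - p.2))}

/-- `x` is an `ε`-constrained Morse minimizer for `V`. -/
structure IsConstrainedMorseMin (ξm ξp : E d) (V : E d → ℝ) (ε : ℝ) (x : ℝ → E d) : Prop where
  h1loc : IsH1loc x
  isLeast : IsLeast (range fun t => ‖x t‖) ε
  norm_atTop : Tendsto (fun t => ‖x t‖) atTop atTop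
  norm_atBot : Tendsto (fun t => ‖x t‖) atBot atTop
  dir_atTop : Tendsto (fun t => ‖x t‖⁻¹ • x t) atTop (𝓝 ξp)
  dir_atBot : Tendsto (fun t => ‖x t‖⁻¹ • x t) atBot (𝓝 ξm)
  minimal : ∀ (a b a' b' : ℝ) (z : ℝ → E d), a < b → a' < b' → IsH1 a' b' z →
    z a' = x a → z b' = x b →
    (∃ ρ : ℝ, IsLeast ((fun t => ‖z t‖) '' Icc a' b') ρ ∧
      IsLeast ((fun t => ‖x t‖) '' Icc a b) ρ) →
    action V a b x ≤ action V a' b' z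

/-- `Δ_vel(x)` is well defined and equal to `δ`, for a path `x` with constraint radius `ε`:
the contact set `{|x| = ε}` is a compact interval `[t₁, t₂]` (`t₁ = t_*`, `t₂ = t_**`),
`x` is differentiable off it, the one-sided limits `vm = x'(t₁⁻)` and `vp = x'(t₂⁺)` of the
velocity exist, and `δ = (vp · x(t₂) - vm · x(t₁)) / (ε^(-α/2) ε)`. -/
def HasVelJump (α ε : ℝ) (x : ℝ → E d) (δ : ℝ) : Prop :=
  ∃ (t₁ t₂ : ℝ) (vm vp : E d), t₁ ≤ t₂ ∧ {t | ‖x t‖ = ε} = Icc t₁ t₂ ∧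
    (∀ t ∉ Icc t₁ t₂, DifferentiableAt ℝ x t) ∧
    Tendsto (deriv x) (𝓝[<] t₁) (𝓝 vm) ∧ Tendsto (deriv x) (𝓝[>] t₂) (𝓝 vp) ∧
    δ = (inner ℝ vp (x t₂) - inner ℝ vm (x t₁)) / (ε ^ (-α / 2) * ε)

/-- `δ` is the velocity-jump of the potential: for every `ε > 0` there are `ε`-constrained Morse
minimizers, and each of them has velocity-jump `δ`.  At most one `δ` has this property. -/
def IsVelJump (ξm ξp : E d) (V : E d → ℝ) (α δ : ℝ) : Prop :=
  ∀ ε : ℝ, 0 < ε → (∃ x : ℝ → E d, IsConstrainedMorseMin ξm ξp V ε x) ∧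
    ∀ x : ℝ → E d, IsConstrainedMorseMin ξm ξp V ε x → HasVelJump α ε x δ

/-- `Δ_vel(V)`, the common velocity-jump of all constrained Morse minimizers for `V`. -/
def deltaVel (ξm ξp : E d) (V : E d → ℝ) (α : ℝ) : ℝ :=
  Classical.epsilon (IsVelJump ξm ξp V α)

end ParabolicMin

end

open scoped NNReal

noncomputable section

namespace ParabolicMin

variable {d : ℕ}

/-! ### Paths of class `H¹` -/

/-! Put p = √(2 Vmin) and κ = 1 - α/2. In a direction where V is minimal, the zero-energy homothetic
motion from the origin to radius r costs (p/κ) r^κ, so the threshold 4√(2 Vmin)/(2 - α) = 2p/κ is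
the cost of the path from ξ⁻ to ξ⁺ through the collision. The function (p/κ)|x|^κ satisfies |∇φ|² ≤
2V, and still does after subtracting a small multiple of |x|^κ |x/|x| - ξ|² (`Setting.coneGrad_le`).
The increments of such functions bound the action from below.

Existence. Outside the ball of radius ε the least action is a distance, `reachInf`. Renormalized at
infinity along ξ±, it gives Busemann functions B±, and from every point starts a ray along which B
decreases at unit rate in the action (`Setting.exists_ray`). The two rays issued from a minimum
point of B⁻ + B⁺ on the sphere |x| = ε form a curve calibrated by B⁻ and B⁺; run at zero energy, it
is a constrained minimizer.

The jump. For any constrained minimizer, time rescaling gives |x'|² = 2V, and off the contact set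
x'' = ∇V(x). Hence (x·x')' = 2κV > 0 there. So |x|² has no local maximum off the contact set, which
is therefore an interval; and the Lagrangian 2V is the derivative of x·x'/κ. Since x·x' - p|x|^κ
tends to 0 along suitable times, the action of x minus that of the two homothetic motions has the
limit m = A - δ ε^κ/κ, where A ≥ 0 is the action on the contact interval and δ ≥ 0 the jump. On a
nontrivial contact interval an outward radial variation shows that the exit and entry radial
velocities vanish, so δ = 0; on a trivial one A = 0. Thus δ > 0 gives m = -δ ε^κ/κ, and δ = 0 gives
m ≥ 0 (`Setting.exists_velJump`).

Comparison. A dilation by l multiplies the action by l^κ, and almost radial paths join a point near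
the axis to far points with error quadratic in the angle. Minimality then bounds m by the
renormalized action of any competitor touching the ball (`Setting.exists_renorm_le`). With a dilated
minimizer as competitor, m scales like ε^κ, so δ is common to all minimizers. A path of action below
2p/κ avoids the origin, and dilated it shows m < 0; conversely, shrinking the minimizer gives c(V) ≤
2p/κ + R^(-κ)(m + η) for large R. Hence c(V) ≤ 2p/κ always, with strict inequality iff m < 0 iff δ >
0. -/

lemma ae_restrict_Icc_iff_Ioo {a b : ℝ} {p : ℝ → Prop} :
    (∀ᵐ t ∂(volume.restrict (Icc a b)), p t) ↔ ∀ᵐ t ∂(volume.restrict (Ioo a b)), p t := by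
  rw [Measure.restrict_congr_set Ioo_ae_eq_Icc]

lemma memLp_two_intervalIntegrable {a b s t : ℝ} {v : ℝ → E d}
    (hv : MemLp v 2 (volume.restrict (Icc a b))) (hs : s ∈ Icc a b) (ht : t ∈ Icc a b) :
    IntervalIntegrable v volume s t := by
  have h1 : IntegrableOn v (Icc a b) := hv.integrable (by norm_num)
  rw [intervalIntegrable_iff]
  exact h1.mono_set (uIoc_subset_uIcc.trans (uIcc_subset_Icc hs ht))

lemma ae_hasDerivAt_of_eq_integral {a b : ℝ} {x v : ℝ → E d}
    (hv : MemLp v 2 (volume.restrict (Icc a b)))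
    (hx : ∀ t ∈ Icc a b, x t = x a + ∫ τ in a..t, v τ) :
    ∀ᵐ t ∂(volume.restrict (Icc a b)), HasDerivAt x (v t) t := by
  rcases le_or_gt b a with hab | hab
  · have : volume.restrict (Icc a b) = 0 := by
      rw [Measure.restrict_eq_zero]; simp [hab]
    simp [this]
  have hii := memLp_two_intervalIntegrable hv (left_mem_Icc.2 hab.le) (right_mem_Icc.2 hab.le)
  rw [ae_restrict_Icc_iff_Ioo, ae_restrict_iff' measurableSet_Ioo]
  filter_upwards [hii.ae_hasDerivAt_integral] with t ht hti
  rw [uIcc_of_le hab.le] at ht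
  have h := (ht (Ioo_subset_Icc_self hti) a (left_mem_Icc.2 hab.le)).const_add (x a)
  refine h.congr_of_eventuallyEq ?_
  filter_upwards [Icc_mem_nhds hti.1 hti.2] with s hs using hx s hs

lemma IsH1.ae_hasDerivAt {a b : ℝ} {x : ℝ → E d} (h : IsH1 a b x) :
    ∀ᵐ t ∂(volume.restrict (Icc a b)), HasDerivAt x (deriv x t) t := by
  obtain ⟨v, hv, hx⟩ := h
  filter_upwards [ae_hasDerivAt_of_eq_integral hv hx] with t ht
  rwa [ht.deriv]

lemma deriv_ae_eq_of_eq_integral {a b : ℝ} {x v : ℝ → E d}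
    (hv : MemLp v 2 (volume.restrict (Icc a b)))
    (hx : ∀ t ∈ Icc a b, x t = x a + ∫ τ in a..t, v τ) :
    deriv x =ᵐ[volume.restrict (Icc a b)] v := by
  filter_upwards [ae_hasDerivAt_of_eq_integral hv hx] with t ht using ht.deriv

lemma IsH1.memLp_deriv {a b : ℝ} {x : ℝ → E d} (h : IsH1 a b x) :
    MemLp (deriv x) 2 (volume.restrict (Icc a b)) := by
  obtain ⟨v, hv, hx⟩ := h
  exact (memLp_congr_ae (deriv_ae_eq_of_eq_integral hv hx)).2 hv

lemma integral_congr_ae_Icc {a b s t : ℝ} {F : Type*} [NormedAddCommGroup F] [NormedSpace ℝ F]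
    {v w : ℝ → F} (h : v =ᵐ[volume.restrict (Icc a b)] w) (hs : s ∈ Icc a b)
    (ht : t ∈ Icc a b) : ∫ τ in s..t, v τ = ∫ τ in s..t, w τ := by
  refine intervalIntegral.integral_congr_ae ?_
  rw [Filter.EventuallyEq, ae_restrict_iff' measurableSet_Icc] at h
  filter_upwards [h] with τ h1 h2
  exact h1 (uIcc_subset_Icc hs ht (uIoc_subset_uIcc h2))

lemma IsH1.sub_eq {a b : ℝ} {x : ℝ → E d} (h : IsH1 a b x) {s t : ℝ}
    (hs : s ∈ Icc a b) (ht : t ∈ Icc a b) : x t - x s = ∫ τ in s..t, deriv x τ := by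
  have hm := h.memLp_deriv
  obtain ⟨v, hv, hx⟩ := h
  have ha : a ∈ Icc a b := left_mem_Icc.2 (hs.1.trans hs.2)
  rw [integral_congr_ae_Icc (deriv_ae_eq_of_eq_integral hv hx) hs ht, hx t ht, hx s hs,
    ← intervalIntegral.integral_add_adjacent_intervals
      (memLp_two_intervalIntegrable hv ha hs) (memLp_two_intervalIntegrable hv hs ht)]
  abel

/-- A working form of `IsH1`. -/
lemma isH1_of_sub_eq {a b : ℝ} {x v : ℝ → E d} (hv : MemLp v 2 (volume.restrict (Icc a b)))
    (hx : ∀ t ∈ Icc a b, x t - x a = ∫ τ in a..t, v τ) : IsH1 a b x :=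
  ⟨v, hv, fun t ht => by rw [← hx t ht]; abel⟩

lemma IsH1.mono {a b a' b' : ℝ} {x : ℝ → E d} (h : IsH1 a b x) (h1 : a ≤ a') (h2 : b' ≤ b) :
    IsH1 a' b' x := by
  refine isH1_of_sub_eq (v := deriv x)
    (h.memLp_deriv.mono_measure (Measure.restrict_mono (Icc_subset_Icc h1 h2) le_rfl)) ?_
  intro t ht
  exact h.sub_eq ⟨h1, ht.1.trans (ht.2.trans h2)⟩ ⟨h1.trans ht.1, ht.2.trans h2⟩

lemma IsH1.congr {a b : ℝ} {x y : ℝ → E d} (h : IsH1 a b x) (hxy : EqOn x y (Icc a b)) :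
    IsH1 a b y := by
  obtain ⟨v, hv, hx⟩ := h
  refine ⟨v, hv, fun t ht => ?_⟩
  rw [← hxy ht, ← hxy (left_mem_Icc.2 (ht.1.trans ht.2)), hx t ht]

lemma IsH1.continuousOn {a b : ℝ} {x : ℝ → E d} (h : IsH1 a b x) : ContinuousOn x (Icc a b) := by
  rcases lt_or_ge b a with hab | hab
  · simp [Icc_eq_empty_of_lt hab]
  obtain ⟨v, hv, hx⟩ := h
  have h1 : IntegrableOn v (Icc a b) := hv.integrable (by norm_num)
  have := intervalIntegral.continuousOn_primitive_interval (f := v) (μ := volume) (a := a) (b := b)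
    (by rwa [uIcc_of_le hab])
  rw [uIcc_of_le hab] at this
  exact (continuousOn_const.add this).congr hx

lemma IsH1.union {a b c : ℝ} {x : ℝ → E d} (h1 : IsH1 a b x) (h2 : IsH1 b c x) (hab : a ≤ b)
    (hbc : b ≤ c) : IsH1 a c x := by
  have hm : MemLp (deriv x) 2 (volume.restrict (Icc a c)) := by
    have hmeas : ∀ μ : Measure ℝ, AEStronglyMeasurable (deriv x) μ := fun μ =>
      (stronglyMeasurable_deriv x).aestronglyMeasurable
    rw [memLp_two_iff_integrable_sq_norm (hmeas _), ← Icc_union_Icc_eq_Icc hab hbc]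
    have i1 : IntegrableOn (fun t => ‖deriv x t‖ ^ 2) (Icc a b) :=
      (memLp_two_iff_integrable_sq_norm (hmeas _)).1 h1.memLp_deriv
    have i2 : IntegrableOn (fun t => ‖deriv x t‖ ^ 2) (Icc b c) :=
      (memLp_two_iff_integrable_sq_norm (hmeas _)).1 h2.memLp_deriv
    exact i1.union i2
  refine isH1_of_sub_eq (v := deriv x) hm ?_
  intro t ht
  rcases le_total t b with htb | htb
  · exact h1.sub_eq (left_mem_Icc.2 hab) ⟨ht.1, htb⟩
  · rw [← intervalIntegral.integral_add_adjacent_intervals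
      (memLp_two_intervalIntegrable hm (left_mem_Icc.2 (hab.trans hbc)) ⟨hab, hbc⟩)
      (memLp_two_intervalIntegrable hm ⟨hab, hbc⟩ ht),
      ← h1.sub_eq (left_mem_Icc.2 hab) (right_mem_Icc.2 hab),
      ← h2.sub_eq (left_mem_Icc.2 hbc) ⟨htb, ht.2⟩]
    abel

lemma IsH1.add_smul {a b : ℝ} {x y : ℝ → E d} (hx : IsH1 a b x) (hy : IsH1 a b y) (s : ℝ) :
    IsH1 a b (fun t => x t + s • y t) := by
  refine isH1_of_sub_eq (v := fun t => deriv x t + s • deriv y t)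
    (hx.memLp_deriv.add (hy.memLp_deriv.const_smul s)) ?_
  intro t ht
  have ha : a ∈ Icc a b := left_mem_Icc.2 (ht.1.trans ht.2)
  have e := intervalIntegral.integral_add (memLp_two_intervalIntegrable hx.memLp_deriv ha ht)
    ((memLp_two_intervalIntegrable hy.memLp_deriv ha ht).smul s)
  simp only [Pi.smul_apply] at e
  rw [e, intervalIntegral.integral_smul,
    ← hx.sub_eq ha ht, ← hy.sub_eq ha ht, smul_sub]
  abel

lemma IsH1.comp_affine {a b : ℝ} {x : ℝ → E d} (h : IsH1 a b x) {c : ℝ} (hc : c ≠ 0)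
    (e l : ℝ) {a' b' : ℝ} (hmap : MapsTo (fun t => c * t + e) (Icc a' b') (Icc a b)) :
    IsH1 a' b' (fun t => l • x (c * t + e)) := by
  have hm := h.memLp_deriv
  have hsub : Icc a' b' ⊆ (fun t => c * t + e) ⁻¹' (Icc a b) := hmap
  have hme : MeasurableEmbedding (fun t : ℝ => c * t + e) :=
    ((Homeomorph.mulLeft₀ c hc).trans (Homeomorph.addRight e)).measurableEmbedding
  have hmap' : (volume.map (fun t : ℝ => c * t + e)) = ENNReal.ofReal |c⁻¹| • volume := by
    have : (fun t : ℝ => c * t + e) = (fun t => t + e) ∘ (fun t => c * t) := rfl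
    rw [this, ← Measure.map_map (measurable_add_const e) (measurable_const_mul c),
      Real.map_volume_mul_left hc, Measure.map_smul, map_add_right_eq_self]
  have hv : MemLp (fun t => (l * c) • deriv x (c * t + e)) 2 (volume.restrict (Icc a' b')) := by
    have h1 : MemLp (deriv x) 2 ((volume.restrict ((fun t => c * t + e) ⁻¹' (Icc a b))).map
        (fun t : ℝ => c * t + e)) := by
      rw [← hme.restrict_map, hmap', Measure.restrict_smul]
      exact hm.smul_measure ENNReal.ofReal_ne_top
    have h2 := hme.memLp_map_measure_iff.1 h1
    exact (h2.mono_measure (Measure.restrict_mono hsub le_rfl)).const_smul (l * c)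
  refine isH1_of_sub_eq hv ?_
  intro t ht
  have ha : a' ∈ Icc a' b' := left_mem_Icc.2 (ht.1.trans ht.2)
  rw [intervalIntegral.integral_smul, mul_smul,
    intervalIntegral.smul_integral_comp_mul_add (fun τ => deriv x τ) c e,
    ← h.sub_eq (hmap ha) (hmap ht), smul_sub]

/-! ### The action -/

/-- The integrand contains `deriv`, which depends on a neighbourhood, so the comparison is made at
interior points; the endpoints are null. -/
lemma action_congr {V : E d → ℝ} {a b : ℝ} {x y : ℝ → E d} (h : EqOn x y (Ioo a b)) :
    action V a b x = action V a b y := by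
  unfold action
  rw [setLIntegral_congr Ioo_ae_eq_Icc.symm, setLIntegral_congr Ioo_ae_eq_Icc.symm]
  refine setLIntegral_congr_fun measurableSet_Ioo ?_
  intro t ht
  have : x =ᶠ[𝓝 t] y := by
    filter_upwards [Ioo_mem_nhds ht.1 ht.2] with s hs using h hs
  simp only [this.deriv_eq, h ht]

lemma action_add {V : E d → ℝ} {a b c : ℝ} {x : ℝ → E d} (hab : a ≤ b) (hbc : b ≤ c) :
    action V a c x = action V a b x + action V b c x := by
  unfold action
  rw [setLIntegral_congr Ico_ae_eq_Icc.symm, setLIntegral_congr (Ico_ae_eq_Icc (a := a)).symm,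
    setLIntegral_congr (Ico_ae_eq_Icc (a := b)).symm,
    ← lintegral_union measurableSet_Ico (Ico_disjoint_Ico_same), Ico_union_Ico_eq_Ico hab hbc]

lemma action_mono {V : E d → ℝ} {a b a' b' : ℝ} {x : ℝ → E d} (h1 : a ≤ a') (h2 : b' ≤ b) :
    action V a' b' x ≤ action V a b x :=
  lintegral_mono_set (Icc_subset_Icc h1 h2)

/-! ### Absolute continuity -/

/-- Increments dominated by those of an absolutely continuous function; in most uses `g` is a
primitive of a norm of velocities. -/
lemma absolutelyContinuousOnInterval_of_dist_le {X Y : Type*} [PseudoMetricSpace X]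
    [PseudoMetricSpace Y] {f : ℝ → X} {g : ℝ → Y} {a b K : ℝ} (hK : 0 ≤ K)
    (hg : AbsolutelyContinuousOnInterval g a b)
    (h : ∀ s ∈ uIcc a b, ∀ t ∈ uIcc a b, dist (f s) (f t) ≤ K * dist (g s) (g t)) :
    AbsolutelyContinuousOnInterval f a b := by
  rw [absolutelyContinuousOnInterval_iff] at hg ⊢
  intro ε hε
  obtain ⟨δ, hδ, hd⟩ := hg (ε / (K + 1)) (by positivity)
  refine ⟨δ, hδ, fun I hI hs => ?_⟩
  calc ∑ i ∈ Finset.range I.1, dist (f (I.2 i).1) (f (I.2 i).2)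
      ≤ ∑ i ∈ Finset.range I.1, K * dist (g (I.2 i).1) (g (I.2 i).2) :=
        Finset.sum_le_sum fun i hi => h _ (hI.left i hi).left _ (hI.left i hi).right
    _ = K * ∑ i ∈ Finset.range I.1, dist (g (I.2 i).1) (g (I.2 i).2) := by
        rw [Finset.mul_sum]
    _ ≤ K * (ε / (K + 1)) := by gcongr; exact (hd I hI hs).le
    _ < (K + 1) * (ε / (K + 1)) := by gcongr; linarith
    _ = ε := by field_simp

lemma IsH1.absolutelyContinuous_of_lipschitz {X : Type*} [PseudoMetricSpace X] {a b : ℝ}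
    (hab : a ≤ b) {x : ℝ → E d} (h : IsH1 a b x) {φ : E d → X} {K : ℝ} (hK : 0 ≤ K)
    (hφ : ∀ s ∈ Icc a b, ∀ t ∈ Icc a b, dist (φ (x s)) (φ (x t)) ≤ K * dist (x s) (x t)) :
    AbsolutelyContinuousOnInterval (fun t => φ (x t)) a b := by
  have ha : a ∈ Icc a b := left_mem_Icc.2 hab
  have hi := memLp_two_intervalIntegrable h.memLp_deriv ha (right_mem_Icc.2 hab)
  have hac := hi.norm.absolutelyContinuousOnInterval_intervalIntegral (c := a) (by simp)
  refine absolutelyContinuousOnInterval_of_dist_le hK hac ?_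
  rw [uIcc_of_le hab]
  intro s hs t ht
  refine (hφ s hs t ht).trans (mul_le_mul_of_nonneg_left ?_ hK)
  have hn : ∀ u ∈ Icc a b, ∀ w ∈ Icc a b, IntervalIntegrable (fun τ => ‖deriv x τ‖) volume u w :=
    fun u hu w hw => (memLp_two_intervalIntegrable h.memLp_deriv hu hw).norm
  rw [dist_eq_norm, dist_eq_norm, h.sub_eq ht hs,
    intervalIntegral.integral_interval_sub_left (hn a ha s hs) (hn a ha t ht)]
  exact intervalIntegral.norm_integral_le_abs_integral_norm

/-- Each coordinate is Lipschitz, hence absolutely continuous, and is the primitive of its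
derivative. Limit curves are known only to be Lipschitz, so this is how they enter H¹. -/
lemma isH1_of_lipschitz {a b : ℝ} {x : ℝ → E d} {K : ℝ}
    (h : ∀ s ∈ Icc a b, ∀ t ∈ Icc a b, ‖x s - x t‖ ≤ K * |s - t|) : IsH1 a b x := by
  rcases le_or_gt b a with hab | hab
  · refine isH1_of_sub_eq (v := 0) MemLp.zero fun t ht => ?_
    have : t = a := le_antisymm (ht.2.trans hab) ht.1
    simp [this]
  have hK : 0 ≤ K := by
    have := (norm_nonneg _).trans (h b (right_mem_Icc.2 hab.le) a (left_mem_Icc.2 hab.le))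
    have h2 : 0 < |b - a| := abs_pos.2 (by linarith)
    exact nonneg_of_mul_nonneg_left this h2
  have hi : ∀ i : Fin d, AbsolutelyContinuousOnInterval (fun t => x t i) a b := by
    intro i
    refine absolutelyContinuousOnInterval_of_dist_le (g := fun t : ℝ => t) hK
      (LipschitzWith.id.lipschitzOnWith.absolutelyContinuousOnInterval) ?_
    rw [uIcc_of_le hab.le]
    intro s hs t ht
    rw [Real.dist_eq, Real.dist_eq, ← PiLp.sub_apply]
    exact (PiLp.norm_apply_le (x s - x t) i).trans (h s hs t ht)
  have hdiff : ∀ᵐ t ∂(volume.restrict (Icc a b)), ∀ i : Fin d,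
      DifferentiableAt ℝ (fun t => x t i) t := by
    rw [ae_all_iff]
    intro i
    rw [ae_restrict_iff' measurableSet_Icc]
    have := (hi i).ae_differentiableAt
    rwa [uIcc_of_le hab.le] at this
  have hdx : ∀ᵐ t ∂(volume.restrict (Icc a b)), DifferentiableAt ℝ x t := by
    filter_upwards [hdiff] with t ht
    exact differentiableAt_euclidean.2 ht
  have hcomp : ∀ᵐ t ∂(volume.restrict (Icc a b)), ∀ i : Fin d,
      deriv x t i = deriv (fun t => x t i) t := by
    filter_upwards [hdx] with t ht i
    exact (((EuclideanSpace.proj (𝕜 := ℝ) i).hasFDerivAt.comp_hasDerivAt t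
      ht.hasDerivAt).deriv).symm
  have hbound : ∀ᵐ t ∂(volume.restrict (Icc a b)), ‖deriv x t‖ ≤ K := by
    rw [ae_restrict_Icc_iff_Ioo, ae_restrict_iff' measurableSet_Ioo]
    refine Eventually.of_forall fun t ht => ?_
    refine norm_deriv_le_of_lip' hK ?_
    filter_upwards [Icc_mem_nhds ht.1 ht.2] with s hs
    exact h s hs t (Ioo_subset_Icc_self ht)
  have hm : MemLp (deriv x) 2 (volume.restrict (Icc a b)) :=
    MemLp.of_bound (stronglyMeasurable_deriv x).aestronglyMeasurable K hbound
  refine isH1_of_sub_eq hm ?_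
  intro t ht
  have ha : a ∈ Icc a b := left_mem_Icc.2 hab.le
  ext i
  have h1 : (∫ τ in a..t, deriv x τ) i = ∫ τ in a..t, deriv x τ i :=
    ((EuclideanSpace.proj (𝕜 := ℝ) i).intervalIntegral_comp_comm
      (memLp_two_intervalIntegrable hm ha ht)).symm
  rw [h1, integral_congr_ae_Icc (a := a) (b := b) (w := fun τ => deriv (fun t => x t i) τ)
    (by filter_upwards [hcomp] with τ hτ using hτ i) ha ht,
    ((hi i).mono (by rw [uIcc_of_le hab.le, uIcc_of_le ht.1]; exact Icc_subset_Icc le_rfl ht.2)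
      ).integral_deriv_eq_sub]
  simp

/-! ### Calibration, and changes of variables in the action. -/

lemma ofReal_integral_le_lintegral {μ : Measure ℝ} (f : ℝ → ℝ) :
    ENNReal.ofReal (∫ t, f t ∂μ) ≤ ∫⁻ t, ENNReal.ofReal (f t) ∂μ := by
  by_cases hf : Integrable f μ
  · calc ENNReal.ofReal (∫ t, f t ∂μ) ≤ ENNReal.ofReal (∫ t, max (f t) 0 ∂μ) :=
        ENNReal.ofReal_le_ofReal (integral_mono hf hf.pos_part fun t => le_max_left _ _)
      _ = ∫⁻ t, ENNReal.ofReal (max (f t) 0) ∂μ :=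
        ofReal_integral_eq_lintegral_ofReal hf.pos_part (ae_of_all _ fun t => le_max_right _ _)
      _ = ∫⁻ t, ENNReal.ofReal (f t) ∂μ := by simp [ENNReal.ofReal_max]
  · simp [integral_undef hf]

/-- Lower bound of increments of a function along an `H¹` path by the action. -/
lemma ofReal_sub_le_action {V : E d → ℝ} {φ : E d → ℝ} {φ' : E d → E d} {a b : ℝ} (hab : a ≤ b)
    {x : ℝ → E d} (h : IsH1 a b x) (hx : ∀ t ∈ Icc a b, x t ≠ 0)
    (hφc : ContDiffOn ℝ 1 φ {0}ᶜ)
    (hφ : ∀ t ∈ Icc a b, HasGradientAt φ (φ' (x t)) (x t))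
    (hV : ∀ t ∈ Icc a b, ‖φ' (x t)‖ ^ 2 ≤ 2 * V (x t)) :
    ENNReal.ofReal (φ (x b) - φ (x a)) ≤ action V a b x := by
  have hcomp : IsCompact (x '' Icc a b) := isCompact_Icc.image_of_continuousOn h.continuousOn
  have hloc : LocallyLipschitzOn (x '' Icc a b) φ := by
    intro y hy
    obtain ⟨t, ht, rfl⟩ := hy
    obtain ⟨K, s, hs, hK⟩ := (hφc.contDiffAt (isOpen_compl_singleton.mem_nhds (hx t ht))).exists_lipschitzOnWith
    exact ⟨K, s, mem_nhdsWithin_of_mem_nhds hs, hK⟩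
  obtain ⟨K, hK⟩ := hloc.exists_lipschitzOnWith_of_compact hcomp
  have hac := h.absolutelyContinuous_of_lipschitz hab (φ := φ) K.2 (fun s hs t ht =>
    hK.dist_le_mul _ (mem_image_of_mem x hs) _ (mem_image_of_mem x ht))
  rw [← hac.integral_deriv_eq_sub, intervalIntegral.integral_of_le hab,
    ← integral_Icc_eq_integral_Ioc]
  refine (ofReal_integral_le_lintegral _).trans (lintegral_mono_ae ?_)
  filter_upwards [h.ae_hasDerivAt, ae_restrict_mem measurableSet_Icc] with t hd ht
  have hd2 : HasDerivAt (fun t => φ (x t)) (inner ℝ (φ' (x t)) (deriv x t)) t := by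
    have := (hφ t ht).hasFDerivAt.comp_hasDerivAt t hd
    simp only [InnerProductSpace.toDual_apply_apply] at this
    exact this
  have h1 := hV t ht
  have hV0 : 0 ≤ V (x t) := by nlinarith [sq_nonneg ‖φ' (x t)‖]
  rw [hd2.deriv, singularPotential, if_neg (hx t ht), ← ENNReal.ofReal_add (by positivity) hV0]
  refine ENNReal.ofReal_le_ofReal ?_
  -- Young's inequality: ⟨∇φ, x'⟩ ≤ |∇φ|²/2 + |x'|²/2 ≤ V + |x'|²/2.
  have h2 := real_inner_le_norm (φ' (x t)) (deriv x t)
  nlinarith [sq_nonneg (‖φ' (x t)‖ - ‖deriv x t‖)]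

/-- The kinetic term scales by (l c)²; `hV` asks the same of V, so the whole Lagrangian scales, and
the time change contributes 1/|c|. Translations and time reversal are l = 1, c = ±1; dilations use
the homogeneity of V. -/
lemma action_comp_affine {V : E d → ℝ} {c l : ℝ} (hc : c ≠ 0) (hl : 0 < l) (e : ℝ)
    (hV : ∀ x : E d, x ≠ 0 → V (l • x) = (l * c) ^ 2 * V x) {a b a' b' : ℝ} (x : ℝ → E d)
    (hab : (fun t => c * t + e) ⁻¹' (Icc a b) = Icc a' b') :
    action V a' b' (fun t => l • x (c * t + e)) =
      ENNReal.ofReal ((l * c) ^ 2 / |c|) * action V a b x := by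
  have hme : MeasurableEmbedding (fun t : ℝ => c * t + e) :=
    ((Homeomorph.mulLeft₀ c hc).trans (Homeomorph.addRight e)).measurableEmbedding
  have hmap' : (volume.map (fun t : ℝ => c * t + e)) = ENNReal.ofReal |c⁻¹| • volume := by
    have : (fun t : ℝ => c * t + e) = (fun t => t + e) ∘ (fun t => c * t) := rfl
    rw [this, ← Measure.map_map (measurable_add_const e) (measurable_const_mul c),
      Real.map_volume_mul_left hc, Measure.map_smul, map_add_right_eq_self]
  have hderiv : ∀ t, deriv (fun t => l • x (c * t + e)) t = (l * c) • deriv x (c * t + e) := by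
    intro t
    rw [deriv_fun_const_smul_field, mul_smul]
    congr 1
    have h1 : deriv (fun t => (fun s => x (s + e)) (c * t)) t = c • deriv x (c * t + e) := by
      rw [deriv_comp_mul_left c (fun s => x (s + e)) t, deriv_comp_add_const]
    exact h1
  have key : ∀ t, ENNReal.ofReal (‖deriv (fun t => l • x (c * t + e)) t‖ ^ 2 / 2) +
      singularPotential V (l • x (c * t + e)) = ENNReal.ofReal ((l * c) ^ 2) *
      (ENNReal.ofReal (‖deriv x (c * t + e)‖ ^ 2 / 2) + singularPotential V (x (c * t + e))) := by
    intro t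
    have hlc : 0 < (l * c) ^ 2 := by positivity
    rw [mul_add, ← ENNReal.ofReal_mul hlc.le, hderiv]
    congr 1
    · congr 1
      rw [norm_smul, Real.norm_eq_abs, mul_pow, sq_abs]; ring
    · unfold singularPotential
      by_cases h0 : x (c * t + e) = 0
      · simp only [h0, smul_zero, if_true]
        rw [ENNReal.mul_top (ENNReal.ofReal_pos.2 hlc).ne']
      · rw [if_neg h0, if_neg (smul_ne_zero hl.ne' h0), hV _ h0, ENNReal.ofReal_mul hlc.le]
  unfold action
  simp_rw [key]
  rw [lintegral_const_mul' _ _ ENNReal.ofReal_ne_top, ← hab]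
  have h2 := hme.lintegral_map (μ := volume.restrict ((fun t => c * t + e) ⁻¹' (Icc a b)))
    (fun s => ENNReal.ofReal (‖deriv x s‖ ^ 2 / 2) + singularPotential V (x s))
  rw [← h2, ← hme.restrict_map, hmap', Measure.restrict_smul, lintegral_smul_measure,
    smul_eq_mul, ← mul_assoc, ← ENNReal.ofReal_mul (by positivity), abs_inv, div_eq_mul_inv]

lemma action_comp_add {V : E d → ℝ} (a b e : ℝ) (x : ℝ → E d) :
    action V a b (fun t => x (t + e)) = action V (a + e) (b + e) x := by
  have h := action_comp_affine (V := V) (c := 1) (l := 1) one_ne_zero one_pos e (by simp)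
    (a := a + e) (b := b + e) (a' := a) (b' := b) x (by ext t; simp)
  simpa using h

lemma action_comp_neg {V : E d → ℝ} (a b : ℝ) (x : ℝ → E d) :
    action V a b (fun t => x (-t)) = action V (-b) (-a) x := by
  have h := action_comp_affine (V := V) (c := -1) (l := 1) (by simp) one_pos 0 (by simp)
    (a := -b) (b := -a) (a' := a) (b' := b) x (by
      ext t
      simp only [mem_preimage, mem_Icc]
      constructor <;> rintro ⟨h1, h2⟩ <;> constructor <;> linarith)
  simpa using h

lemma IsH1.comp_add {a b : ℝ} {x : ℝ → E d} (e : ℝ) (h : IsH1 (a + e) (b + e) x) :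
    IsH1 a b (fun t => x (t + e)) := by
  have := h.comp_affine one_ne_zero e 1 (a' := a) (b' := b) (fun t ht => by
    constructor <;> [linarith [ht.1]; linarith [ht.2]])
  simpa using this

lemma IsH1.comp_neg {a b : ℝ} {x : ℝ → E d} (h : IsH1 (-b) (-a) x) :
    IsH1 a b (fun t => x (-t)) := by
  have := h.comp_affine (c := -1) (by simp) 0 1 (a' := a) (b' := b) (fun t ht => by
    constructor <;> [linarith [ht.2]; linarith [ht.1]])
  simpa using this

lemma intervalIntegrable_lagrangian {V : E d → ℝ} (hVc : ContinuousOn V {0}ᶜ) {a b : ℝ}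
    (hab : a ≤ b) {x : ℝ → E d} (h : IsH1 a b x) (hx : ∀ t ∈ Icc a b, x t ≠ 0) :
    IntervalIntegrable (fun t => ‖deriv x t‖ ^ 2 / 2) volume a b ∧
      IntervalIntegrable (fun t => V (x t)) volume a b := by
  constructor
  · rw [intervalIntegrable_iff_integrableOn_Icc_of_le hab]
    exact ((memLp_two_iff_integrable_sq_norm
      (stronglyMeasurable_deriv x).aestronglyMeasurable).1 h.memLp_deriv).div_const 2
  · refine ContinuousOn.intervalIntegrable ?_
    rw [uIcc_of_le hab]
    exact hVc.comp h.continuousOn hx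

lemma action_eq_ofReal {V : E d → ℝ} (hVc : ContinuousOn V {0}ᶜ) (hV0 : ∀ x, x ≠ 0 → 0 ≤ V x)
    {a b : ℝ} (hab : a ≤ b) {x : ℝ → E d} (h : IsH1 a b x) (hx : ∀ t ∈ Icc a b, x t ≠ 0) :
    action V a b x = ENNReal.ofReal (∫ t in a..b, (‖deriv x t‖ ^ 2 / 2 + V (x t))) := by
  obtain ⟨h1, h2⟩ := intervalIntegrable_lagrangian hVc hab h hx
  have h3 := h1.add h2
  rw [intervalIntegrable_iff_integrableOn_Icc_of_le hab] at h3
  rw [intervalIntegral.integral_of_le hab, ← integral_Icc_eq_integral_Ioc,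
    ofReal_integral_eq_lintegral_ofReal h3]
  · refine lintegral_congr_ae ?_
    filter_upwards [ae_restrict_mem measurableSet_Icc] with t ht
    rw [singularPotential, if_neg (hx t ht), ← ENNReal.ofReal_add (by positivity) (hV0 _ (hx t ht))]
  · filter_upwards [ae_restrict_mem measurableSet_Icc] with t ht
    have := hV0 _ (hx t ht)
    simp only [Pi.zero_apply]
    positivity

lemma action_ne_top {V : E d → ℝ} (hVc : ContinuousOn V {0}ᶜ) (hV0 : ∀ x, x ≠ 0 → 0 ≤ V x)
    {a b : ℝ} (hab : a ≤ b) {x : ℝ → E d} (h : IsH1 a b x) (hx : ∀ t ∈ Icc a b, x t ≠ 0) :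
    action V a b x ≠ ⊤ := by
  rw [action_eq_ofReal hVc hV0 hab h hx]; exact ENNReal.ofReal_ne_top

/-! ### Connecting points outside a ball -/

/-- There is a path from `y` to `z` that stays outside the open ball of radius `ε` and has action
at most `A`. -/
def Reach (V : E d → ℝ) (ε : ℝ) (y z : E d) (A : ℝ) : Prop :=
  ∃ (a b : ℝ) (x : ℝ → E d), a < b ∧ IsH1 a b x ∧ x a = y ∧ x b = z ∧
    (∀ t ∈ Icc a b, ε ≤ ‖x t‖) ∧ action V a b x ≤ ENNReal.ofReal A

/-- There is a path from `y` to `z` that stays outside the open ball of radius `ε`, touches that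
ball, and has action at most `A`. -/
def TouchReach (V : E d → ℝ) (ε : ℝ) (y z : E d) (A : ℝ) : Prop :=
  ∃ (a b : ℝ) (x : ℝ → E d), a < b ∧ IsH1 a b x ∧ x a = y ∧ x b = z ∧
    IsLeast ((fun t => ‖x t‖) '' Icc a b) ε ∧ action V a b x ≤ ENNReal.ofReal A

lemma Reach.touch_left {V : E d → ℝ} {ε : ℝ} {y z : E d} {A : ℝ} (h : Reach V ε y z A)
    (hy : ‖y‖ = ε) : TouchReach V ε y z A := by
  obtain ⟨a, b, x, hab, hx, h1, h2, h3, h4⟩ := h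
  refine ⟨a, b, x, hab, hx, h1, h2, ⟨⟨a, left_mem_Icc.2 hab.le, by simp [h1, hy]⟩, ?_⟩, h4⟩
  rintro _ ⟨t, ht, rfl⟩
  exact h3 t ht

lemma Reach.le {V : E d → ℝ} {ε ε' : ℝ} {y z : E d} {A A' : ℝ} (h : Reach V ε y z A)
    (hε : ε' ≤ ε) (hA : A ≤ A') : Reach V ε' y z A' := by
  obtain ⟨a, b, x, hab, hx, h1, h2, h3, h4⟩ := h
  exact ⟨a, b, x, hab, hx, h1, h2, fun t ht => hε.trans (h3 t ht),
    h4.trans (ENNReal.ofReal_le_ofReal hA)⟩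

/-- Concatenation of two paths. -/
lemma exists_concat (V : E d → ℝ) {a b a' b' : ℝ} {x x' : ℝ → E d} (hab : a < b) (hab' : a' < b')
    (hx : IsH1 a b x) (hx' : IsH1 a' b' x') (h : x b = x' a') :
    ∃ (c : ℝ) (z : ℝ → E d), b < c ∧ IsH1 a c z ∧ EqOn z x (Icc a b) ∧ z c = x' b' ∧
      (∀ t ∈ Icc b c, ∃ s ∈ Icc a' b', z t = x' s) ∧
      action V a c z = action V a b x + action V a' b' x' := by
  set e := a' - b with he
  set z : ℝ → E d := fun t => if t ≤ b then x t else x' (t + e) with hz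
  have e1 : EqOn z x (Icc a b) := fun t ht => by simp [hz, ht.2]
  have e2 : EqOn z (fun t => x' (t + e)) (Icc b (b' - e)) := by
    intro t ht
    rcases eq_or_lt_of_le ht.1 with rfl | hlt
    · simp [hz, he, h]
    · simp [hz, not_le.2 hlt]
  have hbc : b < b' - e := by rw [he]; linarith
  have h1 : IsH1 a b z := hx.congr e1.symm
  have h2 : IsH1 b (b' - e) z := by
    refine IsH1.congr (IsH1.comp_add e ?_) e2.symm
    simpa [he] using hx'
  refine ⟨b' - e, z, hbc, h1.union h2 hab.le hbc.le, e1, ?_, ?_, ?_⟩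
  · rw [e2 (right_mem_Icc.2 hbc.le)]; simp
  · intro t ht
    exact ⟨t + e, ⟨by linarith [ht.1], by linarith [ht.2]⟩, e2 ht⟩
  · rw [action_add hab.le hbc.le, action_congr (e1.mono Ioo_subset_Icc_self),
      action_congr (e2.mono Ioo_subset_Icc_self), action_comp_add]
    simp [he]

lemma Reach.trans {V : E d → ℝ} {ε : ℝ} {y z w : E d} {A B : ℝ} (hA : 0 ≤ A) (hB : 0 ≤ B)
    (h : Reach V ε y z A) (h' : Reach V ε z w B) : Reach V ε y w (A + B) := by
  obtain ⟨a, b, x, hab, hx, h1, h2, h3, h4⟩ := h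
  obtain ⟨a', b', x', hab', hx', h1', h2', h3', h4'⟩ := h'
  obtain ⟨c, u, hbc, hu, e1, e2, e3, e4⟩ := exists_concat V hab hab' hx hx' (h2.trans h1'.symm)
  refine ⟨a, c, u, hab.trans hbc, hu, ?_, e2.trans h2', ?_, ?_⟩
  · rw [e1 (left_mem_Icc.2 hab.le), h1]
  · intro t ht
    rcases le_total t b with htb | htb
    · rw [e1 ⟨ht.1, htb⟩]; exact h3 t ⟨ht.1, htb⟩
    · obtain ⟨s, hs, hst⟩ := e3 t ⟨htb, ht.2⟩
      rw [hst]; exact h3' s hs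
  · rw [e4, ENNReal.ofReal_add hA hB]; exact add_le_add h4 h4'

lemma TouchReach.trans {V : E d → ℝ} {ε : ℝ} {y z w : E d} {A B : ℝ} (hA : 0 ≤ A) (hB : 0 ≤ B)
    (h : TouchReach V ε y z A) (h' : Reach V ε z w B) : TouchReach V ε y w (A + B) := by
  obtain ⟨a, b, x, hab, hx, h1, h2, h3, h4⟩ := h
  obtain ⟨a', b', x', hab', hx', h1', h2', h3', h4'⟩ := h'
  obtain ⟨c, u, hbc, hu, e1, e2, e3, e4⟩ := exists_concat V hab hab' hx hx' (h2.trans h1'.symm)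
  refine ⟨a, c, u, hab.trans hbc, hu, ?_, e2.trans h2', ⟨?_, ?_⟩, ?_⟩
  · rw [e1 (left_mem_Icc.2 hab.le), h1]
  · obtain ⟨t, ht, hte⟩ := h3.1
    exact ⟨t, ⟨ht.1, ht.2.trans hbc.le⟩, by simpa [e1 ht] using hte⟩
  · rintro _ ⟨t, ht, rfl⟩
    rcases le_total t b with htb | htb
    · have := h3.2 (mem_image_of_mem _ (⟨ht.1, htb⟩ : t ∈ Icc a b))
      simpa [e1 ⟨ht.1, htb⟩] using this
    · obtain ⟨s, hs, hst⟩ := e3 t ⟨htb, ht.2⟩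
      simp only [hst]; exact h3' s hs
  · rw [e4, ENNReal.ofReal_add hA hB]; exact add_le_add h4 h4'

lemma Reach.symm {V : E d → ℝ} {ε : ℝ} {y z : E d} {A : ℝ} (h : Reach V ε y z A) :
    Reach V ε z y A := by
  obtain ⟨a, b, x, hab, hx, h1, h2, h3, h4⟩ := h
  refine ⟨-b, -a, fun t => x (-t), by linarith, IsH1.comp_neg (by simpa using hx), by simpa,
    by simpa, fun t ht => h3 _ ⟨by linarith [ht.2], by linarith [ht.1]⟩, ?_⟩
  rw [action_comp_neg]; simpa using h4

lemma TouchReach.symm {V : E d → ℝ} {ε : ℝ} {y z : E d} {A : ℝ} (h : TouchReach V ε y z A) :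
    TouchReach V ε z y A := by
  obtain ⟨a, b, x, hab, hx, h1, h2, h3, h4⟩ := h
  refine ⟨-b, -a, fun t => x (-t), by linarith, IsH1.comp_neg (by simpa using hx), by simpa,
    by simpa, ?_, ?_⟩
  · have : (fun t => ‖x (-t)‖) '' Icc (-b) (-a) = (fun t => ‖x t‖) '' Icc a b := by
      have e : (fun t => ‖x (-t)‖) = (fun t => ‖x t‖) ∘ (fun t => -t) := rfl
      rw [e, image_comp]; simp
    rwa [this]
  · rw [action_comp_neg]; simpa using h4

/-! ### The potential -/

/-- A potential of the class `𝒫` together with the constants `p = √(2 Vmin)`, `κ = 1 - α/2`. -/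
structure Setting (ξm ξp : E d) (Vmin : ℝ) (V : E d → ℝ) (α p κ : ℝ) : Prop where
  pot : IsPotential ξm ξp Vmin V α
  norm_ξm : ‖ξm‖ = 1
  norm_ξp : ‖ξp‖ = 1
  Vmin_pos : 0 < Vmin
  p_pos : 0 < p
  p_sq : p ^ 2 = 2 * Vmin
  κ_eq : κ = 1 - α / 2

section
variable {ξm ξp : E d} {Vmin : ℝ} {V : E d → ℝ} {α p κ : ℝ}

lemma Setting.swap (h : Setting ξm ξp Vmin V α p κ) : Setting ξp ξm Vmin V α p κ where
  pot := { h.pot with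
    val_ξm := h.pot.val_ξp
    val_ξp := h.pot.val_ξm
    nondegenerate := by
      obtain ⟨δ, hδ, μ, hμ, H⟩ := h.pot.nondegenerate
      exact ⟨δ, hδ, μ, hμ, fun s hs => ⟨(H s hs).2, (H s hs).1⟩⟩ }
  norm_ξm := h.norm_ξp
  norm_ξp := h.norm_ξm
  Vmin_pos := h.Vmin_pos
  p_pos := h.p_pos
  p_sq := h.p_sq
  κ_eq := h.κ_eq

lemma Setting.κ_pos (h : Setting ξm ξp Vmin V α p κ) : 0 < κ := by
  have := h.pot.alpha_lt_two; rw [h.κ_eq]; linarith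

lemma Setting.κ_lt_one (h : Setting ξm ξp Vmin V α p κ) : κ < 1 := by
  have := h.pot.alpha_pos; rw [h.κ_eq]; linarith

lemma Setting.continuousOn (h : Setting ξm ξp Vmin V α p κ) : ContinuousOn V {0}ᶜ :=
  h.pot.contDiffOn.continuousOn

lemma Setting.le_mul (h : Setting ξm ξp Vmin V α p κ) {x : E d} (hx : x ≠ 0) :
    Vmin ≤ ‖x‖ ^ α * V x := by
  have hr : 0 < ‖x‖ := norm_pos_iff.2 hx
  rw [h.pot.homogeneous x hx, mul_div_cancel₀ _ (Real.rpow_pos_of_pos hr α).ne']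
  exact h.pot.le_val _ (by rw [norm_smul, norm_inv, norm_norm, inv_mul_cancel₀ hr.ne'])

lemma Setting.le (h : Setting ξm ξp Vmin V α p κ) {x : E d} (hx : x ≠ 0) :
    Vmin / ‖x‖ ^ α ≤ V x := by
  have hr : 0 < ‖x‖ := norm_pos_iff.2 hx
  rw [div_le_iff₀ (Real.rpow_pos_of_pos hr α), mul_comm]
  exact h.le_mul hx

lemma Setting.pos (h : Setting ξm ξp Vmin V α p κ) {x : E d} (hx : x ≠ 0) : 0 < V x :=
  (div_pos h.Vmin_pos (Real.rpow_pos_of_pos (norm_pos_iff.2 hx) α)).trans_le (h.le hx)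

lemma Setting.nonneg (h : Setting ξm ξp Vmin V α p κ) (x : E d) (hx : x ≠ 0) : 0 ≤ V x :=
  (h.pos hx).le

lemma Setting.smul (h : Setting ξm ξp Vmin V α p κ) {l : ℝ} (hl : 0 < l) {x : E d} (hx : x ≠ 0) :
    V (l • x) = l ^ (-α) * V x := by
  have hr : 0 < ‖x‖ := norm_pos_iff.2 hx
  rw [h.pot.homogeneous x hx, h.pot.homogeneous (l • x) (smul_ne_zero hl.ne' hx), norm_smul,
    Real.norm_eq_abs, abs_of_pos hl, smul_smul, mul_inv, mul_comm l⁻¹, mul_assoc,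
    inv_mul_cancel₀ hl.ne', mul_one, Real.mul_rpow hl.le hr.le, Real.rpow_neg hl.le]
  field_simp

lemma Setting.exists_le (h : Setting ξm ξp Vmin V α p κ) :
    ∃ M : ℝ, 0 < M ∧ ∀ x, x ≠ 0 → V x ≤ M / ‖x‖ ^ α := by
  have hc : IsCompact (Metric.sphere (0 : E d) 1) := isCompact_sphere 0 1
  have hcont : ContinuousOn V (Metric.sphere (0 : E d) 1) := h.continuousOn.mono (by
    intro x hx; simp only [mem_sphere_zero_iff_norm] at hx
    simp only [mem_compl_iff, mem_singleton_iff]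
    rintro rfl; simp at hx)
  obtain ⟨M, hM⟩ := hc.bddAbove_image hcont
  have hM' : ∀ s : E d, ‖s‖ = 1 → V s ≤ M := fun s hs =>
    hM (mem_image_of_mem V (mem_sphere_zero_iff_norm.2 hs))
  refine ⟨M, h.Vmin_pos.trans_le ((h.pot.le_val _ h.norm_ξm).trans (hM' _ h.norm_ξm)), ?_⟩
  intro x hx
  have hr : 0 < ‖x‖ := norm_pos_iff.2 hx
  rw [h.pot.homogeneous x hx]
  gcongr
  exact hM' _ (by rw [norm_smul, norm_inv, norm_norm, inv_mul_cancel₀ hr.ne'])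

/-! ### Scaling -/

/-- The rate c = l^(-(1+α/2)) makes the kinetic factor (l c)² equal to the potential factor l^(-α);
dividing by c leaves l^(-α+1+α/2) = l^κ. -/
lemma Setting.scaling (h : Setting ξm ξp Vmin V α p κ) {l : ℝ} (hl : 0 < l) {a b : ℝ}
    {x : ℝ → E d} (hx : IsH1 a b x) :
    ∃ c : ℝ, 0 < c ∧ IsH1 (a / c) (b / c) (fun t => l • x (c * t)) ∧
      action V (a / c) (b / c) (fun t => l • x (c * t)) =
        ENNReal.ofReal (l ^ κ) * action V a b x := by
  set c := l ^ (-(1 + α / 2)) with hcdef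
  have hc : 0 < c := Real.rpow_pos_of_pos hl _
  have hlc : (l * c) ^ 2 = l ^ (-α) := by
    have : l * c = l ^ (-(α / 2)) := by
      rw [hcdef]; nth_rewrite 1 [← Real.rpow_one l]
      rw [← Real.rpow_add hl]; congr 1; ring
    rw [this, ← Real.rpow_natCast, ← Real.rpow_mul hl.le]; congr 1; push_cast; ring
  refine ⟨c, hc, ?_, ?_⟩
  · have := hx.comp_affine hc.ne' 0 l (a' := a / c) (b' := b / c) (fun t ht => by
      have h1 := (div_le_iff₀ hc).1 ht.1
      have h2 := (le_div_iff₀ hc).1 ht.2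
      constructor <;> simp only [add_zero] <;> linarith)
    simpa using this
  · have := action_comp_affine (V := V) hc.ne' hl 0 (fun y hy => by rw [hlc, h.smul hl hy])
      (a := a) (b := b) (a' := a / c) (b' := b / c) x (by
        ext t
        simp only [mem_preimage, mem_Icc, add_zero, div_le_iff₀ hc, le_div_iff₀ hc, mul_comm])
    simp only [add_zero] at this
    rw [this, abs_of_pos hc, hlc, hcdef, ← Real.rpow_sub hl, h.κ_eq]
    congr 3; ring

lemma Setting.touchReach_smul (h : Setting ξm ξp Vmin V α p κ) {l : ℝ} (hl : 0 < l) {ε : ℝ}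
    {y z : E d} {A : ℝ} (hr : TouchReach V ε y z A) :
    TouchReach V (l * ε) (l • y) (l • z) (l ^ κ * A) := by
  obtain ⟨a, b, x, hab, hx, h1, h2, h3, h4⟩ := hr
  obtain ⟨c, hc, h5, h6⟩ := h.scaling hl hx
  refine ⟨a / c, b / c, _, by gcongr, h5, ?_, ?_, ?_, ?_⟩
  · rw [mul_div_cancel₀ _ hc.ne', h1]
  · rw [mul_div_cancel₀ _ hc.ne', h2]
  · constructor
    · obtain ⟨t, ht, hte⟩ := h3.1
      refine ⟨t / c, ⟨by have := ht.1; gcongr, by have := ht.2; gcongr⟩, ?_⟩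
      simp only at hte ⊢
      rw [mul_div_cancel₀ _ hc.ne', norm_smul, hte, Real.norm_eq_abs, abs_of_pos hl]
    · rintro _ ⟨t, ht, rfl⟩
      have := h3.2 (mem_image_of_mem (fun t => ‖x t‖) (⟨by linarith [(div_le_iff₀ hc).1 ht.1],
        by linarith [(le_div_iff₀ hc).1 ht.2]⟩ : c * t ∈ Icc a b))
      simp only at this ⊢
      rw [norm_smul, Real.norm_eq_abs, abs_of_pos hl]
      gcongr
  · rw [h6, ENNReal.ofReal_mul (by positivity)]
    gcongr

/-! ### Lower bounds of the action -/

lemma hasGradientAt_norm_rpow {x : E d} (hx : x ≠ 0) (q : ℝ) :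
    HasGradientAt (fun y : E d => ‖y‖ ^ q) ((q * ‖x‖ ^ (q - 2)) • x) x := by
  have hr : 0 < ‖x‖ := norm_pos_iff.2 hx
  have h1 : HasFDerivAt (fun y : E d => ‖y‖ ^ 2) (2 • (innerSL ℝ x)) x :=
    (hasStrictFDerivAt_norm_sq x).hasFDerivAt
  have h2 := h1.rpow_const (p := q / 2) (Or.inl (by positivity))
  have e : (fun y : E d => ‖y‖ ^ q) = fun y : E d => (‖y‖ ^ 2) ^ (q / 2) := by
    ext y
    rw [← Real.rpow_natCast, ← Real.rpow_mul (norm_nonneg y)]; congr 1; push_cast; ring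
  rw [hasGradientAt_iff_hasFDerivAt, e]
  convert! h2 using 1
  ext y
  have e2 : (‖x‖ ^ 2) ^ (q / 2 - 1) = ‖x‖ ^ (q - 2) := by
    rw [← Real.rpow_natCast, ← Real.rpow_mul (norm_nonneg x)]; congr 1; push_cast; ring
  simp [e2]
  ring

/-- The functions `c₁ |x|^κ + c₂ |x|^(κ-1) x·ξ`, used as subsolutions of the eikonal equation. -/
def coneFun (κ c₁ c₂ : ℝ) (ξ x : E d) : ℝ := c₁ * ‖x‖ ^ κ + c₂ * (‖x‖ ^ (κ - 1) * inner ℝ x ξ)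

def coneGrad (κ c₁ c₂ : ℝ) (ξ x : E d) : E d :=
  (c₁ * (κ * ‖x‖ ^ (κ - 2)) + c₂ * ((κ - 1) * ‖x‖ ^ (κ - 3) * inner ℝ x ξ)) • x +
    (c₂ * ‖x‖ ^ (κ - 1)) • ξ

lemma hasGradientAt_coneFun {κ c₁ c₂ : ℝ} {ξ x : E d} (hx : x ≠ 0) :
    HasGradientAt (coneFun κ c₁ c₂ ξ) (coneGrad κ c₁ c₂ ξ x) x := by
  have h1 := (hasGradientAt_norm_rpow hx κ).hasFDerivAt.const_mul c₁
  have h2 := (hasGradientAt_norm_rpow hx (κ - 1)).hasFDerivAt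
  have h3 : HasFDerivAt (fun y : E d => inner ℝ y ξ) (innerSL ℝ ξ) x := by
    have := (innerSL ℝ ξ).hasFDerivAt (x := x)
    refine this.congr_of_eventuallyEq (Eventually.of_forall fun y => ?_)
    simp [real_inner_comm]
  have h4 := h1.add ((h2.mul h3).const_mul c₂)
  rw [hasGradientAt_iff_hasFDerivAt]
  refine HasFDerivAt.congr_fderiv h4 ?_
  ext y
  simp [coneGrad]
  rw [show κ - 1 - 2 = κ - 3 by ring]
  ring

lemma contDiffOn_coneFun {κ c₁ c₂ : ℝ} {ξ : E d} : ContDiffOn ℝ 1 (coneFun κ c₁ c₂ ξ) {0}ᶜ := by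
  have h1 : ∀ q : ℝ, ContDiffOn ℝ 1 (fun x : E d => ‖x‖ ^ q) {0}ᶜ := fun q x hx =>
    (((contDiffAt_norm ℝ hx).rpow_const_of_ne (norm_ne_zero_iff.2 hx)).of_le
      le_rfl).contDiffWithinAt
  have h2 : ContDiffOn ℝ 1 (fun x : E d => inner ℝ x ξ) {0}ᶜ :=
    (contDiff_id.inner ℝ contDiff_const).contDiffOn
  exact (contDiffOn_const.mul (h1 κ)).add (contDiffOn_const.mul ((h1 (κ - 1)).mul h2))

/-- In polar form the function is r^κ (c₁ + c₂ cos θ): the first square is the radial derivative,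
the second term the tangential one. -/
lemma norm_coneGrad_sq {κ c₁ c₂ : ℝ} {ξ x : E d} (hξ : ‖ξ‖ = 1) (hx : x ≠ 0) :
    ‖coneGrad κ c₁ c₂ ξ x‖ ^ 2 = (‖x‖ ^ (κ - 1)) ^ 2 *
      ((c₁ * κ + c₂ * κ * (inner ℝ x ξ / ‖x‖)) ^ 2 +
        c₂ ^ 2 * (1 - (inner ℝ x ξ / ‖x‖) ^ 2)) := by
  have hr : 0 < ‖x‖ := norm_pos_iff.2 hx
  have e1 : ‖x‖ ^ (κ - 2) = ‖x‖ ^ (κ - 1) * ‖x‖⁻¹ := by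
    rw [← Real.rpow_neg_one, ← Real.rpow_add hr]; congr 1; ring
  have e2 : ‖x‖ ^ (κ - 3) = ‖x‖ ^ (κ - 1) * ‖x‖⁻¹ * ‖x‖⁻¹ := by
    rw [← Real.rpow_neg_one, ← Real.rpow_add hr, ← Real.rpow_add hr]; congr 1; ring
  rw [coneGrad, norm_add_sq_real, norm_smul, norm_smul, inner_smul_left, inner_smul_right, hξ,
    e1, e2, mul_pow, mul_one, Real.norm_eq_abs, Real.norm_eq_abs, sq_abs, sq_abs]
  simp only [conj_trivial]
  field_simp
  ring

/-- With c the cosine, the radial part is p - 2ηκ(1 - c) and the tangential part squared is 4η²(1 -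
c²). The gain 4pηκ(1 - c) must beat 4η²(1 - c)(κ²(1 - c) + 1 + c); the last factor is at most 2,
whence the bound η ≤ pκ/2. -/
lemma Setting.coneGrad_le (h : Setting ξm ξp Vmin V α p κ) {x : E d} (hx : x ≠ 0) {ξ : E d}
    (hξ : ‖ξ‖ = 1) {η : ℝ} (hη0 : 0 ≤ η) (hη : η ≤ p * κ / 2) :
    ‖coneGrad κ (p / κ - 2 * η) (2 * η) ξ x‖ ^ 2 ≤ 2 * V x := by
  have hr : 0 < ‖x‖ := norm_pos_iff.2 hx
  have hκ := h.κ_pos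
  have hκ1 := h.κ_lt_one
  rw [norm_coneGrad_sq hξ hx]
  set c := inner ℝ x ξ / ‖x‖ with hc
  have hc1 : |c| ≤ 1 := by
    rw [hc, abs_div, abs_of_pos hr, div_le_one hr]
    simpa [hξ] using abs_real_inner_le_norm x ξ
  obtain ⟨hc2, hc3⟩ := abs_le.1 hc1
  have e : (‖x‖ ^ (κ - 1)) ^ 2 = (‖x‖ ^ α)⁻¹ := by
    rw [← Real.rpow_neg hr.le, ← Real.rpow_natCast, ← Real.rpow_mul hr.le, h.κ_eq]
    congr 1; push_cast; ring
  have hle := h.le hx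
  have key : ((p / κ - 2 * η) * κ + 2 * η * κ * c) ^ 2 + (2 * η) ^ 2 * (1 - c ^ 2) ≤ p ^ 2 := by
    have e3 : (p / κ - 2 * η) * κ + 2 * η * κ * c = p - 2 * η * κ * (1 - c) := by
      field_simp; ring
    rw [e3]
    have hκ2 : κ ^ 2 ≤ 1 := pow_le_one₀ hκ.le hκ1.le
    have h1 : η * (κ ^ 2 * (1 - c) + (1 + c)) ≤ p * κ := by
      have : κ ^ 2 * (1 - c) + (1 + c) ≤ 2 := by
        nlinarith [mul_nonneg (sub_nonneg.2 hκ2) (sub_nonneg.2 hc3)]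
      nlinarith [h.p_pos]
    have h2 : 0 ≤ η * (1 - c) := mul_nonneg hη0 (by linarith)
    nlinarith [mul_le_mul_of_nonneg_left h1 h2]
  rw [e]
  calc _ ≤ (‖x‖ ^ α)⁻¹ * p ^ 2 := by gcongr
    _ = 2 * (Vmin / ‖x‖ ^ α) := by rw [h.p_sq]; field_simp
    _ ≤ 2 * V x := by linarith

lemma Setting.coneFun_sub_le_action (h : Setting ξm ξp Vmin V α p κ) {ξ : E d} (hξ : ‖ξ‖ = 1)
    {η : ℝ} (hη0 : 0 ≤ η) (hη : η ≤ p * κ / 2) {a b : ℝ} (hab : a ≤ b) {x : ℝ → E d}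
    (hx : IsH1 a b x) (hx0 : ∀ t ∈ Icc a b, x t ≠ 0) :
    ENNReal.ofReal (coneFun κ (p / κ - 2 * η) (2 * η) ξ (x b) -
      coneFun κ (p / κ - 2 * η) (2 * η) ξ (x a)) ≤ action V a b x :=
  ofReal_sub_le_action hab hx hx0 contDiffOn_coneFun
    (fun t ht => hasGradientAt_coneFun (hx0 t ht)) (fun t ht => h.coneGrad_le (hx0 t ht) hξ hη0 hη)

lemma Setting.coneFun_sub_le (h : Setting ξm ξp Vmin V α p κ) {ξ : E d} (hξ : ‖ξ‖ = 1)
    {η : ℝ} (hη0 : 0 ≤ η) (hη : η ≤ p * κ / 2) {ε A : ℝ} (hε : 0 < ε) (hA : 0 ≤ A) {y z : E d}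
    (hr : Reach V ε y z A) :
    coneFun κ (p / κ - 2 * η) (2 * η) ξ z - coneFun κ (p / κ - 2 * η) (2 * η) ξ y ≤ A := by
  obtain ⟨a, b, x, hab, hx, rfl, rfl, h3, h4⟩ := hr
  exact (ENNReal.ofReal_le_ofReal_iff hA).1 ((h.coneFun_sub_le_action hξ hη0 hη hab.le hx
    fun t ht => norm_pos_iff.1 (hε.trans_le (h3 t ht))).trans h4)

lemma coneFun_zero (κ c : ℝ) (ξ x : E d) : coneFun κ (c - 2 * 0) (2 * 0) ξ x = c * ‖x‖ ^ κ := by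
  simp [coneFun]

/-- By |s - ξ|² = 2 - 2 cos θ, the perturbation is a penalty on the direction. It vanishes on the
axis, and off it controls the convergence of directions along rays. -/
lemma coneFun_eq {κ c η : ℝ} {ξ x : E d} (hξ : ‖ξ‖ = 1) (hx : x ≠ 0) :
    coneFun κ (c - 2 * η) (2 * η) ξ x =
      c * ‖x‖ ^ κ - η * (‖x‖ ^ κ * ‖‖x‖⁻¹ • x - ξ‖ ^ 2) := by
  have hr : 0 < ‖x‖ := norm_pos_iff.2 hx
  have e1 : ‖x‖ ^ (κ - 1) = ‖x‖ ^ κ * ‖x‖⁻¹ := by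
    rw [← Real.rpow_neg_one, ← Real.rpow_add hr]; congr 1
  rw [coneFun, norm_sub_sq_real, norm_smul, hξ, inner_smul_left, norm_inv, norm_norm,
    inv_mul_cancel₀ hr.ne', e1]
  simp only [conj_trivial]
  ring

lemma Setting.le_of_reach (h : Setting ξm ξp Vmin V α p κ) {ε A : ℝ} (hε : 0 < ε) (hA : 0 ≤ A)
    {y z : E d} (hr : Reach V ε y z A) : p / κ * (‖z‖ ^ κ - ‖y‖ ^ κ) ≤ A := by
  have := h.coneFun_sub_le h.norm_ξm le_rfl (by have := h.p_pos; have := h.κ_pos; positivity)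
    hε hA hr
  rw [coneFun_zero, coneFun_zero] at this
  linarith

end

/-! ### Explicit paths -/

lemma isH1_of_hasDerivAt {a b : ℝ} {x x' : ℝ → E d} {K : ℝ}
    (h : ∀ t ∈ Icc a b, HasDerivAt x (x' t) t) (hK : ∀ t ∈ Icc a b, ‖x' t‖ ≤ K) : IsH1 a b x := by
  refine isH1_of_lipschitz (K := K) fun s hs t ht => ?_
  exact (convex_Icc a b).norm_image_sub_le_of_norm_hasDerivWithin_le
    (fun u hu => (h u hu).hasDerivWithinAt) hK ht hs

/-- Explicit paths are estimated through a primitive `g` of a bound of the Lagrangian; nonnegativity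
of `g'` supplies its integrability. -/
lemma action_le_of_hasDerivAt {V : E d → ℝ} {a b : ℝ} (hab : a ≤ b) {x : ℝ → E d} {g g' : ℝ → ℝ}
    (hg : ∀ t ∈ Icc a b, HasDerivAt g (g' t) t) (hx : ∀ t ∈ Icc a b, x t ≠ 0)
    (hV : ∀ t ∈ Icc a b, 0 ≤ V (x t))
    (h : ∀ᵐ t ∂(volume.restrict (Icc a b)), ‖deriv x t‖ ^ 2 / 2 + V (x t) ≤ g' t)
    (hg0 : ∀ t ∈ Icc a b, 0 ≤ g' t) :
    action V a b x ≤ ENNReal.ofReal (g b - g a) := by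
  have hi : IntegrableOn g' (Ioc a b) :=
    intervalIntegral.integrableOn_deriv_of_nonneg (fun t ht => (hg t ht).continuousAt.continuousWithinAt)
      (fun t ht => hg t (Ioo_subset_Icc_self ht)) (fun t ht => hg0 t (Ioo_subset_Icc_self ht))
  have h1 := intervalIntegral.integral_eq_sub_of_hasDerivAt (f := g) (f' := g') (a := a) (b := b)
    (by rwa [uIcc_of_le hab]) ((intervalIntegrable_iff_integrableOn_Ioc_of_le hab).2 hi)
  rw [← h1, intervalIntegral.integral_of_le hab, ← integral_Icc_eq_integral_Ioc,
    ofReal_integral_eq_lintegral_ofReal (by rwa [← IntegrableOn, integrableOn_Icc_iff_integrableOn_Ioc])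
    (by filter_upwards [ae_restrict_mem measurableSet_Icc] with t ht using hg0 t ht)]
  refine lintegral_mono_ae ?_
  filter_upwards [h, ae_restrict_mem measurableSet_Icc] with t ht hti
  rw [singularPotential, if_neg (hx t hti), ← ENNReal.ofReal_add (by positivity) (hV t hti)]
  exact ENNReal.ofReal_le_ofReal ht

/-- The derivative vanishes at the minimum and is Lipschitz nearby, so it is at most K‖y - x₀‖ on
the ball of radius ‖y - x₀‖; then the mean value inequality. -/
lemma exists_quadratic_bound {F : E d → ℝ} {x₀ : E d} (hF : ContDiffAt ℝ 2 F x₀)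
    (hmin : IsLocalMin F x₀) :
    ∃ C > 0, ∃ σ > 0, ∀ y, ‖y - x₀‖ ≤ σ → F y ≤ F x₀ + C * ‖y - x₀‖ ^ 2 := by
  have h1 : ContDiffAt ℝ 1 (fderiv ℝ F) x₀ := hF.fderiv_right (by norm_num)
  obtain ⟨K, s, hs, hK⟩ := h1.exists_lipschitzOnWith
  have hd : ∀ᶠ y in 𝓝 x₀, DifferentiableAt ℝ F y := by
    filter_upwards [hF.eventually (by simp)] with y hy using hy.differentiableAt (by norm_num)
  obtain ⟨σ, hσ, hball⟩ := Metric.nhds_basis_closedBall.mem_iff.1 (inter_mem hs hd)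
  refine ⟨K + 1, by positivity, σ, hσ, fun y hy => ?_⟩
  have h0 : fderiv ℝ F x₀ = 0 := hmin.fderiv_eq_zero
  have hx₀ : x₀ ∈ s := mem_of_mem_nhds hs
  have hsub : Metric.closedBall x₀ ‖y - x₀‖ ⊆ Metric.closedBall x₀ σ :=
    Metric.closedBall_subset_closedBall hy
  have hmv := (convex_closedBall x₀ ‖y - x₀‖).norm_image_sub_le_of_norm_fderiv_le (𝕜 := ℝ)
    (f := F) (C := K * ‖y - x₀‖) (x := x₀) (y := y)
    (fun z hz => (hball (hsub hz)).2) (fun z hz => ?_) (by simp) (by simp [dist_eq_norm])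
  · have h2 := (le_abs_self _).trans hmv
    nlinarith [sq_nonneg ‖y - x₀‖]
  · have h3 := hK.dist_le_mul z (hball (hsub hz)).1 x₀ hx₀
    rw [dist_eq_norm, h0, sub_zero] at h3
    exact h3.trans (mul_le_mul_of_nonneg_left hz K.2)

/-! ### Almost radial paths near a minimal direction. -/

section
variable {ξm ξp : E d} {Vmin : ℝ} {V : E d → ℝ} {α p κ : ℝ}

lemma ne_zero_of_norm_one {ξ : E d} (h : ‖ξ‖ = 1) : ξ ≠ 0 := by
  rintro rfl; simp at h

/-- The product ‖y‖^α V y is homogeneous of degree 0, so ξp is a local minimum of it in the full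
space and no chart of the sphere is needed. -/
lemma Setting.exists_upper (h : Setting ξm ξp Vmin V α p κ) :
    ∃ C > 0, ∃ σ > 0, ∀ y, ‖y - ξp‖ ≤ σ → ‖y‖ ^ α * V y ≤ Vmin + C * ‖y - ξp‖ ^ 2 := by
  have h0 := ne_zero_of_norm_one h.norm_ξp
  have h1 : ContDiffAt ℝ 2 (fun y => ‖y‖ ^ α * V y) ξp :=
    ((contDiffAt_norm ℝ h0).rpow_const_of_ne (norm_ne_zero_iff.2 h0)).mul
      (h.pot.contDiffOn.contDiffAt (isOpen_compl_singleton.mem_nhds h0))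
  have h2 : ‖ξp‖ ^ α * V ξp = Vmin := by rw [h.norm_ξp, h.pot.val_ξp]; simp
  have h3 : IsLocalMin (fun y => ‖y‖ ^ α * V y) ξp := by
    filter_upwards [isOpen_compl_singleton.mem_nhds h0] with y hy
    rw [h2]; exact h.le_mul hy
  have := exists_quadratic_bound h1 h3
  rwa [h2] at this

/-- The radius of the zero energy solution along a ray where the potential is minimal. -/
lemma Setting.exists_radius (h : Setting ξm ξp Vmin V α p κ) {r₁ r₂ : ℝ} (h1 : 0 < r₁)
    (h12 : r₁ < r₂) :
    ∃ (a b : ℝ) (ρ : ℝ → ℝ), a < b ∧ ρ a = r₁ ∧ ρ b = r₂ ∧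
      ∀ t ∈ Icc a b, r₁ ≤ ρ t ∧ ρ t ≤ r₂ ∧ HasDerivAt ρ (p * ρ t ^ (-(α / 2))) t := by
  have hα := h.pot.alpha_pos
  have hp := h.p_pos
  set q := 1 + α / 2 with hq
  have hq0 : 0 < q := by positivity
  have hk : 0 < p * q := by positivity
  have hpow : ∀ r : ℝ, 0 < r → (p * q * (r ^ q / (p * q))) ^ q⁻¹ = r := by
    intro r hr
    rw [mul_div_cancel₀ _ hk.ne', Real.rpow_rpow_inv hr.le hq0.ne']
  -- The solution of ρ' = p ρ^(-α/2) that vanishes at time 0, restricted to the times at which its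
  -- radius lies between r₁ and r₂.
  refine ⟨r₁ ^ q / (p * q), r₂ ^ q / (p * q), fun t => (p * q * t) ^ q⁻¹, by gcongr,
    hpow r₁ h1, hpow r₂ (h1.trans h12), fun t ht => ?_⟩
  have ht0 : 0 < t := lt_of_lt_of_le (by positivity) ht.1
  refine ⟨?_, ?_, ?_⟩
  · calc r₁ = (p * q * (r₁ ^ q / (p * q))) ^ q⁻¹ := (hpow r₁ h1).symm
      _ ≤ (p * q * t) ^ q⁻¹ := by have := ht.1; gcongr
  · calc (p * q * t) ^ q⁻¹ ≤ (p * q * (r₂ ^ q / (p * q))) ^ q⁻¹ := by have := ht.2; gcongr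
      _ = r₂ := hpow r₂ (h1.trans h12)
  · have hd := ((hasDerivAt_id t).const_mul (p * q)).rpow_const (p := q⁻¹)
      (Or.inl (by simp only [id]; positivity))
    refine hd.congr_deriv ?_
    simp only [id, mul_one]
    rw [← Real.rpow_mul (by positivity)]
    have : q⁻¹ * -(α / 2) = q⁻¹ - 1 := by
      field_simp; rw [hq]; ring
    rw [this]
    field_simp

-- The radius follows the zero-energy homothetic motion while the direction moves along the chord
-- from s₁ to s₂, affinely in the radius. The excess is of order σ² because V is quadratically close
-- to Vmin near ξp and the chord has no first-order radial component. The chord dips inside the unit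
-- sphere, hence the lower radius r₁(1 - σ).
set_option maxHeartbeats 1000000 in
lemma Setting.exists_reach (h : Setting ξm ξp Vmin V α p κ) :
    ∃ C > 0, ∃ σ₀ > 0, σ₀ ≤ 1 / 2 ∧ ∀ (r₁ r₂ σ : ℝ) (s₁ s₂ : E d), 0 < r₁ → 2 * r₁ ≤ r₂ →
      ‖s₁‖ = 1 → ‖s₂‖ = 1 → ‖s₁ - ξp‖ ≤ σ → ‖s₂ - ξp‖ ≤ σ → σ ≤ σ₀ →
      Reach V (r₁ * (1 - σ)) (r₁ • s₁) (r₂ • s₂) (p / κ * (r₂ ^ κ - r₁ ^ κ) * (1 + C * σ ^ 2)) := by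
  obtain ⟨C₀, hC₀, σ₁, hσ₁, H⟩ := h.exists_upper
  have hp := h.p_pos
  have hκ := h.κ_pos
  have hα := h.pot.alpha_pos
  -- The kinetic excess is p²/2 · 24σ² and the potential excess is (2Vmin + 2C₀)σ² = (p² + 2C₀)σ²,
  -- both times ρ^(-α); their sum is p²(13 + 2C₀/p²)σ².
  refine ⟨13 + 2 * C₀ / p ^ 2, by positivity, min σ₁ (1 / 2), by positivity, min_le_right _ _, ?_⟩
  intro r₁ r₂ σ s₁ s₂ hr₁ hr₂ hs₁ hs₂ hsσ₁ hsσ₂ hσ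
  have hσ' : σ ≤ 1 / 2 := hσ.trans (min_le_right _ _)
  have hσ0 : 0 ≤ σ := (norm_nonneg _).trans hsσ₁
  obtain ⟨a, b, ρ, hab, hρa, hρb, hρ⟩ := h.exists_radius hr₁ (show r₁ < r₂ by linarith)
  set δ := s₂ - s₁ with hδ
  have hD : 0 < r₂ - r₁ := by linarith
  have hδn : ‖δ‖ ≤ 2 * σ := by
    have : δ = (s₂ - ξp) - (s₁ - ξp) := by rw [hδ]; abel
    rw [this]; exact (norm_sub_le _ _).trans (by linarith)
  have hδ2 : ‖δ‖ ^ 2 ≤ 4 * σ ^ 2 := by nlinarith [norm_nonneg δ]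
  -- Both ends lie on the unit sphere, so the linear term of ‖s₁ + θ δ‖² is itself quadratic in δ.
  have hin : inner ℝ s₁ δ = -(‖δ‖ ^ 2 / 2) := by
    have := norm_add_sq_real s₁ δ
    rw [show s₁ + δ = s₂ by rw [hδ]; abel, hs₁, hs₂] at this
    linarith
  have hnorm : ∀ θ : ℝ, ‖s₁ + θ • δ‖ ^ 2 = 1 + (θ ^ 2 - θ) * ‖δ‖ ^ 2 := by
    intro θ
    rw [norm_add_sq_real, norm_smul, inner_smul_right, hin, hs₁, mul_pow, Real.norm_eq_abs, sq_abs]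
    ring
  set φ : ℝ → ℝ := fun t => (ρ t - r₁) / (r₂ - r₁) with hφ
  set z : ℝ → E d := fun t => ρ t • (s₁ + φ t • δ) with hz
  have hφ01 : ∀ t ∈ Icc a b, 0 ≤ φ t ∧ φ t ≤ 1 := by
    intro t ht
    obtain ⟨h1, h2, -⟩ := hρ t ht
    exact ⟨div_nonneg (by linarith) hD.le, (div_le_one hD).2 (by linarith)⟩
  have hz' : ∀ t ∈ Icc a b, HasDerivAt z ((p * ρ t ^ (-(α / 2))) •
      (s₁ + (φ t + ρ t / (r₂ - r₁)) • δ)) t := by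
    intro t ht
    obtain ⟨h1, h2, h3⟩ := hρ t ht
    have h4 : HasDerivAt φ (p * ρ t ^ (-(α / 2)) / (r₂ - r₁)) t :=
      (h3.sub_const r₁).div_const _
    have h5 := h3.smul ((h4.smul_const δ).const_add s₁)
    refine h5.congr_deriv ?_
    module
  have hθ : ∀ t ∈ Icc a b, 0 ≤ φ t + ρ t / (r₂ - r₁) ∧ φ t + ρ t / (r₂ - r₁) ≤ 3 := by
    intro t ht
    obtain ⟨h1, h2, h3⟩ := hρ t ht
    obtain ⟨h4, h5⟩ := hφ01 t ht
    -- Here 2 r₁ ≤ r₂ is used: r₂ - r₁ ≥ r₂/2 ≥ ρ/2, so the direction turns at a rate bounded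
    -- independently of the radii.
    have h6 : ρ t / (r₂ - r₁) ≤ 2 := by rw [div_le_iff₀ hD]; linarith
    have h7 : 0 ≤ ρ t / (r₂ - r₁) := div_nonneg (hr₁.le.trans h1) hD.le
    constructor <;> linarith
  have hw : ∀ t ∈ Icc a b, ‖s₁ + (φ t + ρ t / (r₂ - r₁)) • δ‖ ^ 2 ≤ 1 + 24 * σ ^ 2 := by
    intro t ht
    obtain ⟨h4, h5⟩ := hθ t ht
    rw [hnorm]
    have : (φ t + ρ t / (r₂ - r₁)) ^ 2 - (φ t + ρ t / (r₂ - r₁)) ≤ 6 := by nlinarith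
    nlinarith [sq_nonneg ‖δ‖]
  have hdir : ∀ t ∈ Icc a b, ‖(s₁ + φ t • δ) - ξp‖ ≤ σ := by
    intro t ht
    obtain ⟨h4, h5⟩ := hφ01 t ht
    have : (s₁ + φ t • δ) - ξp = (1 - φ t) • (s₁ - ξp) + φ t • (s₂ - ξp) := by rw [hδ]; module
    rw [this]
    refine (norm_add_le _ _).trans ?_
    rw [norm_smul, norm_smul, Real.norm_eq_abs, Real.norm_eq_abs, abs_of_nonneg h4,
      abs_of_nonneg (by linarith)]
    nlinarith
  have hdir1 : ∀ t ∈ Icc a b, 1 - σ ≤ ‖s₁ + φ t • δ‖ := by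
    intro t ht
    have h1 := norm_sub_norm_le ξp (ξp - (s₁ + φ t • δ))
    rw [h.norm_ξp, sub_sub_cancel, norm_sub_rev] at h1
    linarith [hdir t ht]
  have hρpos : ∀ t ∈ Icc a b, 0 < ρ t := fun t ht => hr₁.trans_le (hρ t ht).1
  have hne : ∀ t ∈ Icc a b, s₁ + φ t • δ ≠ 0 := by
    intro t ht h0
    have := hdir1 t ht
    rw [h0, norm_zero] at this
    linarith
  have hz0 : ∀ t ∈ Icc a b, z t ≠ 0 := fun t ht => smul_ne_zero (hρpos t ht).ne' (hne t ht)
  have hVs : ∀ t ∈ Icc a b, V (s₁ + φ t • δ) ≤ Vmin + (2 * Vmin + 2 * C₀) * σ ^ 2 := by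
    intro t ht
    obtain ⟨h4, h5⟩ := hφ01 t ht
    have h1 := H _ ((hdir t ht).trans (hσ.trans (min_le_left _ _)))
    have h2 : ‖s₁ + φ t • δ‖ ^ 2 = 1 + (φ t ^ 2 - φ t) * ‖δ‖ ^ 2 := hnorm _
    have h3 : 1 - σ ^ 2 ≤ ‖s₁ + φ t • δ‖ ^ 2 := by
      rw [h2]; nlinarith [sq_nonneg (φ t - 1 / 2), sq_nonneg ‖δ‖]
    have h6 : ‖s₁ + φ t • δ‖ ≤ 1 := by
      have : ‖s₁ + φ t • δ‖ ^ 2 ≤ 1 := by rw [h2]; linarith [mul_nonneg (mul_nonneg h4 (sub_nonneg.2 h5)) (sq_nonneg ‖δ‖)]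
      exact (sq_le_one_iff₀ (norm_nonneg _)).1 this
    have h7 : ‖s₁ + φ t • δ‖ ^ 2 ≤ ‖s₁ + φ t • δ‖ ^ α := by
      rw [← Real.rpow_natCast]
      exact Real.rpow_le_rpow_of_exponent_ge (norm_pos_iff.2 (hne t ht)) h6
        (by push_cast; exact h.pot.alpha_lt_two.le)
    have h8 : ‖(s₁ + φ t • δ) - ξp‖ ^ 2 ≤ σ ^ 2 := by
      have := hdir t ht; gcongr
    have hV0 := h.pos (hne t ht)
    have h9 : (1 - σ ^ 2) * V (s₁ + φ t • δ) ≤ Vmin + C₀ * σ ^ 2 := by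
      calc _ ≤ ‖s₁ + φ t • δ‖ ^ α * V (s₁ + φ t • δ) := by
            apply mul_le_mul_of_nonneg_right (h3.trans h7) hV0.le
        _ ≤ _ := h1
        _ ≤ _ := by gcongr
    have hσ2 : σ ^ 2 ≤ 1 / 2 := by nlinarith
    have h10 : (1 - σ ^ 2) * V (s₁ + φ t • δ) ≤
        (1 - σ ^ 2) * (Vmin + (2 * Vmin + 2 * C₀) * σ ^ 2) := by
      refine h9.trans ?_
      linarith [mul_nonneg (mul_nonneg (add_pos h.Vmin_pos hC₀).le (sq_nonneg σ))
        (show 0 ≤ 1 - 2 * σ ^ 2 by linarith)]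
    exact le_of_mul_le_mul_left h10 (by linarith)
  have hρ2 : ∀ t ∈ Icc a b, (ρ t ^ (-(α / 2))) ^ 2 = ρ t ^ (-α) := by
    intro t ht
    rw [← Real.rpow_natCast, ← Real.rpow_mul (hρpos t ht).le]; congr 1; push_cast; ring
  have hH1 : IsH1 a b z := by
    refine isH1_of_hasDerivAt (K := p * r₁ ^ (-(α / 2)) * (1 + 24 * σ ^ 2)) hz' fun t ht => ?_
    rw [norm_smul, Real.norm_eq_abs, abs_of_nonneg (by have := hρpos t ht; positivity)]
    have h1 : ρ t ^ (-(α / 2)) ≤ r₁ ^ (-(α / 2)) :=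
      Real.rpow_le_rpow_of_nonpos hr₁ (hρ t ht).1 (by linarith)
    have h2 : ‖s₁ + (φ t + ρ t / (r₂ - r₁)) • δ‖ ≤ 1 + 24 * σ ^ 2 := by
      have := hw t ht
      nlinarith [norm_nonneg (s₁ + (φ t + ρ t / (r₂ - r₁)) • δ), sq_nonneg σ]
    have := hρpos t ht
    gcongr
  have hG : ∀ t ∈ Icc a b, HasDerivAt (fun t => p / κ * ρ t ^ κ * (1 + (13 + 2 * C₀ / p ^ 2) * σ ^ 2))
      (p ^ 2 * ρ t ^ (-α) * (1 + (13 + 2 * C₀ / p ^ 2) * σ ^ 2)) t := by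
    intro t ht
    have h1 := (((hρ t ht).2.2.rpow_const (p := κ) (Or.inl (hρpos t ht).ne')).const_mul
      (p / κ)).mul_const (1 + (13 + 2 * C₀ / p ^ 2) * σ ^ 2)
    refine h1.congr_deriv ?_
    have : ρ t ^ (-α) = ρ t ^ (-(α / 2)) * ρ t ^ (κ - 1) := by
      rw [← Real.rpow_add (hρpos t ht), h.κ_eq]; congr 1; ring
    rw [this]
    field_simp
  refine ⟨a, b, z, hab, hH1, ?_, ?_, ?_, ?_⟩
  · simp [hz, hφ, hρa]
  · simp only [hz, hφ, hρb, hδ, div_self hD.ne']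
    module
  · intro t ht
    rw [hz, norm_smul, Real.norm_eq_abs, abs_of_pos (hρpos t ht)]
    have := hdir1 t ht
    have h1 := (hρ t ht).1
    exact mul_le_mul h1 this (by linarith) (hρpos t ht).le
  · refine (action_le_of_hasDerivAt hab.le hG hz0 (fun t ht => h.nonneg _ (hz0 t ht)) ?_ ?_).trans
      (ENNReal.ofReal_le_ofReal (by rw [hρa, hρb]; linarith))
    · filter_upwards [ae_restrict_mem measurableSet_Icc] with t ht
      rw [(hz' t ht).deriv, norm_smul, mul_pow, Real.norm_eq_abs, sq_abs, mul_pow, hρ2 t ht]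
      have h1 : V (z t) = ρ t ^ (-α) * V (s₁ + φ t • δ) := h.smul (hρpos t ht) (hne t ht)
      rw [h1]
      have h2 : 0 < ρ t ^ (-α) := Real.rpow_pos_of_pos (hρpos t ht) _
      calc _ ≤ p ^ 2 * ρ t ^ (-α) * (1 + 24 * σ ^ 2) / 2 +
            ρ t ^ (-α) * (Vmin + (2 * Vmin + 2 * C₀) * σ ^ 2) := by
            have := hw t ht; have := hVs t ht; gcongr
        _ = _ := by
            rw [show Vmin = p ^ 2 / 2 by rw [h.p_sq]; ring]
            field_simp; ring
    · intro t ht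
      have := hρpos t ht
      positivity

end

section
variable {ξm ξp : E d} {Vmin : ℝ} {V : E d → ℝ} {α p κ : ℝ}

/-! ### Local bounds for the cost of connections -/

/-- Calibration by a linear function of slope √(2m), directed along the displacement at the first
time T at which the displacement reaches L = min(‖x b - x a‖, ρ). Up to T the path stays where V ≥
m. -/
lemma sqrt_mul_min_le_action {m ρ : ℝ} (hm : 0 ≤ m) (hρ : 0 ≤ ρ) {a b : ℝ} (hab : a ≤ b)
    {x : ℝ → E d} (hx : IsH1 a b x) (hx0 : ∀ t ∈ Icc a b, x t ≠ 0)
    (hV : ∀ t ∈ Icc a b, ‖x t - x a‖ ≤ ρ → m ≤ V (x t)) :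
    ENNReal.ofReal (√(2 * m) * min ‖x b - x a‖ ρ) ≤ action V a b x := by
  set L := min ‖x b - x a‖ ρ with hL
  have hL0 : 0 ≤ L := by positivity
  have hcont : ContinuousOn (fun t => ‖x t - x a‖) (Icc a b) :=
    (hx.continuousOn.sub continuousOn_const).norm
  rcases hL0.eq_or_lt with h0 | hLpos
  · simp [← h0]
  set S := {t ∈ Icc a b | L ≤ ‖x t - x a‖} with hS
  have hSc : IsClosed S := by
    have := hcont.preimage_isClosed_of_isClosed isClosed_Icc (isClosed_Ici (a := L))
    exact this
  have hScomp : IsCompact S := isCompact_Icc.of_isClosed_subset hSc (fun t ht => ht.1)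
  have hSne : S.Nonempty := ⟨b, right_mem_Icc.2 hab, min_le_left _ _⟩
  have hT := hScomp.sInf_mem hSne
  set T := sInf S with hTdef
  have hlt : ∀ t ∈ Icc a T, t < T → ‖x t - x a‖ < L := by
    intro t ht htT
    by_contra hcon
    have : t ∈ S := ⟨⟨ht.1, ht.2.trans hT.1.2⟩, not_lt.1 hcon⟩
    exact absurd (csInf_le hScomp.bddBelow this) (not_le.2 htT)
  have haT : a < T := by
    rcases hT.1.1.eq_or_lt with h | h
    · have := hT.2
      rw [← h] at this
      simp at this
      linarith
    · exact h
  have hle : ∀ t ∈ Icc a T, ‖x t - x a‖ ≤ ρ := by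
    have hsub : Icc a T ⊆ Icc a b := Icc_subset_Icc le_rfl hT.1.2
    intro t ht
    have hcl : T ∈ closure (Ico a T) := by rw [closure_Ico haT.ne]; exact right_mem_Icc.2 haT.le
    rcases ht.2.eq_or_lt with h | h
    · rw [h]
      have h1 : ContinuousWithinAt (fun t => ‖x t - x a‖) (Ico a T) T :=
        (hcont T hT.1).mono (Ico_subset_Icc_self.trans hsub)
      have h2 := h1.closure_le (s := Ico a T) hcl (continuousWithinAt_const (b := L))
        (fun t ht => (hlt t ⟨ht.1, ht.2.le⟩ ht.2).le)
      exact h2.trans (min_le_right _ _)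
    · exact (hlt t ht h).le.trans (min_le_right _ _)
  have hTb : T ≤ b := hT.1.2
  refine le_trans ?_ (action_mono (V := V) (x := x) le_rfl hTb)
  set w := x T - x a with hw
  have hwpos : 0 < ‖w‖ := hLpos.trans_le hT.2
  set e : E d := ‖w‖⁻¹ • w with he
  have hen : ‖e‖ = 1 := by rw [he, norm_smul, norm_inv, norm_norm, inv_mul_cancel₀ hwpos.ne']
  have hg : ∀ y : E d, HasGradientAt (fun y => inner ℝ (√(2 * m) • e) y) (√(2 * m) • e) y := by
    intro y
    rw [hasGradientAt_iff_hasFDerivAt]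
    exact (innerSL ℝ (√(2 * m) • e)).hasFDerivAt
  have hmain := ofReal_sub_le_action (V := V) (φ := fun y => inner ℝ (√(2 * m) • e) y)
    (φ' := fun _ => √(2 * m) • e) haT.le (hx.mono le_rfl hTb)
    (fun t ht => hx0 t ⟨ht.1, ht.2.trans hTb⟩)
    ((innerSL ℝ (√(2 * m) • e)).contDiff.contDiffOn) (fun t _ => hg _) (fun t ht => by
      rw [norm_smul, hen, mul_one, Real.norm_eq_abs, sq_abs, Real.sq_sqrt (by positivity)]
      have := hV t ⟨ht.1, ht.2.trans hTb⟩ (hle t ht)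
      linarith)
  refine le_trans (ENNReal.ofReal_le_ofReal ?_) hmain
  rw [← inner_sub_right, ← hw, inner_smul_left, he, inner_smul_left, real_inner_self_eq_norm_sq]
  simp only [conj_trivial]
  have : ‖w‖⁻¹ * ‖w‖ ^ 2 = ‖w‖ := by field_simp
  rw [this]
  exact mul_le_mul_of_nonneg_left hT.2 (Real.sqrt_nonneg _)

/-- The constant C bounds the Lagrangian at speed at most 1, and the segment is run in time A/C.
Keeping A > 0 free allows y = z, where a time interval of positive length is still needed. -/
lemma Setting.reach_segment (h : Setting ξm ξp Vmin V α p κ) {ε : ℝ} (hε : 0 < ε) :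
    ∃ C > 0, ∀ (y z : E d) (A : ℝ), 0 < A → C * ‖z - y‖ ≤ A →
      (∀ θ ∈ Icc (0 : ℝ) 1, ε ≤ ‖y + θ • (z - y)‖) → Reach V ε y z A := by
  obtain ⟨M, hM, hV⟩ := h.exists_le
  have hC : 0 < 1 / 2 + M / ε ^ α := by positivity
  refine ⟨1 / 2 + M / ε ^ α, hC, fun y z A hA hle hθ => ?_⟩
  set C := 1 / 2 + M / ε ^ α with hCdef
  set T := A / C with hT
  have hTpos : 0 < T := by positivity
  have hd : ∀ t, HasDerivAt (fun t : ℝ => y + (t / T) • (z - y)) ((1 / T) • (z - y)) t := fun t =>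
    (((hasDerivAt_id t).div_const T).smul_const (z - y)).const_add y
  have hn : ‖(1 / T) • (z - y)‖ ≤ 1 := by
    rw [norm_smul, Real.norm_eq_abs, abs_of_pos (by positivity), hT]
    rw [one_div_div, div_mul_eq_mul_div, div_le_one hA]; exact hle
  have hreg : ∀ t ∈ Icc 0 T, ε ≤ ‖y + (t / T) • (z - y)‖ := fun t ht =>
    hθ _ ⟨div_nonneg ht.1 hTpos.le, (div_le_one hTpos).2 ht.2⟩
  have hne : ∀ t ∈ Icc 0 T, y + (t / T) • (z - y) ≠ 0 := fun t ht =>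
    norm_pos_iff.1 (hε.trans_le (hreg t ht))
  refine ⟨0, T, fun t => y + (t / T) • (z - y), hTpos,
    isH1_of_hasDerivAt (K := 1) (fun t _ => hd t) (fun t _ => hn), by simp, ?_, hreg, ?_⟩
  · simp [div_self hTpos.ne']
  · refine (action_le_of_hasDerivAt (g := fun t => C * t) (g' := fun _ => C) hTpos.le
      (fun t _ => by simpa using (hasDerivAt_id t).const_mul C) hne
      (fun t ht => h.nonneg _ (hne t ht)) ?_ (fun _ _ => hC.le)).trans ?_
    · filter_upwards [ae_restrict_mem measurableSet_Icc] with t ht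
      rw [(hd t).deriv, hCdef]
      have h1 : V (y + (t / T) • (z - y)) ≤ M / ε ^ α :=
        (hV _ (hne t ht)).trans (by have := hreg t ht; have := h.pot.alpha_pos; gcongr)
      nlinarith [norm_nonneg ((1 / T) • (z - y))]
    · rw [mul_zero, sub_zero, hT, mul_div_cancel₀ _ hC.ne']

/-- The chord between two points near the sphere may enter the ball. Both points are first pushed
outwards by the factor 1 + c, c = 2‖z - y‖/ε, and the chord is taken there; the three pieces have
length linear in ‖z - y‖. -/
lemma Setting.reach_local (h : Setting ξm ξp Vmin V α p κ) {ε : ℝ} (hε : 0 < ε) (R : ℝ) :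
    ∃ C > 0, ∀ (y z : E d) (A : ℝ), ε ≤ ‖y‖ → ε ≤ ‖z‖ → ‖y‖ ≤ R → ‖z‖ ≤ R → ‖z - y‖ ≤ ε / 2 →
      0 < A → C * ‖z - y‖ ≤ A → Reach V ε y z A := by
  rcases lt_or_ge R ε with hR | hR
  · exact ⟨1, one_pos, fun y z A h1 _ h3 => absurd (h1.trans h3) (not_le.2 hR)⟩
  obtain ⟨C, hC, H⟩ := h.reach_segment hε
  have hR0 : 0 < R := hε.trans_le hR
  refine ⟨3 * C * (2 * R / ε + 2), by positivity, fun y z A hy hz hyR hzR hyz hA hle => ?_⟩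
  set l := ‖z - y‖ with hl
  have hl0 : 0 ≤ l := norm_nonneg _
  set c := 2 * l / ε with hc
  have hc0 : 0 ≤ c := by positivity
  have hc1 : c ≤ 1 := by rw [hc, div_le_one hε]; linarith
  have hlc : l = c * ε / 2 := by rw [hc]; field_simp
  have hle1 : C * (2 * R / ε * l) ≤ A / 3 := by
    have : 0 ≤ C * l := by positivity
    have : C * (2 * R / ε * l) ≤ C * (2 * R / ε + 2) * l := by nlinarith
    linarith
  have hle2 : C * (2 * l) ≤ A / 3 := by
    have : 0 ≤ C * l * (2 * R / ε) := by positivity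
    nlinarith
  have radial : ∀ u : E d, ε ≤ ‖u‖ → ‖u‖ ≤ R → Reach V ε u ((1 + c) • u) (A / 3) := by
    intro u hu huR
    have e : (1 + c) • u - u = c • u := by module
    refine H _ _ _ (by positivity) ?_ ?_
    · rw [e, norm_smul, Real.norm_eq_abs, abs_of_nonneg hc0]
      refine le_trans ?_ hle1
      have : c * ‖u‖ ≤ 2 * R / ε * l := by
        rw [hc]
        calc 2 * l / ε * ‖u‖ ≤ 2 * l / ε * R := by gcongr
          _ = 2 * R / ε * l := by ring
      gcongr
    · intro θ hθ
      have e2 : u + θ • ((1 + c) • u - u) = (1 + θ * c) • u := by module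
      rw [e2, norm_smul, Real.norm_eq_abs, abs_of_nonneg (by have := hθ.1; positivity)]
      nlinarith [mul_nonneg (mul_nonneg hθ.1 hc0) (norm_nonneg u)]
  have mid : Reach V ε ((1 + c) • y) ((1 + c) • z) (A / 3) := by
    have e : (1 + c) • z - (1 + c) • y = (1 + c) • (z - y) := by module
    refine H _ _ _ (by positivity) ?_ ?_
    · rw [e, norm_smul, Real.norm_eq_abs, abs_of_nonneg (by positivity), ← hl]
      refine le_trans ?_ hle2
      gcongr; linarith
    · intro θ hθ
      have e2 : (1 + c) • y + θ • ((1 + c) • z - (1 + c) • y) = (1 + c) • (y + θ • (z - y)) := by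
        module
      rw [e2, norm_smul, Real.norm_eq_abs, abs_of_nonneg (by positivity)]
      have h1 : ε - l ≤ ‖y + θ • (z - y)‖ := by
        have h2 : ‖y‖ ≤ ‖y + θ • (z - y)‖ + ‖θ • (z - y)‖ := by
          have := norm_sub_le (y + θ • (z - y)) (θ • (z - y))
          rwa [add_sub_cancel_right] at this
        have h3 : ‖θ • (z - y)‖ ≤ l := by
          rw [norm_smul, Real.norm_eq_abs, abs_of_nonneg hθ.1, ← hl]
          nlinarith [hθ.2]
        linarith
      -- With l = cε/2 this is (1 + c)(1 - c/2) ≥ 1, which holds for 0 ≤ c ≤ 1.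
      calc ε ≤ (1 + c) * (ε - l) := by rw [hlc]; nlinarith [mul_nonneg hc0 (sub_nonneg.2 hc1)]
        _ ≤ _ := by gcongr
  have := ((radial y hy hyR).trans (by positivity) (by positivity) mid).trans (by positivity)
    (by positivity) (radial z hz hzR).symm
  exact this.le le_rfl (by linarith)

/-- The radial retraction maps the punctured space, connected since d ≥ 2, onto this set. -/
lemma isPreconnected_le_norm (hd : 2 ≤ d) {ε : ℝ} (hε : 0 < ε) :
    IsPreconnected {x : E d | ε ≤ ‖x‖} := by
  have hrank : 1 < Module.rank ℝ (E d) := by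
    rw [← Module.finrank_eq_rank, finrank_euclideanSpace_fin]
    exact_mod_cast hd
  have h0 : IsPreconnected ({0}ᶜ : Set (E d)) :=
    (isConnected_compl_singleton_of_one_lt_rank hrank 0).isPreconnected
  have himg : (fun x : E d => max 1 (ε / ‖x‖) • x) '' {0}ᶜ = {x : E d | ε ≤ ‖x‖} := by
    ext y
    constructor
    · rintro ⟨x, hx, rfl⟩
      have hr : 0 < ‖x‖ := norm_pos_iff.2 hx
      simp only [mem_ofPred_eq, norm_smul, Real.norm_eq_abs]
      rw [abs_of_nonneg (by positivity)]
      calc ε = ε / ‖x‖ * ‖x‖ := by field_simp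
        _ ≤ _ := by gcongr; exact le_max_right _ _
    · intro hy
      have hy' : ε ≤ ‖y‖ := hy
      have hr : 0 < ‖y‖ := hε.trans_le hy'
      refine ⟨y, norm_pos_iff.1 hr, ?_⟩
      simp only
      rw [max_eq_left ((div_le_one hr).2 hy'), one_smul]
  rw [← himg]
  refine h0.image _ ?_
  refine ContinuousOn.smul (continuousOn_const.sup (continuousOn_const.div continuousOn_id.norm ?_))
    continuousOn_id
  intro x hx
  exact norm_ne_zero_iff.2 hx

/-- Reachability is a symmetric and transitive relation that holds locally, hence holds on all of a
preconnected set. It makes `reachInf` the infimum of a nonempty set. -/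
lemma Setting.exists_reach_of_le_norm (h : Setting ξm ξp Vmin V α p κ) (hd : 2 ≤ d) {ε : ℝ}
    (hε : 0 < ε) {y z : E d} (hy : ε ≤ ‖y‖) (hz : ε ≤ ‖z‖) : ∃ A > 0, Reach V ε y z A := by
  refine (isPreconnected_le_norm hd hε).induction₂ (fun y z => ∃ A > 0, Reach V ε y z A)
    ?_ ?_ ?_ hy hz
  · intro u hu
    obtain ⟨C, hC, H⟩ := h.reach_local hε (‖u‖ + ε)
    have hball : Metric.ball u (ε / 2) ∈ 𝓝 u := Metric.ball_mem_nhds u (by positivity)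
    filter_upwards [mem_nhdsWithin_of_mem_nhds hball, self_mem_nhdsWithin] with v hv hvr
    rw [mem_ball_iff_norm] at hv
    have hvn : ‖v‖ ≤ ‖u‖ + ε := by
      have := norm_add_le u (v - u)
      rw [add_sub_cancel] at this
      linarith
    exact ⟨C * ‖v - u‖ + 1, by positivity,
      H u v _ hu hvr (by linarith) hvn hv.le (by positivity) (by linarith)⟩
  · rintro u v w _ _ _ ⟨A, hA, h1⟩ ⟨B, hB, h2⟩
    exact ⟨A + B, by positivity, h1.trans hA.le hB.le h2⟩
  · rintro u v _ _ ⟨A, hA, h1⟩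
    exact ⟨A, hA, h1.symm⟩

/-! ### The distance induced by the action -/

/-- The infimum of the action over the paths from `y` to `z` outside the ball of radius `ε`. -/
def reachInf (V : E d → ℝ) (ε : ℝ) (y z : E d) : ℝ := sInf {A | 0 < A ∧ Reach V ε y z A}

lemma reachInf_nonneg (V : E d → ℝ) (ε : ℝ) (y z : E d) : 0 ≤ reachInf V ε y z :=
  Real.sInf_nonneg fun _ hA => hA.1.le

lemma reachInf_le {ε : ℝ} {y z : E d} {A : ℝ} (hA : 0 < A) (h : Reach V ε y z A) :
    reachInf V ε y z ≤ A := csInf_le ⟨0, fun _ hA => hA.1.le⟩ ⟨hA, h⟩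

lemma reachInf_symm (V : E d → ℝ) (ε : ℝ) (y z : E d) : reachInf V ε y z = reachInf V ε z y := by
  unfold reachInf
  congr 1; ext A
  exact ⟨fun h => ⟨h.1, h.2.symm⟩, fun h => ⟨h.1, h.2.symm⟩⟩

lemma Setting.reach_of_lt (h : Setting ξm ξp Vmin V α p κ) (hd : 2 ≤ d) {ε : ℝ}
    (hε : 0 < ε) {y z : E d} (hy : ε ≤ ‖y‖) (hz : ε ≤ ‖z‖) {A : ℝ} (hA : reachInf V ε y z < A) :
    Reach V ε y z A := by
  obtain ⟨B, hB, hBA⟩ := exists_lt_of_csInf_lt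
    (by obtain ⟨B, hB⟩ := h.exists_reach_of_le_norm hd hε hy hz; exact ⟨B, hB⟩) hA
  exact hB.2.le le_rfl hBA.le

lemma Setting.le_reachInf (h : Setting ξm ξp Vmin V α p κ) (hd : 2 ≤ d) {ε : ℝ}
    (hε : 0 < ε) {y z : E d} (hy : ε ≤ ‖y‖) (hz : ε ≤ ‖z‖) {B : ℝ}
    (hB : ∀ A, 0 < A → Reach V ε y z A → B ≤ A) : B ≤ reachInf V ε y z :=
  le_csInf (by obtain ⟨B, hB⟩ := h.exists_reach_of_le_norm hd hε hy hz; exact ⟨B, hB⟩)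
    fun A hA => hB A hA.1 hA.2

lemma Setting.reachInf_triangle (h : Setting ξm ξp Vmin V α p κ) (hd : 2 ≤ d) {ε : ℝ}
    (hε : 0 < ε) {y z w : E d} (hy : ε ≤ ‖y‖) (hz : ε ≤ ‖z‖) (hw : ε ≤ ‖w‖) :
    reachInf V ε y w ≤ reachInf V ε y z + reachInf V ε z w := by
  refine le_of_forall_pos_le_add fun δ hδ => ?_
  have h1 := h.reach_of_lt hd hε hy hz (lt_add_of_pos_right (reachInf V ε y z) (half_pos hδ))
  have h2 := h.reach_of_lt hd hε hz hw (lt_add_of_pos_right (reachInf V ε z w) (half_pos hδ))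
  have n1 := reachInf_nonneg V ε y z
  have n2 := reachInf_nonneg V ε z w
  have := reachInf_le (by linarith) (h1.trans (by linarith) (by linarith) h2)
  linarith

lemma Setting.tendsto_reachInf (h : Setting ξm ξp Vmin V α p κ) {ε : ℝ} (hε : 0 < ε)
    {ι : Type*} {l : Filter ι} {u : ι → E d} {y : E d} (hy : ε ≤ ‖y‖)
    (hu : ∀ᶠ i in l, ε ≤ ‖u i‖) (ht : Tendsto u l (𝓝 y)) :
    Tendsto (fun i => reachInf V ε y (u i)) l (𝓝 0) := by
  obtain ⟨C, hC, H⟩ := h.reach_local hε (‖y‖ + ε)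
  rw [Metric.tendsto_nhds]
  intro δ hδ
  have hnorm : Tendsto (fun i => ‖u i - y‖) l (𝓝 0) := tendsto_iff_norm_sub_tendsto_zero.1 ht
  have h1 := hnorm.eventually (gt_mem_nhds (show 0 < ε / 2 by positivity))
  have h2 := hnorm.eventually (gt_mem_nhds (show 0 < δ / (2 * C) by positivity))
  filter_upwards [hu, h1, h2] with i hi hi1 hi2
  have hun : ‖u i‖ ≤ ‖y‖ + ε := by
    have := norm_add_le y (u i - y)
    rw [add_sub_cancel] at this
    linarith
  have h3 : C * ‖u i - y‖ ≤ δ / 2 := by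
    rw [lt_div_iff₀ (by positivity)] at hi2; linarith
  have := reachInf_le (half_pos hδ) (H y (u i) (δ / 2) hy hi (by linarith) hun hi1.le
    (half_pos hδ) h3)
  rw [Real.dist_eq, sub_zero, abs_of_nonneg (reachInf_nonneg _ _ _ _)]
  linarith

lemma Setting.sqrt_mul_min_le (h : Setting ξm ξp Vmin V α p κ) (hd : 2 ≤ d) {ε : ℝ} (hε : 0 < ε)
    {y z : E d} (hy : ε ≤ ‖y‖) (hz : ε ≤ ‖z‖) {m ρ : ℝ} (hm : 0 ≤ m) (hρ : 0 ≤ ρ)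
    (hV : ∀ w, ε ≤ ‖w‖ → ‖w - y‖ ≤ ρ → m ≤ V w) :
    √(2 * m) * min ‖z - y‖ ρ ≤ reachInf V ε y z := by
  refine h.le_reachInf hd hε hy hz fun A hA hr => ?_
  obtain ⟨a, b, x, hab, hx, rfl, rfl, h3, h4⟩ := hr
  exact (ENNReal.ofReal_le_ofReal_iff hA.le).1 ((sqrt_mul_min_le_action hm hρ hab.le hx
    (fun t ht => norm_pos_iff.1 (hε.trans_le (h3 t ht))) (fun t ht => hV _ (h3 t ht))).trans h4)

end

section
variable {ξm ξp : E d} {Vmin : ℝ} {V : E d → ℝ} {α p κ : ℝ}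

/-! ### Busemann functions -/

/-- The case σ = 0 of `Setting.exists_reach`: on the axis there is no error term. -/
lemma Setting.reach_ray (h : Setting ξm ξp Vmin V α p κ) {r₁ r₂ : ℝ} (h1 : 0 < r₁)
    (h12 : 2 * r₁ ≤ r₂) : Reach V r₁ (r₁ • ξp) (r₂ • ξp) (p / κ * (r₂ ^ κ - r₁ ^ κ)) := by
  obtain ⟨C, hC, σ₀, hσ₀, -, H⟩ := h.exists_reach
  have := H r₁ r₂ 0 ξp ξp h1 h12 h.norm_ξp h.norm_ξp (by simp) (by simp) hσ₀.le
  simpa using this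

/-- The renormalized distance to infinity in the direction `ξ`. -/
def busemannTerm (V : E d → ℝ) (ε κ c : ℝ) (ξ y : E d) (n : ℕ) : ℝ :=
  reachInf V ε y ((ε * 2 ^ n) • ξ) - c * (ε * 2 ^ n) ^ κ

/-- For c = p/κ, ξ = ξp and y outside the open ball the terms decrease, so the infimum is the limit.
The radii double because `Setting.reach_ray` joins radii with ratio at least 2. -/
def busemann (V : E d → ℝ) (ε κ c : ℝ) (ξ y : E d) : ℝ := ⨅ n, busemannTerm V ε κ c ξ y n

lemma norm_smul_of_norm_one {r : ℝ} (hr : 0 ≤ r) {ξ : E d} (hξ : ‖ξ‖ = 1) : ‖r • ξ‖ = r := by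
  rw [norm_smul, hξ, mul_one, Real.norm_eq_abs, abs_of_nonneg hr]

lemma coneFun_smul {κ c η r : ℝ} {ξ : E d} (hξ : ‖ξ‖ = 1) (hr : 0 < r) :
    coneFun κ (c - 2 * η) (2 * η) ξ (r • ξ) = c * r ^ κ := by
  rw [coneFun_eq hξ (smul_ne_zero hr.ne' (ne_zero_of_norm_one hξ)), norm_smul_of_norm_one hr.le hξ,
    smul_smul, inv_mul_cancel₀ hr.ne']
  simp

lemma le_radius {ε : ℝ} (hε : 0 < ε) (n : ℕ) : ε ≤ ε * 2 ^ n :=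
  le_mul_of_one_le_right hε.le (one_le_pow₀ one_le_two)

lemma le_norm_radius {ε : ℝ} (hε : 0 < ε) {ξ : E d} (hξ : ‖ξ‖ = 1) (n : ℕ) :
    ε ≤ ‖(ε * 2 ^ n) • ξ‖ := by
  rw [norm_smul_of_norm_one (by positivity) hξ]; exact le_radius hε n

/-- On the axis the penalty vanishes, so the value of the cone function at the far end is exactly
the subtracted (p/κ) r^κ. -/
lemma Setting.neg_coneFun_le_busemannTerm (h : Setting ξm ξp Vmin V α p κ) (hd : 2 ≤ d) {ε : ℝ}
    (hε : 0 < ε) {η : ℝ} (hη0 : 0 ≤ η) (hη : η ≤ p * κ / 2) {y : E d} (hy : ε ≤ ‖y‖) (n : ℕ) :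
    -coneFun κ (p / κ - 2 * η) (2 * η) ξp y ≤ busemannTerm V ε κ (p / κ) ξp y n := by
  have hR : 0 < ε * 2 ^ n := by positivity
  have := h.le_reachInf hd hε hy (le_norm_radius hε h.norm_ξp n)
    (B := coneFun κ (p / κ - 2 * η) (2 * η) ξp ((ε * 2 ^ n) • ξp) -
      coneFun κ (p / κ - 2 * η) (2 * η) ξp y)
    (fun A hA hr => h.coneFun_sub_le h.norm_ξp hη0 hη hε hA.le hr)
  rw [coneFun_smul h.norm_ξp hR] at this
  unfold busemannTerm
  linarith

lemma Setting.mul_κ_nonneg (h : Setting ξm ξp Vmin V α p κ) : 0 ≤ p * κ / 2 := by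
  have := h.p_pos; have := h.κ_pos; positivity

lemma Setting.bddBelow_busemannTerm (h : Setting ξm ξp Vmin V α p κ) (hd : 2 ≤ d) {ε : ℝ}
    (hε : 0 < ε) {y : E d} (hy : ε ≤ ‖y‖) :
    BddBelow (range (busemannTerm V ε κ (p / κ) ξp y)) := by
  refine ⟨-coneFun κ (p / κ - 2 * 0) (2 * 0) ξp y, ?_⟩
  rintro _ ⟨n, rfl⟩
  exact h.neg_coneFun_le_busemannTerm hd hε le_rfl h.mul_κ_nonneg hy n

lemma Setting.neg_coneFun_le_busemann (h : Setting ξm ξp Vmin V α p κ) (hd : 2 ≤ d) {ε : ℝ}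
    (hε : 0 < ε) {η : ℝ} (hη0 : 0 ≤ η) (hη : η ≤ p * κ / 2) {y : E d} (hy : ε ≤ ‖y‖) :
    -coneFun κ (p / κ - 2 * η) (2 * η) ξp y ≤ busemann V ε κ (p / κ) ξp y :=
  le_ciInf fun n => h.neg_coneFun_le_busemannTerm hd hε hη0 hη hy n

/-- Moving the target out along the axis costs at most the increase of (p/κ) r^κ, which is what the
renormalization removes. -/
lemma Setting.antitone_busemannTerm (h : Setting ξm ξp Vmin V α p κ) (hd : 2 ≤ d) {ε : ℝ}
    (hε : 0 < ε) {y : E d} (hy : ε ≤ ‖y‖) : Antitone (busemannTerm V ε κ (p / κ) ξp y) := by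
  refine antitone_nat_of_succ_le fun n => ?_
  have hR : 0 < ε * 2 ^ n := by positivity
  have hκ := h.κ_pos
  have hp := h.p_pos
  have e : ε * 2 ^ (n + 1) = 2 * (ε * 2 ^ n) := by ring
  have h1 := h.reach_ray hR (r₂ := ε * 2 ^ (n + 1)) e.ge
  have hlt : (ε * 2 ^ n) ^ κ < (ε * 2 ^ (n + 1)) ^ κ := by
    exact Real.rpow_lt_rpow hR.le (by linarith) hκ
  have h2 := reachInf_le (mul_pos (by positivity) (sub_pos.2 hlt)) (h1.le (le_radius hε n) le_rfl)
  have h3 := h.reachInf_triangle hd hε hy (le_norm_radius hε h.norm_ξp n)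
    (le_norm_radius hε h.norm_ξp (n + 1))
  unfold busemannTerm
  linarith

lemma Setting.tendsto_busemannTerm (h : Setting ξm ξp Vmin V α p κ) (hd : 2 ≤ d) {ε : ℝ}
    (hε : 0 < ε) {y : E d} (hy : ε ≤ ‖y‖) :
    Tendsto (busemannTerm V ε κ (p / κ) ξp y) atTop (𝓝 (busemann V ε κ (p / κ) ξp y)) :=
  tendsto_atTop_ciInf (h.antitone_busemannTerm hd hε hy) (h.bddBelow_busemannTerm hd hε hy)

lemma Setting.busemann_le_term (h : Setting ξm ξp Vmin V α p κ) (hd : 2 ≤ d) {ε : ℝ}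
    (hε : 0 < ε) {y : E d} (hy : ε ≤ ‖y‖) (n : ℕ) :
    busemann V ε κ (p / κ) ξp y ≤ busemannTerm V ε κ (p / κ) ξp y n :=
  ciInf_le (h.bddBelow_busemannTerm hd hε hy) n

lemma Setting.busemann_le_add (h : Setting ξm ξp Vmin V α p κ) (hd : 2 ≤ d) {ε : ℝ}
    (hε : 0 < ε) {y z : E d} (hy : ε ≤ ‖y‖) (hz : ε ≤ ‖z‖) :
    busemann V ε κ (p / κ) ξp y ≤ reachInf V ε y z + busemann V ε κ (p / κ) ξp z := by
  rw [← sub_le_iff_le_add']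
  refine le_ciInf fun n => ?_
  have h1 := h.busemann_le_term hd hε hy n
  have h3 := h.reachInf_triangle hd hε hy hz (le_norm_radius hε h.norm_ξp n)
  unfold busemannTerm at h1 ⊢
  linarith

lemma Setting.continuousOn_busemann (h : Setting ξm ξp Vmin V α p κ) (hd : 2 ≤ d) {ε : ℝ}
    (hε : 0 < ε) : ContinuousOn (busemann V ε κ (p / κ) ξp) {y | ε ≤ ‖y‖} := by
  intro y hy
  have h1 := h.tendsto_reachInf hε (l := 𝓝[{y | ε ≤ ‖y‖}] y) (u := id) hy self_mem_nhdsWithin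
    (tendsto_id.mono_left nhdsWithin_le_nhds)
  rw [ContinuousWithinAt, tendsto_iff_norm_sub_tendsto_zero]
  refine squeeze_zero' (Eventually.of_forall fun _ => norm_nonneg _) ?_ h1
  filter_upwards [self_mem_nhdsWithin] with z hz
  have h2 := h.busemann_le_add hd hε hy hz
  have h3 := h.busemann_le_add hd hε hz hy
  rw [reachInf_symm] at h3
  rw [Real.norm_eq_abs, abs_le]
  simp only [id]
  constructor <;> linarith

/-! ### Minimizing rays -/

/-- The accumulated action F is continuous and monotone, and g = x ∘ T for a chosen right inverse T
of F. Injectivity of F is not needed: F t < F u already forces t < u. -/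
lemma exists_param_by_action {V : E d → ℝ} (hVc : ContinuousOn V {0}ᶜ)
    (hV0 : ∀ x, x ≠ 0 → 0 ≤ V x) {ε : ℝ} (hε : 0 < ε) {y z : E d} {A : ℝ} (hA : 0 ≤ A)
    (h : Reach V ε y z A) :
    ∃ (L : ℝ) (g : ℝ → E d), (0 ≤ L ∧ L ≤ A ∧ Reach V ε y z L) ∧ g 0 = y ∧
      (∀ s, 0 ≤ s → s < L → ε ≤ ‖g s‖ ∧ Reach V ε (g s) z (L - s)) ∧
      ∀ s t, 0 ≤ s → s < t → t < L → Reach V ε (g s) (g t) (t - s) := by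
  obtain ⟨a, b, x, hab, hx, rfl, rfl, h3, h4⟩ := h
  have hne : ∀ t ∈ Icc a b, x t ≠ 0 := fun t ht => norm_pos_iff.1 (hε.trans_le (h3 t ht))
  set F : ℝ → ℝ := fun t => (action V a t x).toReal with hF
  have hfin : ∀ t ∈ Icc a b, ∀ u ∈ Icc a b, t ≤ u → action V t u x ≠ ⊤ := fun t ht u hu htu =>
    action_ne_top hVc hV0 htu (hx.mono ht.1 hu.2)
      fun τ hτ => hne τ ⟨ht.1.trans hτ.1, hτ.2.trans hu.2⟩
  have ha : a ∈ Icc a b := left_mem_Icc.2 hab.le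
  have hb : b ∈ Icc a b := right_mem_Icc.2 hab.le
  have hadd : ∀ t ∈ Icc a b, ∀ u ∈ Icc a b, t ≤ u →
      action V t u x = ENNReal.ofReal (F u - F t) := by
    intro t ht u hu htu
    have h1 := action_add (V := V) (x := x) ht.1 htu
    have h2 : F u = F t + (action V t u x).toReal := by
      simp only [hF]
      rw [h1, ENNReal.toReal_add (hfin a ha t ht ht.1) (hfin t ht u hu htu)]
    rw [h2, add_sub_cancel_left, ENNReal.ofReal_toReal (hfin t ht u hu htu)]
  have hmono : MonotoneOn F (Icc a b) := by
    intro t ht u hu htu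
    exact ENNReal.toReal_mono (hfin a ha u hu hu.1) (action_mono le_rfl htu)
  have hcont : ContinuousOn F (Icc a b) := by
    have hi := intervalIntegrable_lagrangian hVc hab.le hx hne
    have hi' := (intervalIntegrable_iff_integrableOn_Icc_of_le hab.le).1 (hi.1.add hi.2)
    have h1 := intervalIntegral.continuousOn_primitive_interval
      (μ := volume) (f := fun t => ‖deriv x t‖ ^ 2 / 2 + V (x t)) (a := a) (b := b)
      (by rw [uIcc_of_le hab.le]; exact hi')
    rw [uIcc_of_le hab.le] at h1
    refine h1.congr fun t ht => ?_
    simp only [hF]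
    rw [action_eq_ofReal hVc hV0 ht.1 (hx.mono le_rfl ht.2)
      (fun τ hτ => hne τ ⟨hτ.1, hτ.2.trans ht.2⟩), ENNReal.toReal_ofReal]
    refine intervalIntegral.integral_nonneg ht.1 fun τ hτ => ?_
    have := hV0 _ (hne τ ⟨hτ.1, hτ.2.trans ht.2⟩)
    positivity
  have hF0 : F a = 0 := by
    simp only [hF, action]
    rw [Icc_self, setLIntegral_measure_zero _ _ (by simp)]; simp
  have hex : ∀ s, 0 ≤ s → s < F b → ∃ t ∈ Icc a b, F t = s := by
    intro s hs hsb
    have := intermediate_value_Icc hab.le hcont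
    rw [hF0] at this
    exact this ⟨hs, hsb.le⟩
  have hex' : ∀ s, ∃ t, (s ≤ 0 → t = a) ∧ (0 ≤ s → s < F b → t ∈ Icc a b ∧ F t = s) := by
    intro s
    rcases le_or_gt s 0 with hs | hs
    · exact ⟨a, fun _ => rfl, fun h0 _ => ⟨ha, by rw [hF0]; linarith⟩⟩
    · by_cases h1 : s < F b
      · obtain ⟨t, ht, hte⟩ := hex s hs.le h1
        exact ⟨t, fun h => absurd h (not_le.2 hs), fun _ _ => ⟨ht, hte⟩⟩
      · exact ⟨a, fun _ => rfl, fun _ h => absurd h h1⟩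
  choose T hT0 hT using hex'
  have hreach : ∀ t ∈ Icc a b, ∀ u ∈ Icc a b, t < u → Reach V ε (x t) (x u) (F u - F t) :=
    fun t ht u hu htu => ⟨t, u, x, htu, hx.mono ht.1 hu.2, rfl, rfl,
      fun τ hτ => h3 τ ⟨ht.1.trans hτ.1, hτ.2.trans hu.2⟩, (hadd t ht u hu htu.le).le⟩
  have hlt : ∀ t ∈ Icc a b, ∀ u ∈ Icc a b, F t < F u → t < u := by
    intro t ht u hu hlt
    by_contra hcon
    exact absurd (hmono hu ht (not_lt.1 hcon)) (not_le.2 hlt)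
  refine ⟨F b, fun s => x (T s), ?_, by simp [hT0 0 le_rfl], ?_, ?_⟩
  · refine ⟨ENNReal.toReal_nonneg, ENNReal.toReal_le_of_le_ofReal hA h4, ?_⟩
    have := hreach a ha b hb hab
    rwa [hF0, sub_zero] at this
  · intro s hs hsL
    obtain ⟨h5, h6⟩ := hT s hs hsL
    refine ⟨h3 _ h5, ?_⟩
    have := hreach _ h5 b hb (hlt _ h5 b hb (by rw [h6]; exact hsL))
    rwa [h6] at this
  · intro s t hs hst htL
    obtain ⟨h5, h6⟩ := hT s hs (hst.trans htL)
    obtain ⟨h7, h8⟩ := hT t (hs.trans hst.le) htL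
    have := hreach _ h5 _ h7 (hlt _ h5 _ h7 (by rw [h6, h8]; exact hst))
    rwa [h6, h8] at this

lemma reachInf_self (h : Setting ξm ξp Vmin V α p κ) {ε : ℝ} (hε : 0 < ε) {y : E d}
    (hy : ε ≤ ‖y‖) : reachInf V ε y y = 0 :=
  tendsto_nhds_unique tendsto_const_nhds (h.tendsto_reachInf hε (l := (atTop : Filter ℕ))
    (u := fun _ => y) hy (Eventually.of_forall fun _ => hy) tendsto_const_nhds)

lemma Setting.norm_rpow_le (h : Setting ξm ξp Vmin V α p κ) (hd : 2 ≤ d) {ε : ℝ} (hε : 0 < ε)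
    {y z : E d} (hy : ε ≤ ‖y‖) (hz : ε ≤ ‖z‖) :
    p / κ * (‖z‖ ^ κ - ‖y‖ ^ κ) ≤ reachInf V ε y z :=
  h.le_reachInf hd hε hy hz fun _ hA hr => h.le_of_reach hε hA.le hr

/-- Limit of almost minimal paths from q to points going to infinity on the axis, all parametrized
by action. In this parametrization their points at parameter s stay in a compact set independent of
n, because `reachInf` controls the growth of ‖x‖^κ. -/
lemma Setting.exists_ray (h : Setting ξm ξp Vmin V α p κ) (hd : 2 ≤ d) {ε : ℝ} (hε : 0 < ε)
    {q : E d} (hq : ε ≤ ‖q‖) :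
    ∃ γ : ℝ → E d, γ 0 = q ∧ (∀ s, 0 ≤ s → ε ≤ ‖γ s‖) ∧
      (∀ s, 0 ≤ s → busemann V ε κ (p / κ) ξp (γ s) = busemann V ε κ (p / κ) ξp q - s) ∧
      ∀ s t, 0 ≤ s → s ≤ t → reachInf V ε (γ s) (γ t) ≤ t - s := by
  have hκ := h.κ_pos
  have hp := h.p_pos
  set e : ℕ → E d := fun n => (ε * 2 ^ n) • ξp with he
  have hen : ∀ n, ε ≤ ‖e n‖ := le_norm_radius hε h.norm_ξp
  have hex : ∀ n : ℕ, ∃ (L : ℝ) (g : ℝ → E d),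
      (0 ≤ L ∧ L ≤ reachInf V ε q (e n) + 1 / (n + 1) ∧ Reach V ε q (e n) L) ∧ g 0 = q ∧
      (∀ s, 0 ≤ s → s < L → ε ≤ ‖g s‖ ∧ Reach V ε (g s) (e n) (L - s)) ∧
      ∀ s t, 0 ≤ s → s < t → t < L → Reach V ε (g s) (g t) (t - s) := by
    intro n
    have h1 : (0 : ℝ) < 1 / (n + 1) := by positivity
    exact exists_param_by_action h.continuousOn h.nonneg hε
      (add_nonneg (reachInf_nonneg _ _ _ _) h1.le)
      (h.reach_of_lt hd hε hq (hen n) (lt_add_of_pos_right _ h1))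
  choose L g hLle hg0 hgz hgg using hex
  have hRtop : Tendsto (fun n : ℕ => (ε * 2 ^ n) ^ κ) atTop atTop :=
    (tendsto_rpow_atTop hκ).comp ((tendsto_pow_atTop_atTop_of_one_lt one_lt_two).const_mul_atTop hε)
  have hLtop : Tendsto L atTop atTop := by
    have h1 : Tendsto (fun n : ℕ => p / κ * ((ε * 2 ^ n) ^ κ - ‖q‖ ^ κ)) atTop atTop :=
      (tendsto_atTop_add_const_right _ _ hRtop).const_mul_atTop (by positivity)
    refine tendsto_atTop_mono (fun n => ?_) h1
    have := h.le_of_reach hε (hLle n).1 (hLle n).2.2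
    rwa [he, norm_smul_of_norm_one (by positivity) h.norm_ξp] at this
  have hdist : ∀ n s t, 0 ≤ s → s ≤ t → t < L n → reachInf V ε (g n s) (g n t) ≤ t - s := by
    intro n s t hs hst ht
    rcases hst.eq_or_lt with rfl | hlt
    · rw [reachInf_self h hε (hgz n s hs ht).1, sub_self]
    · exact reachInf_le (sub_pos.2 hlt) (hgg n s t hs hlt ht)
  have hbound : ∀ s, 0 ≤ s → ∀ᶠ n in atTop, g n s ∈
      Metric.closedBall (0 : E d) ((‖q‖ ^ κ + s * κ / p) ^ κ⁻¹) ∩ {y | ε ≤ ‖y‖} := by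
    intro s hs
    filter_upwards [hLtop.eventually_gt_atTop s] with n hn
    have h1 := (hgz n s hs hn).1
    refine ⟨?_, h1⟩
    have h2 := hdist n 0 s le_rfl hs hn
    rw [hg0] at h2
    have h3 := (h.norm_rpow_le hd hε hq h1).trans h2
    rw [mem_closedBall_zero_iff, Real.le_rpow_inv_iff_of_pos (norm_nonneg _) (by positivity) hκ]
    rw [div_mul_eq_mul_div, div_le_iff₀ hκ] at h3
    rw [← sub_le_iff_le_add', le_div_iff₀ hp]
    linarith
  -- An ultrafilter gives the limits at all parameters s simultaneously, without a diagonal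
  -- extraction.
  set U := Ultrafilter.of (atTop : Filter ℕ) with hU
  have hUle : (U : Filter ℕ) ≤ atTop := Ultrafilter.of_le _
  have hlim : ∀ s, ∃ y : E d, 0 ≤ s → ε ≤ ‖y‖ ∧ Tendsto (fun n => g n s) U (𝓝 y) := by
    intro s
    rcases le_or_gt 0 s with hs | hs
    · have hK : IsCompact (Metric.closedBall (0 : E d) ((‖q‖ ^ κ + s * κ / p) ^ κ⁻¹) ∩
          {y | ε ≤ ‖y‖}) :=
        (isCompact_closedBall _ _).inter_right (isClosed_le continuous_const continuous_norm)
      obtain ⟨y, hy, hy2⟩ := hK.ultrafilter_le_nhds (U.map fun n => g n s) (by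
        rw [le_principal_iff]
        exact (hbound s hs).filter_mono hUle)
      exact ⟨y, fun _ => ⟨hy.2, hy2⟩⟩
    · exact ⟨0, fun h => absurd h (not_le.2 hs)⟩
  choose γ hγ using hlim
  have hLs : ∀ s, ∀ᶠ n in (U : Filter ℕ), s < L n := fun s =>
    (hLtop.eventually_gt_atTop s).filter_mono hUle
  have hclose : ∀ s, 0 ≤ s → Tendsto (fun n => reachInf V ε (γ s) (g n s)) U (𝓝 0) := by
    intro s hs
    refine h.tendsto_reachInf hε (hγ s hs).1 ?_ (hγ s hs).2
    filter_upwards [hLs s] with n hn using (hgz n s hs hn).1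
  have hlip : ∀ s t, 0 ≤ s → s ≤ t → reachInf V ε (γ s) (γ t) ≤ t - s := by
    intro s t hs hst
    have ht := hs.trans hst
    have h1 : Tendsto (fun n => reachInf V ε (γ s) (g n s) + ((t - s) +
        reachInf V ε (γ t) (g n t))) U (𝓝 (0 + ((t - s) + 0))) :=
      (hclose s hs).add ((hclose t ht).const_add _)
    rw [zero_add, add_zero] at h1
    refine ge_of_tendsto h1 ?_
    filter_upwards [hLs t] with n hn
    have e1 := (hgz n s hs (hst.trans_lt hn)).1
    have e2 := (hgz n t ht hn).1
    have h2 := h.reachInf_triangle hd hε (hγ s hs).1 e1 (hγ t ht).1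
    have h3 := h.reachInf_triangle hd hε e1 e2 (hγ t ht).1
    have h4 := hdist n s t hs hst hn
    rw [reachInf_symm V ε (g n t) (γ t)] at h3
    linarith
  have hγ0 : γ 0 = q := by
    refine tendsto_nhds_unique (hγ 0 le_rfl).2 ?_
    simp only [hg0]
    exact tendsto_const_nhds
  refine ⟨γ, hγ0, fun s hs => (hγ s hs).1, fun s hs => le_antisymm ?_ ?_, hlip⟩
  -- From g n s the target is reached with action L n - s, and L n exceeds the distance from q by at
  -- most 1/(n+1); so almost minimality passes to the Busemann function. The opposite inequality is
  -- its Lipschitz bound.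
  · have h1 : Tendsto (fun n : ℕ => reachInf V ε (γ s) (g n s) +
        ((busemannTerm V ε κ (p / κ) ξp q n + 1 / ((n : ℝ) + 1)) - s)) U
        (𝓝 (0 + ((busemann V ε κ (p / κ) ξp q + 0) - s))) :=
      (hclose s hs).add ((((h.tendsto_busemannTerm hd hε hq).mono_left hUle).add
        (tendsto_one_div_add_atTop_nhds_zero_nat.mono_left hUle)).sub_const s)
    rw [zero_add, add_zero] at h1
    refine ge_of_tendsto h1 ?_
    filter_upwards [hLs s] with n hn
    obtain ⟨e1, e2⟩ := hgz n s hs hn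
    have h2 := h.busemann_le_add hd hε (hγ s hs).1 e1
    have h3 := h.busemann_le_term hd hε e1 n
    have h4 := reachInf_le (sub_pos.2 hn) e2
    have h5 := (hLle n).2.1
    unfold busemannTerm at h3 ⊢
    simp only [he] at h4 h5
    linarith
  · have h2 := h.busemann_le_add hd hε hq (hγ s hs).1
    have h3 := hlip 0 s le_rfl hs
    rw [hγ0] at h3
    linarith

end

section
variable {ξm ξp : E d} {Vmin : ℝ} {V : E d → ℝ} {α p κ : ℝ}

/-! ### Parametrization by time -/

lemma Setting.norm_le_of_reachInf_le (h : Setting ξm ξp Vmin V α p κ) (hd : 2 ≤ d) {ε : ℝ}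
    (hε : 0 < ε) {y z : E d} (hy : ε ≤ ‖y‖) (hz : ε ≤ ‖z‖) {B : ℝ} (hB0 : 0 ≤ B)
    (hB : reachInf V ε y z ≤ B) : ‖z‖ ≤ (‖y‖ ^ κ + B * κ / p) ^ κ⁻¹ := by
  have hκ := h.κ_pos
  have hp := h.p_pos
  have h3 := (h.norm_rpow_le hd hε hy hz).trans hB
  rw [Real.le_rpow_inv_iff_of_pos (norm_nonneg _) (by positivity) hκ]
  rw [div_mul_eq_mul_div, div_le_iff₀ hκ] at h3
  rw [← sub_le_iff_le_add', le_div_iff₀ hp]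
  linarith

/-- On bounded sets V is bounded below, so `reachInf` dominates the Euclidean distance up to
displacement 1; larger displacements are at most 2R. -/
lemma Setting.lipschitz_of_reachInf_le (h : Setting ξm ξp Vmin V α p κ) (hd : 2 ≤ d) {ε : ℝ}
    (hε : 0 < ε) {γ : ℝ → E d} (hreg : ∀ s, ε ≤ ‖γ s‖)
    (hlip : ∀ s t, s ≤ t → reachInf V ε (γ s) (γ t) ≤ t - s) (a b : ℝ) :
    ∃ K, 0 ≤ K ∧ ∀ s ∈ Icc a b, ∀ t ∈ Icc a b, ‖γ s - γ t‖ ≤ K * |s - t| := by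
  rcases lt_or_ge b a with hab | hab
  · exact ⟨0, le_rfl, by simp [Icc_eq_empty_of_lt hab]⟩
  have hκ := h.κ_pos
  have hp := h.p_pos
  have hα := h.pot.alpha_pos
  set R := (‖γ a‖ ^ κ + (b - a) * κ / p) ^ κ⁻¹ with hR
  have hsub : 0 ≤ b - a := sub_nonneg.2 hab
  have hR0 : 0 ≤ R := by positivity
  have hbd : ∀ s ∈ Icc a b, ‖γ s‖ ≤ R := fun s hs =>
    h.norm_le_of_reachInf_le hd hε (hreg a) (hreg s) hsub
      ((hlip a s hs.1).trans (by linarith [hs.2]))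
  set m := Vmin / (R + 1) ^ α with hm
  have hm0 : 0 < m := div_pos h.Vmin_pos (by positivity)
  set c := √(2 * m) with hc
  have hc0 : 0 < c := Real.sqrt_pos.2 (by positivity)
  have key : ∀ s ∈ Icc a b, ∀ t ∈ Icc a b, s ≤ t → ‖γ s - γ t‖ ≤ (1 + 2 * R) / c * |s - t| := by
    intro s hs t ht hst
    have h1 := h.sqrt_mul_min_le hd hε (hreg s) (hreg t) hm0.le zero_le_one (fun w hw hws => by
      have hw0 : 0 < ‖w‖ := hε.trans_le hw
      refine le_trans ?_ (h.le (norm_pos_iff.1 hw0))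
      have : ‖w‖ ≤ R + 1 := by
        have := norm_add_le (γ s) (w - γ s)
        rw [add_sub_cancel] at this
        linarith [hbd s hs]
      have := h.Vmin_pos
      rw [hm]; gcongr)
    have h2 := h1.trans (hlip s t hst)
    rw [norm_sub_rev, abs_sub_comm, abs_of_nonneg (sub_nonneg.2 hst), div_mul_eq_mul_div,
      le_div_iff₀ hc0]
    rcases le_total ‖γ t - γ s‖ 1 with h3 | h3
    · rw [min_eq_left h3] at h2
      nlinarith [mul_nonneg hR0 (sub_nonneg.2 hst)]
    · rw [min_eq_right h3] at h2
      have h4 : ‖γ t - γ s‖ ≤ 2 * R := (norm_sub_le _ _).trans (by linarith [hbd s hs, hbd t ht])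
      have h5 : ‖γ t - γ s‖ * c ≤ 2 * R * c := by gcongr
      nlinarith [mul_nonneg hR0 (sub_nonneg.2 hst)]
  refine ⟨(1 + 2 * R) / c, by positivity, fun s hs t ht => ?_⟩
  rcases le_total s t with hst | hst
  · exact key s hs t ht hst
  · rw [norm_sub_rev, abs_sub_comm]; exact key t ht s hs hst

/-- At zero energy the Lagrangian is 2V, so time is recovered from the action parameter by dt =
ds/(2V); T is this time and S its inverse. It remains to see that the speed is at most √(2V), so
that the action is at most the increment of S. Differentiability of the curve is not needed: `deriv`
is 0 where it fails. -/
lemma Setting.exists_time_param (h : Setting ξm ξp Vmin V α p κ) (hd : 2 ≤ d) {ε : ℝ}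
    (hε : 0 < ε) {γ : ℝ → E d} (hreg : ∀ s, ε ≤ ‖γ s‖)
    (hlip : ∀ s t, s ≤ t → reachInf V ε (γ s) (γ t) ≤ t - s) :
    ∃ S : ℝ → ℝ, StrictMono S ∧ Function.Surjective S ∧ IsH1loc (fun t => γ (S t)) ∧
      ∀ a b, a < b → action V a b (fun t => γ (S t)) ≤ ENNReal.ofReal (S b - S a) := by
  have hα := h.pot.alpha_pos
  obtain ⟨M, hM, hVM⟩ := h.exists_le
  have hne : ∀ s, γ s ≠ 0 := fun s => norm_pos_iff.1 (hε.trans_le (hreg s))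
  have hVpos : ∀ s, 0 < V (γ s) := fun s => h.pos (hne s)
  have hVle : ∀ s, V (γ s) ≤ M / ε ^ α := fun s =>
    (hVM _ (hne s)).trans (by have := hreg s; gcongr)
  have hγc : Continuous γ := by
    rw [continuous_iff_continuousAt]
    intro s
    obtain ⟨K, hK, hKs⟩ := h.lipschitz_of_reachInf_le hd hε hreg hlip (s - 1) (s + 1)
    have : ContinuousOn γ (Icc (s - 1) (s + 1)) :=
      (LipschitzOnWith.of_dist_le_mul (K := ⟨K, hK⟩) (fun u hu v hv => by
        rw [dist_eq_norm, Real.dist_eq]; exact hKs u hu v hv)).continuousOn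
    exact this.continuousAt (Icc_mem_nhds (by linarith) (by linarith))
  have hVc : Continuous fun s => V (γ s) :=
    h.continuousOn.comp_continuous hγc hne
  set f : ℝ → ℝ := fun s => (2 * V (γ s))⁻¹ with hf
  have hfc : Continuous f := (continuous_const.mul hVc).inv₀ fun s => by
    exact (mul_pos two_pos (hVpos s)).ne'
  set T : ℝ → ℝ := fun s => ∫ τ in (0 : ℝ)..s, f τ with hT
  have hTd : ∀ s, HasDerivAt T (f s) s := fun s =>
    intervalIntegral.integral_hasDerivAt_right (hfc.intervalIntegrable _ _)
      (hfc.stronglyMeasurableAtFilter _ _) hfc.continuousAt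
  have hfpos : ∀ s, 0 < f s := fun s => by have := hVpos s; simp only [hf]; positivity
  have hTmono : StrictMono T := strictMono_of_deriv_pos fun s => by
    rw [(hTd s).deriv]; exact hfpos s
  set c := (2 * (M / ε ^ α))⁻¹ with hc
  have hc0 : 0 < c := by positivity
  have hfc' : ∀ s, c ≤ f s := fun s => by
    have := hVpos s
    simp only [hf, hc]
    gcongr
    exact hVle s
  have hTdiff : Differentiable ℝ T := fun s => (hTd s).differentiableAt
  have hTge : ∀ s t, s ≤ t → c * (t - s) ≤ T t - T s := fun s t hst =>
    mul_sub_le_image_sub_of_le_deriv hTdiff (fun u => by rw [(hTd u).deriv]; exact hfc' u) hst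
  have hT0 : T 0 = 0 := by simp [hT]
  have hTsurj : Function.Surjective T := by
    refine hTdiff.continuous.surjective ?_ ?_
    · refine tendsto_atTop_mono' _ ?_ (tendsto_id.const_mul_atTop hc0)
      filter_upwards [eventually_ge_atTop 0] with s hs
      have := hTge 0 s hs
      simpa [hT0] using this
    · refine tendsto_atBot_mono' _ ?_ (tendsto_id.const_mul_atBot hc0)
      filter_upwards [eventually_le_atBot 0] with s hs
      have := hTge s 0 hs
      rw [hT0] at this
      simp only [id]; linarith
  set e := hTmono.orderIsoOfSurjective T hTsurj with he
  set S : ℝ → ℝ := fun t => e.symm t with hS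
  have hTS : ∀ t, T (S t) = t := fun t => e.apply_symm_apply t
  have hSmono : StrictMono S := e.symm.strictMono
  have hSc : Continuous S := e.symm.continuous
  have hSd : ∀ t, HasDerivAt S (2 * V (γ (S t))) t := by
    intro t
    have := HasDerivAt.of_local_left_inverse hSc.continuousAt (hTd (S t)) (hfpos _).ne'
      (Eventually.of_forall hTS)
    simpa [hf] using this
  have hSlip : ∀ s t, s ≤ t → |S t - S s| ≤ c⁻¹ * |t - s| := by
    intro s t hst
    have h1 := hTge (S s) (S t) (hSmono.monotone hst)
    rw [hTS, hTS] at h1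
    rw [abs_of_nonneg (sub_nonneg.2 (hSmono.monotone hst)), abs_of_nonneg (sub_nonneg.2 hst)]
    rw [inv_mul_eq_div, le_div_iff₀ hc0]; linarith
  set x : ℝ → E d := fun t => γ (S t) with hx
  have hxH1 : IsH1loc x := by
    intro a b hab
    obtain ⟨K, hK, hKs⟩ := h.lipschitz_of_reachInf_le hd hε hreg hlip (S a) (S b)
    refine isH1_of_lipschitz (K := K * c⁻¹) fun s hs t ht => ?_
    have hSm : ∀ u ∈ Icc a b, S u ∈ Icc (S a) (S b) := fun u hu =>
      ⟨hSmono.monotone hu.1, hSmono.monotone hu.2⟩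
    refine (hKs _ (hSm s hs) _ (hSm t ht)).trans ?_
    rw [mul_assoc]
    refine mul_le_mul_of_nonneg_left ?_ hK
    rcases le_total s t with hst | hst
    · rw [abs_sub_comm, abs_sub_comm s]; exact hSlip s t hst
    · exact hSlip t s hst
  have hspeed : ∀ t, ‖deriv x t‖ ^ 2 ≤ 2 * V (x t) := by
    intro t
    have hV0 := hVpos (S t)
    -- Near x t one has V > m, so √(2m)‖Δx‖ ≤ |ΔS| ≈ 2V |Δt|; letting m increase to V gives ‖x'‖ ≤
    -- √(2V).
    have hbound : ∀ m, 0 < m → m < V (x t) → √(2 * m) * ‖deriv x t‖ ≤ 2 * V (x t) := by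
      intro m hm hmV
      have hq : 0 < √(2 * m) := Real.sqrt_pos.2 (by positivity)
      have hnh : {w | m < V w} ∈ 𝓝 (x t) :=
        (h.continuousOn.continuousAt (isOpen_compl_singleton.mem_nhds (hne (S t)))).eventually
          (lt_mem_nhds hmV)
      obtain ⟨ρ, hρ, hball⟩ := Metric.nhds_basis_closedBall.mem_iff.1 hnh
      refine le_of_forall_pos_le_add fun δ hδ => ?_
      rw [← le_div_iff₀' hq]
      refine norm_deriv_le_of_lip' (by positivity) ?_
      have hxc : Continuous x := hγc.comp hSc
      have e1 : ∀ᶠ u in 𝓝 t, ‖x u - x t‖ < ρ := by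
        have := (tendsto_iff_norm_sub_tendsto_zero.1 (hxc.tendsto t)).eventually
          (gt_mem_nhds hρ)
        exact this
      have e2 : ∀ᶠ u in 𝓝 t, |S u - S t| ≤ (2 * V (x t) + δ) * |u - t| := by
        have := (hasDerivAt_iff_isLittleO.1 (hSd t)).def hδ
        filter_upwards [this] with u hu
        rw [Real.norm_eq_abs, Real.norm_eq_abs, smul_eq_mul] at hu
        have h1 := abs_sub_abs_le_abs_sub (S u - S t) ((u - t) * (2 * V (γ (S t))))
        rw [abs_mul, abs_of_pos (show 0 < 2 * V (γ (S t)) by positivity)] at h1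
        simp only [hx]
        linarith
      filter_upwards [e1, e2] with u hu1 hu2
      have h1 : √(2 * m) * min ‖x u - x t‖ ρ ≤ |S u - S t| := by
        refine (h.sqrt_mul_min_le hd hε (hreg _) (hreg _) hm.le hρ.le (fun w _ hw => ?_)).trans
          (b := reachInf V ε (x t) (x u)) ?_
        · exact le_of_lt (hball (by rwa [mem_closedBall_iff_norm]))
        · rcases le_total t u with htu | htu
          · have := hlip _ _ (hSmono.monotone htu)
            rw [abs_of_nonneg (sub_nonneg.2 (hSmono.monotone htu))]
            exact this
          · have := hlip _ _ (hSmono.monotone htu)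
            rw [reachInf_symm, abs_sub_comm, abs_of_nonneg (sub_nonneg.2 (hSmono.monotone htu))]
            exact this
      rw [min_eq_left hu1.le] at h1
      rw [div_mul_eq_mul_div, le_div_iff₀' hq, Real.norm_eq_abs]
      exact h1.trans hu2
    by_contra hcon
    rw [not_le] at hcon
    have hN : 0 < ‖deriv x t‖ ^ 2 := lt_trans (by positivity) hcon
    have h2 : 2 * V (x t) ^ 2 / ‖deriv x t‖ ^ 2 < V (x t) := by
      rw [div_lt_iff₀ hN]; nlinarith
    obtain ⟨m, hm1, hm2⟩ := exists_between h2
    have hm0 : 0 < m := lt_of_le_of_lt (by positivity) hm1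
    have h3 := hbound m hm0 hm2
    have h4 : (√(2 * m) * ‖deriv x t‖) ^ 2 ≤ (2 * V (x t)) ^ 2 := by gcongr
    rw [mul_pow, Real.sq_sqrt (by positivity)] at h4
    rw [div_lt_iff₀ hN] at hm1
    nlinarith
  refine ⟨S, hSmono, e.symm.surjective, hxH1, fun a b hab => ?_⟩
  refine action_le_of_hasDerivAt hab.le (fun t _ => hSd t) (fun t _ => hne _)
    (fun t _ => (hVpos _).le) (ae_of_all _ fun t => ?_) (fun t _ => by
      have := hVpos (S t); positivity)
  have := hspeed t
  simp only [hx] at this ⊢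
  linarith

/-! ### Existence of constrained minimizers -/

lemma Setting.busemann_sub_le_action (h : Setting ξm ξp Vmin V α p κ) (hd : 2 ≤ d) {ε : ℝ}
    (hε : 0 < ε) {a b : ℝ} (hab : a ≤ b) {z : ℝ → E d} (hz : IsH1 a b z)
    (hreg : ∀ t ∈ Icc a b, ε ≤ ‖z t‖) :
    ENNReal.ofReal (busemann V ε κ (p / κ) ξp (z a) - busemann V ε κ (p / κ) ξp (z b)) ≤
      action V a b z ∧
    ENNReal.ofReal (busemann V ε κ (p / κ) ξp (z b) - busemann V ε κ (p / κ) ξp (z a)) ≤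
      action V a b z := by
  have ha := hreg a (left_mem_Icc.2 hab)
  have hb := hreg b (right_mem_Icc.2 hab)
  rcases hab.eq_or_lt with rfl | hlt
  · simp
  have hfin := action_ne_top h.continuousOn h.nonneg hab hz
    (fun t ht => norm_pos_iff.1 (hε.trans_le (hreg t ht)))
  have hr : ∀ δ > 0, reachInf V ε (z a) (z b) ≤ (action V a b z).toReal + δ := fun δ hδ =>
    reachInf_le (by positivity) ⟨a, b, z, hlt, hz, rfl, rfl, hreg, by
      rw [ENNReal.ofReal_add ENNReal.toReal_nonneg hδ.le, ENNReal.ofReal_toReal hfin]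
      exact le_self_add⟩
  have hr' := le_of_forall_pos_le_add hr
  have h1 := h.busemann_le_add hd hε ha hb
  have h2 := h.busemann_le_add hd hε hb ha
  rw [reachInf_symm] at h2
  constructor <;>
  · rw [ENNReal.ofReal_le_iff_le_toReal hfin]; linarith

/-- The Busemann function is B(γ 0) - s along the ray and at least minus the cone function. With η =
0 this forces ‖γ s‖^κ to grow linearly; with η = pκ/2, and (p/κ)(‖γ s‖^κ - ‖γ 0‖^κ) ≤ s, it bounds
‖γ s‖^κ times the squared angular deviation. -/
lemma Setting.exists_bound_dir (h : Setting ξm ξp Vmin V α p κ) (hd : 2 ≤ d) {ε : ℝ} (hε : 0 < ε)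
    {γ : ℝ → E d} (hreg : ∀ s, 0 ≤ s → ε ≤ ‖γ s‖)
    (hb : ∀ s, 0 ≤ s → busemann V ε κ (p / κ) ξp (γ s) = busemann V ε κ (p / κ) ξp (γ 0) - s)
    (hlip : ∀ s t, 0 ≤ s → s ≤ t → reachInf V ε (γ s) (γ t) ≤ t - s) :
    Tendsto (fun s => ‖γ s‖) atTop atTop ∧ Tendsto (fun s => ‖γ s‖⁻¹ • γ s) atTop (𝓝 ξp) := by
  have hκ := h.κ_pos
  have hp := h.p_pos
  have hpow : Tendsto (fun s => ‖γ s‖ ^ κ) atTop atTop := by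
    have h1 : Tendsto (fun s => (s - busemann V ε κ (p / κ) ξp (γ 0)) / (p / κ)) atTop atTop :=
      (tendsto_atTop_add_const_right _ _ tendsto_id).atTop_div_const (by positivity)
    refine tendsto_atTop_mono' _ ?_ h1
    filter_upwards [eventually_ge_atTop 0] with s hs
    have h2 := h.neg_coneFun_le_busemann hd hε le_rfl h.mul_κ_nonneg (hreg s hs)
    rw [coneFun_zero, hb s hs] at h2
    rw [div_le_iff₀ (by positivity)]
    linarith
  have hnorm : Tendsto (fun s => ‖γ s‖) atTop atTop := by
    have h1 := (tendsto_rpow_atTop (inv_pos.2 hκ)).comp hpow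
    refine h1.congr fun s => ?_
    exact Real.rpow_rpow_inv (norm_nonneg _) hκ.ne'
  refine ⟨hnorm, ?_⟩
  set η := p * κ / 2 with hη
  have hη0 : 0 < η := by positivity
  set C := busemann V ε κ (p / κ) ξp (γ 0) + p / κ * ‖γ 0‖ ^ κ with hC
  have hbound : ∀ s, 0 ≤ s → ‖‖γ s‖⁻¹ • γ s - ξp‖ ^ 2 ≤ C / η * (‖γ s‖ ^ κ)⁻¹ := by
    intro s hs
    have hn : 0 < ‖γ s‖ := hε.trans_le (hreg s hs)
    have h2 := h.neg_coneFun_le_busemann hd hε hη0.le le_rfl (hreg s hs)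
    rw [coneFun_eq h.norm_ξp (norm_pos_iff.1 hn), hb s hs] at h2
    have h3 := (h.norm_rpow_le hd hε (hreg 0 le_rfl) (hreg s hs)).trans (hlip 0 s le_rfl hs)
    have hk : 0 < ‖γ s‖ ^ κ := by positivity
    rw [← div_eq_mul_inv, le_div_iff₀ hk, le_div_iff₀ hη0]
    linarith
  rw [tendsto_iff_norm_sub_tendsto_zero]
  have h1 : Tendsto (fun s => C / η * (‖γ s‖ ^ κ)⁻¹) atTop (𝓝 0) := by
    simpa using (tendsto_inv_atTop_zero.comp hpow).const_mul (C / η)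
  have h2 : Tendsto (fun s => ‖‖γ s‖⁻¹ • γ s - ξp‖ ^ 2) atTop (𝓝 0) := by
    refine squeeze_zero' (Eventually.of_forall fun s => by positivity) ?_ h1
    filter_upwards [eventually_ge_atTop 0] with s hs using hbound s hs
  have h3 := h2.sqrt
  simpa using h3

/-- The two rays start at a minimum point q of B⁻ + B⁺ on the sphere. A competitor touching the
sphere at z t is bounded below by an increment of B⁻ before t and of B⁺ after it; the sum involves
(B⁻ + B⁺)(z t), which is at least its value at q. An arc lying on a single ray is calibrated by one
of the two functions. -/
theorem Setting.exists_minimizer (h : Setting ξm ξp Vmin V α p κ) (hd : 2 ≤ d) {ε : ℝ}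
    (hε : 0 < ε) : ∃ x, IsConstrainedMorseMin ξm ξp V ε x := by
  set B : E d → E d → ℝ := fun ξ => busemann V ε κ (p / κ) ξ with hB
  have hsphere : Metric.sphere (0 : E d) ε ⊆ {y | ε ≤ ‖y‖} := fun y hy =>
    (mem_sphere_zero_iff_norm.1 hy).ge
  obtain ⟨q, hq, hqmin⟩ := (isCompact_sphere (0 : E d) ε).exists_isMinOn
    ⟨ε • ξp, by rw [mem_sphere_zero_iff_norm, norm_smul_of_norm_one hε.le h.norm_ξp]⟩
    (((h.swap.continuousOn_busemann hd hε).mono hsphere).add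
      ((h.continuousOn_busemann hd hε).mono hsphere))
  rw [mem_sphere_zero_iff_norm] at hq
  obtain ⟨γp, hp0, hpreg, hpb, hplip⟩ := h.exists_ray hd hε hq.ge
  obtain ⟨γm, hm0, hmreg, hmb, hmlip⟩ := h.swap.exists_ray hd hε hq.ge
  set γ : ℝ → E d := fun s => if 0 ≤ s then γp s else γm (-s) with hγ
  have hγp : ∀ s, 0 ≤ s → γ s = γp s := fun s hs => if_pos hs
  have hγm : ∀ s, s ≤ 0 → γ s = γm (-s) := by
    intro s hs
    rcases hs.eq_or_lt with rfl | hs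
    · rw [hγp 0 le_rfl, hp0, neg_zero, hm0]
    · exact if_neg (not_le.2 hs)
  have hγ0 : γ 0 = q := by rw [hγp 0 le_rfl, hp0]
  have hreg : ∀ s, ε ≤ ‖γ s‖ := by
    intro s
    rcases le_total 0 s with hs | hs
    · rw [hγp s hs]; exact hpreg s hs
    · rw [hγm s hs]; exact hmreg _ (by linarith)
  have hlip : ∀ s t, s ≤ t → reachInf V ε (γ s) (γ t) ≤ t - s := by
    have hneg : ∀ s t, s ≤ t → t ≤ 0 → reachInf V ε (γ s) (γ t) ≤ t - s := by
      intro s t hst ht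
      rw [hγm t ht, hγm s (hst.trans ht), reachInf_symm]
      have := hmlip (-t) (-s) (by linarith) (by linarith)
      linarith
    have hpos : ∀ s t, s ≤ t → 0 ≤ s → reachInf V ε (γ s) (γ t) ≤ t - s := by
      intro s t hst hs
      rw [hγp s hs, hγp t (hs.trans hst)]
      exact hplip s t hs hst
    intro s t hst
    rcases le_total t 0 with ht | ht
    · exact hneg s t hst ht
    rcases le_total 0 s with hs | hs
    · exact hpos s t hst hs
    have h1 := h.reachInf_triangle hd hε (hreg s) (hreg 0) (hreg t)
    have h2 := hneg s 0 hs le_rfl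
    have h3 := hpos 0 t ht le_rfl
    linarith
  have hbp : ∀ s, 0 ≤ s → B ξp (γ s) = B ξp q - s := fun s hs => by
    rw [hγp s hs]; exact hpb s hs
  have hbm : ∀ s, s ≤ 0 → B ξm (γ s) = B ξm q + s := fun s hs => by
    rw [hγm s hs, hB]
    have := hmb (-s) (by linarith)
    simp only
    rw [this]; ring
  obtain ⟨S, hSmono, hSsurj, hH1, hact⟩ := h.exists_time_param hd hε hreg hlip
  have hStop : Tendsto S atTop atTop := by
    refine tendsto_atTop.2 fun b => ?_
    obtain ⟨t, rfl⟩ := hSsurj b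
    filter_upwards [eventually_ge_atTop t] with u hu using hSmono.monotone hu
  have hSbot : Tendsto S atBot atBot := by
    refine tendsto_atBot.2 fun b => ?_
    obtain ⟨t, rfl⟩ := hSsurj b
    filter_upwards [eventually_le_atBot t] with u hu using hSmono.monotone hu
  obtain ⟨hpn, hpd⟩ := h.exists_bound_dir hd hε hpreg (by rw [hp0]; exact hpb) hplip
  obtain ⟨hmn, hmd⟩ := h.swap.exists_bound_dir hd hε hmreg (by rw [hm0]; exact hmb) hmlip
  have hevp : ∀ᶠ t in atTop, γ (S t) = γp (S t) := by
    filter_upwards [hStop.eventually_ge_atTop 0] with t ht using hγp _ ht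
  have hevm : ∀ᶠ t in atBot, γ (S t) = γm (-S t) := by
    filter_upwards [hSbot.eventually_le_atBot 0] with t ht using hγm _ ht
  have hSneg : Tendsto (fun t => -S t) atBot atTop := tendsto_neg_atBot_atTop.comp hSbot
  refine ⟨fun t => γ (S t), hH1, ⟨?_, ?_⟩, ?_, ?_, ?_, ?_, ?_⟩
  · obtain ⟨t, ht⟩ := hSsurj 0
    exact ⟨t, by simp only [ht, hγ0, hq]⟩
  · rintro _ ⟨t, rfl⟩
    exact hreg _
  · refine (hpn.comp hStop).congr' ?_
    filter_upwards [hevp] with t ht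
    simp [ht]
  · refine (hmn.comp hSneg).congr' ?_
    filter_upwards [hevm] with t ht
    simp [ht]
  · refine (hpd.comp hStop).congr' ?_
    filter_upwards [hevp] with t ht
    simp [ht]
  · refine (hmd.comp hSneg).congr' ?_
    filter_upwards [hevm] with t ht
    simp [ht]
  · rintro a b a' b' z hab hab' hz hza hzb ⟨ρ, hρz, hρx⟩
    refine (hact a b hab).trans ?_
    have hρε : ε ≤ ρ := by
      obtain ⟨t, -, ht⟩ := hρx.1
      rw [← ht]; exact hreg _
    have hzreg : ∀ t ∈ Icc a' b', ε ≤ ‖z t‖ := fun t ht =>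
      hρε.trans (hρz.2 (mem_image_of_mem _ ht))
    have hSab := hSmono hab
    rcases le_total 0 (S a) with ha | ha
    · have h1 := (h.busemann_sub_le_action hd hε hab'.le hz hzreg).1
      rw [hza, hzb] at h1
      have e1 := hbp _ ha
      have e2 := hbp _ (ha.trans hSab.le)
      simp only [hB] at e1 e2
      rw [e1, e2] at h1
      refine le_trans (ENNReal.ofReal_le_ofReal ?_) h1
      linarith
    rcases le_total (S b) 0 with hb | hb
    · have h1 := (h.swap.busemann_sub_le_action hd hε hab'.le hz hzreg).2
      rw [hza, hzb] at h1
      have e1 := hbm _ ha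
      have e2 := hbm _ hb
      simp only [hB] at e1 e2
      rw [e1, e2] at h1
      refine le_trans (ENNReal.ofReal_le_ofReal ?_) h1
      linarith
    · have hρ : ρ = ε := by
        refine le_antisymm ?_ hρε
        obtain ⟨t, ht⟩ := hSsurj 0
        have : t ∈ Icc a b := ⟨hSmono.le_iff_le.1 (by rwa [ht]), hSmono.le_iff_le.1 (by rwa [ht])⟩
        have h1 := hρx.2 (mem_image_of_mem _ this)
        simpa only [ht, hγ0, hq] using h1
      obtain ⟨t, ht, hzt⟩ := hρz.1
      simp only [hρ] at hzt
      have h1 := (h.swap.busemann_sub_le_action hd hε ht.1 (hz.mono le_rfl ht.2)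
        (fun u hu => hzreg u ⟨hu.1, hu.2.trans ht.2⟩)).2
      have h2 := (h.busemann_sub_le_action hd hε ht.2 (hz.mono ht.1 le_rfl)
        (fun u hu => hzreg u ⟨ht.1.trans hu.1, hu.2⟩)).1
      have h3 := hqmin (mem_sphere_zero_iff_norm.2 hzt)
      have e1 := hbm _ ha
      have e2 := hbp _ hb
      simp only [hB, mem_ofPred_eq, Pi.add_apply] at e1 e2 h3
      rw [hza, e1] at h1
      rw [hzb, e2] at h2
      rw [action_add ht.1 ht.2]
      refine le_trans ?_ (add_le_add h1 h2)
      refine le_trans (ENNReal.ofReal_le_ofReal ?_) ENNReal.ofReal_add_le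
      linarith

end

/-! ### Integration by parts and first variation -/

lemma memLp_inner_integrable {a b : ℝ} (hab : a ≤ b) {v w : ℝ → E d}
    (hv : MemLp v 2 (volume.restrict (Icc a b))) (hw : MemLp w 2 (volume.restrict (Icc a b))) :
    IntervalIntegrable (fun t => inner ℝ (v t) (w t)) volume a b := by
  rw [intervalIntegrable_iff_integrableOn_Icc_of_le hab]
  refine (hv.norm.integrable_mul hw.norm).mono' (hv.1.inner hw.1) (ae_of_all _ fun t => ?_)
  exact norm_inner_le_norm _ _

lemma IsH1.memLp {a b : ℝ} {x : ℝ → E d} (h : IsH1 a b x) :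
    MemLp x 2 (volume.restrict (Icc a b)) := by
  obtain ⟨C, hC⟩ := isCompact_Icc.exists_bound_of_continuousOn h.continuousOn
  exact MemLp.of_bound (h.continuousOn.aestronglyMeasurable measurableSet_Icc) C
    (by filter_upwards [ae_restrict_mem measurableSet_Icc] with t ht using hC t ht)

lemma IsH1.integral_inner {a b : ℝ} (hab : a ≤ b) {f g : ℝ → E d} (hf : IsH1 a b f)
    (hg : IsH1 a b g) :
    ∫ t in a..b, (inner ℝ (f t) (deriv g t) + inner ℝ (deriv f t) (g t)) =
      inner ℝ (f b) (g b) - inner ℝ (f a) (g a) := by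
  have ha : a ∈ Icc a b := left_mem_Icc.2 hab
  have hb : b ∈ Icc a b := right_mem_Icc.2 hab
  obtain ⟨Cf, hCf⟩ := isCompact_Icc.exists_bound_of_continuousOn hf.continuousOn
  obtain ⟨Cg, hCg⟩ := isCompact_Icc.exists_bound_of_continuousOn hg.continuousOn
  have hCf0 : 0 ≤ Cf := (norm_nonneg _).trans (hCf a ha)
  have hCg0 : 0 ≤ Cg := (norm_nonneg _).trans (hCg a ha)
  have hif : ∀ s ∈ Icc a b, ∀ t ∈ Icc a b, IntervalIntegrable (fun τ => ‖deriv f τ‖ + ‖deriv g τ‖)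
      volume s t := fun s hs t ht => (memLp_two_intervalIntegrable hf.memLp_deriv hs ht).norm.add
    (memLp_two_intervalIntegrable hg.memLp_deriv hs ht).norm
  have hac := (hif a ha b hb).absolutelyContinuousOnInterval_intervalIntegral (c := a) (by simp)
  have hle : ∀ u : ℝ → E d, IsH1 a b u → (∀ τ, ‖deriv u τ‖ ≤ ‖deriv f τ‖ + ‖deriv g τ‖) →
      ∀ s ∈ Icc a b, ∀ t ∈ Icc a b, ‖u s - u t‖ ≤
      dist (∫ τ in a..s, (‖deriv f τ‖ + ‖deriv g τ‖)) (∫ τ in a..t, (‖deriv f τ‖ + ‖deriv g τ‖)) := by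
    intro u hu hle s hs t ht
    rw [dist_eq_norm, intervalIntegral.integral_interval_sub_left (hif a ha s hs) (hif a ha t ht),
      hu.sub_eq ht hs, Real.norm_eq_abs]
    refine intervalIntegral.norm_integral_le_abs_of_norm_le ?_ (hif t ht s hs)
    exact ae_of_all _ hle
  have hF : AbsolutelyContinuousOnInterval (fun t => (inner ℝ (f t) (g t) : ℝ)) a b := by
    refine absolutelyContinuousOnInterval_of_dist_le (K := Cf + Cg) (by positivity) hac ?_
    rw [uIcc_of_le hab]
    intro s hs t ht
    have e : (inner ℝ (f s) (g s) : ℝ) - inner ℝ (f t) (g t) =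
        inner ℝ (f s) (g s - g t) + inner ℝ (f s - f t) (g t) := by
      rw [inner_sub_right, inner_sub_left]; ring
    rw [Real.dist_eq, e]
    refine (abs_add_le _ _).trans ?_
    rw [add_mul]
    refine add_le_add ((abs_real_inner_le_norm _ _).trans ?_)
      ((abs_real_inner_le_norm _ _).trans ?_)
    · exact mul_le_mul (hCf s hs) (hle g hg (fun τ => by simp) s hs t ht) (norm_nonneg _) hCf0
    · rw [mul_comm]
      exact mul_le_mul (hCg t ht) (hle f hf (fun τ => by simp) s hs t ht) (norm_nonneg _) hCg0
  rw [← hF.integral_deriv_eq_sub]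
  refine integral_congr_ae_Icc ?_ ha hb
  filter_upwards [hf.ae_hasDerivAt, hg.ae_hasDerivAt] with t h1 h2
  exact (h1.inner ℝ h2).deriv.symm

-- Only s > 0 is tested, since the constraint makes admissible variations one-sided. The action is
-- exactly quadratic in s in the kinetic part and differentiable in the potential part; the
-- increment is divided by s.
set_option maxHeartbeats 1000000 in
lemma first_variation {V : E d → ℝ} (hV : ContDiffOn ℝ 2 V {0}ᶜ) (hV0 : ∀ x, x ≠ 0 → 0 ≤ V x)
    {a b : ℝ} (hab : a < b) {x y : ℝ → E d} (hx : IsH1 a b x) (hy : IsH1 a b y) {ε : ℝ}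
    (hε : 0 < ε) (hxε : ∀ t ∈ Icc a b, ε ≤ ‖x t‖)
    (hmin : ∀ᶠ s in 𝓝[>] (0 : ℝ), action V a b x ≤ action V a b (fun t => x t + s • y t)) :
    0 ≤ ∫ t in a..b, (inner ℝ (deriv x t) (deriv y t) + fderiv ℝ V (x t) (y t)) := by
  have ha : a ∈ Icc a b := left_mem_Icc.2 hab.le
  have hb : b ∈ Icc a b := right_mem_Icc.2 hab.le
  have hopen : IsOpen ({0}ᶜ : Set (E d)) := isOpen_compl_singleton
  have hVc : ContinuousOn V {0}ᶜ := hV.continuousOn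
  have hV' : ContinuousOn (fderiv ℝ V) {0}ᶜ := hV.continuousOn_fderiv_of_isOpen hopen (by norm_num)
  obtain ⟨Y, hY⟩ := isCompact_Icc.exists_bound_of_continuousOn hy.continuousOn
  have hY0 : 0 ≤ Y := (norm_nonneg _).trans (hY a ha)
  set r := ε / (2 * (Y + 1)) with hr
  have hr0 : 0 < r := by positivity
  have hne : ∀ s ∈ Icc (-r) r, ∀ t ∈ Icc a b, x t + s • y t ≠ 0 := by
    intro s hs t ht h0
    have h1 : ‖x t‖ = ‖s • y t‖ := by rw [eq_neg_of_add_eq_zero_left h0, norm_neg]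
    have h2 : ‖s • y t‖ ≤ r * Y := by
      rw [norm_smul, Real.norm_eq_abs]
      exact mul_le_mul (abs_le.2 hs) (hY t ht) (norm_nonneg _) hr0.le
    have h3 : r * Y < ε := by
      have : r * (2 * (Y + 1)) = ε := by rw [hr]; field_simp
      nlinarith
    linarith [hxε t ht]
  have hcont2 : ContinuousOn (fun q : ℝ × ℝ => x q.2 + q.1 • y q.2) (Icc (-r) r ×ˢ Icc a b) :=
    (hx.continuousOn.comp continuousOn_snd fun q hq => hq.2).add
      (continuousOn_fst.smul (hy.continuousOn.comp continuousOn_snd fun q hq => hq.2))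
  have hcontV' : ContinuousOn (fun q : ℝ × ℝ => fderiv ℝ V (x q.2 + q.1 • y q.2))
      (Icc (-r) r ×ˢ Icc a b) := hV'.comp hcont2 fun q hq => hne q.1 hq.1 q.2 hq.2
  obtain ⟨M, hM⟩ := (isCompact_Icc.prod isCompact_Icc).exists_bound_of_continuousOn hcontV'
  have h0r : (0 : ℝ) ∈ Icc (-r) r := ⟨by linarith, hr0.le⟩
  have hcs : ∀ s ∈ Icc (-r) r, ContinuousOn (fun t => V (x t + s • y t)) (Icc a b) := fun s hs =>
    hVc.comp (hx.continuousOn.add (hy.continuousOn.const_smul s)) (hne s hs)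
  have hmeas : ∀ F : ℝ → ℝ, ContinuousOn F (Icc a b) →
      AEStronglyMeasurable F (volume.restrict (uIoc a b)) := by
    intro F hF
    rw [uIoc_of_le hab.le]
    exact (hF.mono Ioc_subset_Icc_self).aestronglyMeasurable measurableSet_Ioc
  have hder := intervalIntegral.hasDerivAt_integral_of_dominated_loc_of_deriv_le
    (F := fun s t => V (x t + s • y t)) (F' := fun s t => fderiv ℝ V (x t + s • y t) (y t))
    (x₀ := (0 : ℝ)) (a := a) (b := b) (μ := volume) (bound := fun _ => M * Y)
    (s := Ioo (-r) r) (Ioo_mem_nhds (by linarith) hr0)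
    (by filter_upwards [Ioo_mem_nhds (show -r < 0 by linarith) hr0] with s hs
        exact hmeas _ (hcs s (Ioo_subset_Icc_self hs)))
    ((ContinuousOn.intervalIntegrable (by rw [uIcc_of_le hab.le]; exact hcs 0 h0r)))
    (hmeas _ ((hV'.comp (hx.continuousOn.add (hy.continuousOn.const_smul (0 : ℝ)))
      (fun t ht => hne 0 h0r t ht)).clm_apply hy.continuousOn))
    (ae_of_all _ fun t ht s hs => by
      rw [uIoc_of_le hab.le] at ht
      have ht' := Ioc_subset_Icc_self ht
      refine (ContinuousLinearMap.le_opNorm _ _).trans ?_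
      have h1 := hM (s, t) ⟨Ioo_subset_Icc_self hs, ht'⟩
      exact mul_le_mul h1 (hY t ht') (norm_nonneg _) ((norm_nonneg _).trans h1))
    (intervalIntegrable_const)
    (ae_of_all _ fun t ht s hs => by
      rw [uIoc_of_le hab.le] at ht
      have ht' := Ioc_subset_Icc_self ht
      have h1 := ((hV.contDiffAt (hopen.mem_nhds
        (hne s (Ioo_subset_Icc_self hs) t ht'))).differentiableAt (by norm_num)).hasFDerivAt
      have h2 : HasDerivAt (fun s : ℝ => x t + s • y t) (y t) s := by
        simpa using ((hasDerivAt_id s).smul_const (y t)).const_add (x t)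
      exact h1.comp_hasDerivAt s h2)
  obtain ⟨hint', hder⟩ := hder
  simp only [zero_smul, add_zero] at hder hint'
  set P : ℝ → ℝ := fun s => ∫ t in a..b, V (x t + s • y t) with hP
  set B := ∫ t in a..b, (inner ℝ (deriv x t) (deriv y t) : ℝ) with hB
  set Q := ∫ t in a..b, (inner ℝ (deriv y t) (deriv y t) : ℝ) with hQ
  have hiB := memLp_inner_integrable hab.le hx.memLp_deriv hy.memLp_deriv
  have hiQ := memLp_inner_integrable hab.le hy.memLp_deriv hy.memLp_deriv
  have hiK := (intervalIntegrable_lagrangian hVc hab.le hx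
    (fun t ht => by simpa using hne 0 h0r t ht)).1
  rw [intervalIntegral.integral_add hiB hint']
  have hact : ∀ s ∈ Icc (-r) r, action V a b (fun t => x t + s • y t) =
      ENNReal.ofReal ((∫ t in a..b, ‖deriv x t‖ ^ 2 / 2) + s * B + s ^ 2 / 2 * Q + P s) ∧
      0 ≤ (∫ t in a..b, ‖deriv x t‖ ^ 2 / 2) + s * B + s ^ 2 / 2 * Q + P s := by
    intro s hs
    have hxy := hx.add_smul hy s
    have hi := intervalIntegrable_lagrangian hVc hab.le hxy (hne s hs)
    rw [action_eq_ofReal hVc hV0 hab.le hxy (hne s hs)]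
    have hnn : 0 ≤ ∫ t in a..b, (‖deriv (fun t => x t + s • y t) t‖ ^ 2 / 2 +
        V (x t + s • y t)) := intervalIntegral.integral_nonneg hab.le fun t ht => by
      have := hV0 _ (hne s hs t ht)
      positivity
    suffices e : ∫ t in a..b, (‖deriv (fun t => x t + s • y t) t‖ ^ 2 / 2 + V (x t + s • y t)) =
        (∫ t in a..b, ‖deriv x t‖ ^ 2 / 2) + s * B + s ^ 2 / 2 * Q + P s by
      rw [← e]; exact ⟨rfl, hnn⟩
    rw [intervalIntegral.integral_add hi.1 hi.2]
    congr 1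
    rw [hB, hQ, ← intervalIntegral.integral_const_mul, ← intervalIntegral.integral_const_mul,
      ← intervalIntegral.integral_add hiK (hiB.const_mul s),
      ← intervalIntegral.integral_add (hiK.add (hiB.const_mul s)) (hiQ.const_mul (s ^ 2 / 2))]
    refine integral_congr_ae_Icc ?_ ha hb
    filter_upwards [hx.ae_hasDerivAt, hy.ae_hasDerivAt] with t h1 h2
    have h3 : HasDerivAt (fun t => x t + s • y t) (deriv x t + s • deriv y t) t :=
      h1.add (h2.const_smul s)
    rw [h3.deriv, norm_add_sq_real, norm_smul, inner_smul_right, real_inner_self_eq_norm_sq,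
      mul_pow, Real.norm_eq_abs, sq_abs]
    ring
  have hx0 : action V a b x =
      ENNReal.ofReal ((∫ t in a..b, ‖deriv x t‖ ^ 2 / 2) + P 0) := by
    have := (hact 0 h0r).1
    simpa using this
  have hslope : Tendsto (fun s => B + s / 2 * Q + s⁻¹ * (P s - P 0)) (𝓝[>] 0)
      (𝓝 (B + 0 / 2 * Q + ∫ t in a..b, fderiv ℝ V (x t) (y t))) := by
    refine Tendsto.add (Tendsto.add tendsto_const_nhds ?_) ?_
    · have : Continuous fun s : ℝ => s / 2 * Q := by fun_prop
      exact (this.tendsto 0).mono_left nhdsWithin_le_nhds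
    · have := hder.hasDerivWithinAt (s := Ioi 0)
      have h2 := hasDerivWithinAt_iff_tendsto_slope' (lt_irrefl (0 : ℝ)) |>.1 this
      refine h2.congr fun s => ?_
      simp [slope, hP]
  rw [zero_div, zero_mul, add_zero] at hslope
  refine ge_of_tendsto hslope ?_
  filter_upwards [hmin, Ioo_mem_nhdsGT hr0] with s hs hsr
  have hsI : s ∈ Icc (-r) r := ⟨by linarith [hsr.1], hsr.2.le⟩
  have hs0 : 0 < s := hsr.1
  rw [(hact s hsI).1, hx0] at hs
  have h4 : (∫ t in a..b, ‖deriv x t‖ ^ 2 / 2) + P 0 ≤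
      (∫ t in a..b, ‖deriv x t‖ ^ 2 / 2) + s * B + s ^ 2 / 2 * Q + P s := by
    exact (ENNReal.ofReal_le_ofReal_iff (hact s hsI).2).1 hs
  have h6 : 0 ≤ s * (B + s / 2 * Q + s⁻¹ * (P s - P 0)) := by
    have : s * (B + s / 2 * Q + s⁻¹ * (P s - P 0)) = s * B + s ^ 2 / 2 * Q + (P s - P 0) := by
      field_simp
    rw [this]; linarith
  exact nonneg_of_mul_nonneg_right h6 hs0

section
variable {ξm ξp : E d} {Vmin : ℝ} {V : E d → ℝ} {α p κ ε : ℝ} {x : ℝ → E d}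

/-! ### Elementary properties of constrained minimizers -/

lemma IsConstrainedMorseMin.isH1 (hx : IsConstrainedMorseMin ξm ξp V ε x) (a b : ℝ) :
    IsH1 a b x := (hx.h1loc (min a (b - 1)) b (by
      rcases min_le_iff.1 (le_refl (min a (b - 1))) with h | h <;> linarith [min_le_right a (b - 1)])
    ).mono (min_le_left _ _) le_rfl

lemma IsConstrainedMorseMin.continuous (hx : IsConstrainedMorseMin ξm ξp V ε x) :
    Continuous x := by
  rw [continuous_iff_continuousAt]
  intro t
  exact (hx.isH1 (t - 1) (t + 1)).continuousOn.continuousAt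
    (Icc_mem_nhds (by linarith) (by linarith))

lemma IsConstrainedMorseMin.le_norm (hx : IsConstrainedMorseMin ξm ξp V ε x) (t : ℝ) :
    ε ≤ ‖x t‖ := hx.isLeast.2 (mem_range_self t)

lemma IsConstrainedMorseMin.ne_zero (hx : IsConstrainedMorseMin ξm ξp V ε x) (hε : 0 < ε) (t : ℝ) :
    x t ≠ 0 := norm_pos_iff.1 (hε.trans_le (hx.le_norm t))

lemma IsConstrainedMorseMin.exists_contact (hx : IsConstrainedMorseMin ξm ξp V ε x) :
    ∃ t, ‖x t‖ = ε := hx.isLeast.1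

/-- Time reversal exchanges the two asymptotic directions. -/
lemma IsConstrainedMorseMin.comp_neg (hx : IsConstrainedMorseMin ξm ξp V ε x) :
    IsConstrainedMorseMin ξp ξm V ε (fun t => x (-t)) where
  h1loc a b _ := (hx.isH1 (-b) (-a)).comp_neg
  isLeast := by
    have : (range fun t => ‖x (-t)‖) = range fun t => ‖x t‖ :=
      (neg_surjective (G := ℝ)).range_comp (fun t => ‖x t‖)
    rw [this]; exact hx.isLeast
  norm_atTop := hx.norm_atBot.comp tendsto_neg_atTop_atBot
  norm_atBot := hx.norm_atTop.comp tendsto_neg_atBot_atTop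
  dir_atTop := hx.dir_atBot.comp tendsto_neg_atTop_atBot
  dir_atBot := hx.dir_atTop.comp tendsto_neg_atBot_atTop
  minimal a b a' b' z hab hab' hz hza hzb hρ := by
    rw [action_comp_neg]
    have e : ∀ (u : ℝ → E d) (s t : ℝ), (fun t => ‖u (-t)‖) '' Icc (-t) (-s) =
        (fun t => ‖u t‖) '' Icc s t := by
      intro u s t
      have e : (fun t => ‖u (-t)‖) = (fun t => ‖u t‖) ∘ (fun t => -t) := rfl
      rw [e, image_comp]; simp
    have h1 := hx.minimal (-b) (-a) (-b') (-a') (fun t => z (-t)) (by linarith) (by linarith)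
      (IsH1.comp_neg (by simpa using hz)) (by simpa using hzb) (by simpa using hza) (by
        obtain ⟨ρ, h1, h2⟩ := hρ
        refine ⟨ρ, by rwa [e], ?_⟩
        have := e (fun t => x (-t)) a b
        simp only [neg_neg] at this
        rwa [this])
    rw [action_comp_neg] at h1
    simpa using h1

lemma IsConstrainedMorseMin.action_le_of_touchReach (hx : IsConstrainedMorseMin ξm ξp V ε x)
    {a b : ℝ} (hab : a < b) (hc : ∃ t ∈ Icc a b, ‖x t‖ = ε) {A : ℝ}
    (h : TouchReach V ε (x a) (x b) A) : action V a b x ≤ ENNReal.ofReal A := by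
  obtain ⟨a', b', z, hab', hz, h1, h2, h3, h4⟩ := h
  refine (hx.minimal a b a' b' z hab hab' hz h1 h2 ⟨ε, h3, ?_, ?_⟩).trans h4
  · obtain ⟨t, ht, hte⟩ := hc
    exact ⟨t, ht, hte⟩
  · rintro _ ⟨t, -, rfl⟩
    exact hx.le_norm t

lemma Setting.action_ne_top (h : Setting ξm ξp Vmin V α p κ) (hε : 0 < ε)
    (hx : IsConstrainedMorseMin ξm ξp V ε x) {a b : ℝ} (hab : a ≤ b) : action V a b x ≠ ⊤ :=
  ParabolicMin.action_ne_top h.continuousOn h.nonneg hab (hx.isH1 a b) fun t _ => hx.ne_zero hε t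

lemma Setting.reach_self (h : Setting ξm ξp Vmin V α p κ) (hε : 0 < ε)
    (hx : IsConstrainedMorseMin ξm ξp V ε x) {a b : ℝ} (hab : a < b) :
    Reach V ε (x a) (x b) (action V a b x).toReal :=
  ⟨a, b, x, hab, hx.isH1 a b, rfl, rfl, fun t _ => hx.le_norm t, by
    rw [ENNReal.ofReal_toReal (h.action_ne_top hε hx hab.le)]⟩

/-- Minimality compares only paths with the same minimal norm. Prepending the arc of x from a
contact time makes both paths touch the ball, and its finite action is then cancelled; so a free arc
can be compared with any path outside the ball. -/
lemma Setting.action_le_of_reach_of_le (h : Setting ξm ξp Vmin V α p κ) (hε : 0 < ε)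
    (hx : IsConstrainedMorseMin ξm ξp V ε x) {a b c : ℝ} (hca : c ≤ a) (hab : a < b)
    (hc : ‖x c‖ = ε) {A : ℝ} (hA : 0 ≤ A) (hr : Reach V ε (x a) (x b) A) :
    action V a b x ≤ ENNReal.ofReal A := by
  rcases hca.eq_or_lt with rfl | hlt
  · exact hx.action_le_of_touchReach hab ⟨c, left_mem_Icc.2 hab.le, hc⟩ (hr.touch_left hc)
  · have h1 := ((h.reach_self hε hx hlt).trans ENNReal.toReal_nonneg hA hr).touch_left hc
    have h2 := hx.action_le_of_touchReach (hlt.trans hab)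
      ⟨c, left_mem_Icc.2 (hlt.trans hab).le, hc⟩ h1
    rw [action_add hlt.le hab.le, ENNReal.ofReal_add ENNReal.toReal_nonneg hA,
      ENNReal.ofReal_toReal (h.action_ne_top hε hx hlt.le)] at h2
    exact (ENNReal.add_le_add_iff_left (h.action_ne_top hε hx hlt.le)).1 h2

lemma Setting.action_le_of_reach (h : Setting ξm ξp Vmin V α p κ) (hε : 0 < ε)
    (hx : IsConstrainedMorseMin ξm ξp V ε x) {a b c : ℝ} (hab : a < b) (hcab : c ∉ Ioo a b)
    (hc : ‖x c‖ = ε) {A : ℝ} (hA : 0 ≤ A) (hr : Reach V ε (x a) (x b) A) :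
    action V a b x ≤ ENNReal.ofReal A := by
  rcases le_or_gt c a with hca | hca
  · exact h.action_le_of_reach_of_le hε hx hca hab hc hA hr
  · have hbc : b ≤ c := by
      by_contra hcon
      exact hcab ⟨hca, not_le.1 hcon⟩
    have h1 := h.swap.action_le_of_reach_of_le hε hx.comp_neg (a := -b) (b := -a) (c := -c)
      (by linarith) (by linarith) (by simpa using hc) hA (by simpa using hr.symm)
    rw [action_comp_neg] at h1
    simpa using h1

/-! ### Conservation of energy -/

/-- The right-hand side has a minimum at c = 1, where its derivative is K - U. -/
lemma eq_of_forall_le_mul_add {K U : ℝ} (h : ∀ c : ℝ, 0 < c → K + U ≤ c * K + U / c) :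
    K = U := by
  have hlim : ∀ l : Filter ℝ, l ≤ 𝓝 1 → Tendsto (fun c : ℝ => U / c) l (𝓝 U) := by
    intro l hl
    have : ContinuousAt (fun c : ℝ => U / c) 1 := continuousAt_const.div continuousAt_id one_ne_zero
    simpa using this.tendsto.mono_left hl
  have key : ∀ c : ℝ, 0 < c → 0 ≤ (c - 1) * (K - U / c) := by
    intro c hc
    have e : (c - 1) * (K - U / c) = c * K + U / c - (K + U) := by field_simp; ring
    rw [e]; linarith [h c hc]
  refine le_antisymm ?_ ?_
  · refine ge_of_tendsto (hlim (𝓝[<] 1) nhdsWithin_le_nhds) ?_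
    filter_upwards [Ioo_mem_nhdsLT (show (0 : ℝ) < 1 by norm_num)] with c hc
    by_contra hcon
    nlinarith [key c hc.1, mul_pos (sub_pos.2 hc.2) (sub_pos.2 (not_le.1 hcon))]
  · refine le_of_tendsto (hlim (𝓝[>] 1) nhdsWithin_le_nhds) ?_
    filter_upwards [self_mem_nhdsWithin] with c hc
    have hc1 : 1 < c := hc
    by_contra hcon
    nlinarith [key c (by linarith), mul_pos (sub_pos.2 hc1) (sub_pos.2 (not_le.1 hcon))]

/-- The rescaled path x(c t) has the same image, hence the same minimal norm, so it is admissible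
even across the contact set. -/
lemma Setting.kinetic_eq_potential (h : Setting ξm ξp Vmin V α p κ) (hε : 0 < ε)
    (hx : IsConstrainedMorseMin ξm ξp V ε x) {a b : ℝ} (hab : a < b) :
    ∫ t in a..b, ‖deriv x t‖ ^ 2 / 2 = ∫ t in a..b, V (x t) := by
  have hne := hx.ne_zero hε
  obtain ⟨h1, h2⟩ := intervalIntegrable_lagrangian h.continuousOn hab.le (hx.isH1 a b)
    fun t _ => hne t
  refine eq_of_forall_le_mul_add fun c hc => ?_
  set y : ℝ → E d := fun t => x (c * t) with hy
  have hab' : a / c < b / c := by gcongr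
  have hyH : IsH1 (a / c) (b / c) y := by
    have := (hx.isH1 a b).comp_affine hc.ne' 0 1 (a' := a / c) (b' := b / c) (fun t ht => by
      have h1 := (div_le_iff₀ hc).1 ht.1
      have h2 := (le_div_iff₀ hc).1 ht.2
      constructor <;> simp only [add_zero] <;> linarith)
    simpa using this
  have himg : (fun t => ‖y t‖) '' Icc (a / c) (b / c) = (fun t => ‖x t‖) '' Icc a b := by
    have e : (fun t => ‖y t‖) = (fun t => ‖x t‖) ∘ (fun t => c * t) := rfl
    rw [e, image_comp]
    congr 1
    rw [image_mul_left_Icc' hc, mul_div_cancel₀ _ hc.ne', mul_div_cancel₀ _ hc.ne']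
  obtain ⟨ρ, hρ⟩ : ∃ ρ, IsLeast ((fun t => ‖x t‖) '' Icc a b) ρ :=
    (isCompact_Icc.image hx.continuous.norm).exists_isLeast ((nonempty_Icc.2 hab.le).image _)
  have hmin := hx.minimal a b (a / c) (b / c) y hab hab' hyH (by simp [hy, mul_div_cancel₀ _ hc.ne'])
    (by simp [hy, mul_div_cancel₀ _ hc.ne']) ⟨ρ, by rwa [himg], hρ⟩
  have hyne : ∀ t ∈ Icc (a / c) (b / c), y t ≠ 0 := fun t _ => hne _
  rw [action_eq_ofReal h.continuousOn h.nonneg hab.le (hx.isH1 a b) (fun t _ => hne t),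
    action_eq_ofReal h.continuousOn h.nonneg hab'.le hyH hyne, ENNReal.ofReal_le_ofReal_iff
    (intervalIntegral.integral_nonneg hab'.le fun t ht => by
      have := h.nonneg _ (hyne t ht)
      positivity), intervalIntegral.integral_add h1 h2] at hmin
  have hd : ∀ t, ‖deriv y t‖ ^ 2 / 2 + V (y t) =
      (fun s => c ^ 2 * (‖deriv x s‖ ^ 2 / 2) + V (x s)) (c * t) := by
    intro t
    simp only [hy]
    rw [deriv_comp_mul_left c x t, norm_smul, Real.norm_eq_abs, mul_pow, sq_abs]
    ring
  rw [intervalIntegral.integral_congr (fun t _ => hd t),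
    intervalIntegral.integral_comp_mul_left (fun s => c ^ 2 * (‖deriv x s‖ ^ 2 / 2) + V (x s))
      hc.ne', mul_div_cancel₀ _ hc.ne',
    mul_div_cancel₀ _ hc.ne', intervalIntegral.integral_add (h1.const_mul _) h2,
    intervalIntegral.integral_const_mul, smul_eq_mul] at hmin
  refine hmin.trans (le_of_eq ?_)
  field_simp

lemma Setting.energy_ae (h : Setting ξm ξp Vmin V α p κ) (hε : 0 < ε)
    (hx : IsConstrainedMorseMin ξm ξp V ε x) : ∀ᵐ t, ‖deriv x t‖ ^ 2 = 2 * V (x t) := by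
  have hne := hx.ne_zero hε
  have hi : ∀ a b, a < b → IntervalIntegrable (fun t => ‖deriv x t‖ ^ 2 / 2) volume a b ∧
      IntervalIntegrable (fun t => V (x t)) volume a b := fun a b hab =>
    intervalIntegrable_lagrangian h.continuousOn hab.le (hx.isH1 a b) fun t _ => hne t
  set g : ℝ → ℝ := fun t => ‖deriv x t‖ ^ 2 / 2 - V (x t) with hg
  have hzero : ∀ a b, a < b → ∫ t in a..b, g t = 0 := by
    intro a b hab
    rw [intervalIntegral.integral_sub (hi a b hab).1 (hi a b hab).2,
      h.kinetic_eq_potential hε hx hab, sub_self]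
  have hloc : LocallyIntegrable g volume := by
    intro t
    refine ⟨Icc (t - 1) (t + 1), Icc_mem_nhds (by linarith) (by linarith), ?_⟩
    have h1 := hi (t - 1) (t + 1) (by linarith)
    exact (intervalIntegrable_iff_integrableOn_Icc_of_le (by linarith)).1 (h1.1.sub h1.2)
  filter_upwards [LocallyIntegrable.ae_hasDerivAt_integral hloc] with t ht
  have h1 := ht (t - 1)
  have h2 : (fun s => ∫ τ in (t - 1)..s, g τ) =ᶠ[𝓝 t] fun _ => 0 := by
    filter_upwards [lt_mem_nhds (show t - 1 < t by linarith)] with s hs using hzero _ _ hs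
  have h3 := (h2.hasDerivAt_iff.1 h1).unique (hasDerivAt_const t (0 : ℝ))
  simp only [hg] at h3
  linarith

/-! ### The Euler-Lagrange equation off the contact set -/

/-- Du Bois-Reymond: with W a primitive of ∇V(x), the test path is y with y' = u = c - (x' - W),
where c is the mean of x' - W, so that y vanishes at both ends. The first variation in this
direction is -∫|u|², so the one-sided inequality already gives u = 0. -/
lemma Setting.euler_lagrange_Ioo (h : Setting ξm ξp Vmin V α p κ) (hε : 0 < ε)
    (hx : IsConstrainedMorseMin ξm ξp V ε x) {a b : ℝ} (hab : a < b)
    (hfree : ∀ t ∈ Icc a b, ε < ‖x t‖) :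
    ∀ t ∈ Ioo a b, HasDerivAt x (deriv x t) t ∧
      HasDerivAt (deriv x) (gradient V (x t)) t := by
  have hne := hx.ne_zero hε
  have hxc := hx.continuous
  have ha : a ∈ Icc a b := left_mem_Icc.2 hab.le
  have hb : b ∈ Icc a b := right_mem_Icc.2 hab.le
  have hopen : IsOpen ({0}ᶜ : Set (E d)) := isOpen_compl_singleton
  have hV' : ContinuousOn (fderiv ℝ V) {0}ᶜ :=
    h.pot.contDiffOn.continuousOn_fderiv_of_isOpen hopen (by norm_num)
  set G : ℝ → E d := fun t => gradient V (x t) with hG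
  have hGc : Continuous G :=
    (InnerProductSpace.toDual ℝ (E d)).symm.continuous.comp (hV'.comp_continuous hxc hne)
  have hGin : ∀ t y, inner ℝ (G t) y = fderiv ℝ V (x t) y := fun t y => by
    simp [hG, gradient]
  set W : ℝ → E d := fun t => ∫ τ in a..t, G τ with hW
  have hWd : ∀ t, HasDerivAt W (G t) t := fun t =>
    intervalIntegral.integral_hasDerivAt_right (hGc.intervalIntegrable _ _)
      (hGc.stronglyMeasurableAtFilter _ _) hGc.continuousAt
  obtain ⟨CG, hCG⟩ := isCompact_Icc.exists_bound_of_continuousOn (s := Icc a b) hGc.continuousOn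
  have hWH : IsH1 a b W := isH1_of_hasDerivAt (fun t _ => hWd t) hCG
  have hxH := hx.isH1 a b
  have hu0 : MemLp (fun t => deriv x t - W t) 2 (volume.restrict (Icc a b)) :=
    hxH.memLp_deriv.sub hWH.memLp
  set c : E d := (b - a)⁻¹ • ∫ t in a..b, (deriv x t - W t) with hc
  have hcm : MemLp (fun _ : ℝ => c) 2 (volume.restrict (Icc a b)) := memLp_const c
  set u : ℝ → E d := fun t => c - (deriv x t - W t) with hu
  have hum : MemLp u 2 (volume.restrict (Icc a b)) := hcm.sub hu0
  set y : ℝ → E d := fun t => ∫ τ in a..t, u τ with hy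
  have hya : y a = 0 := by simp [hy]
  have hyb : y b = 0 := by
    simp only [hy, hu]
    rw [intervalIntegral.integral_sub intervalIntegrable_const
      (memLp_two_intervalIntegrable hu0 ha hb), intervalIntegral.integral_const, hc, smul_smul,
      mul_inv_cancel₀ (sub_pos.2 hab).ne', one_smul, sub_self]
  have hyeq : ∀ t ∈ Icc a b, y t = y a + ∫ τ in a..t, u τ := fun t _ => by rw [hya, zero_add]
  have hyH : IsH1 a b y := ⟨u, hum, hyeq⟩
  have hyd : deriv y =ᵐ[volume.restrict (Icc a b)] u := deriv_ae_eq_of_eq_integral hum hyeq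
  obtain ⟨tc, htc⟩ := hx.exists_contact
  have htc' : tc ∉ Ioo a b := fun hmem =>
    absurd htc (hfree tc (Ioo_subset_Icc_self hmem)).ne'
  have hmin : ∀ᶠ s in 𝓝[>] (0 : ℝ), action V a b x ≤ action V a b (fun t => x t + s • y t) := by
    obtain ⟨ρ, ⟨t₀, ht₀, hρ0⟩, hρ⟩ : ∃ ρ, IsLeast ((fun t => ‖x t‖) '' Icc a b) ρ :=
      (isCompact_Icc.image hxc.norm).exists_isLeast ((nonempty_Icc.2 hab.le).image _)
    have hρε : ε < ρ := by rw [← hρ0]; exact hfree t₀ ht₀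
    obtain ⟨Y, hY⟩ := isCompact_Icc.exists_bound_of_continuousOn hyH.continuousOn
    have hY0 : 0 ≤ Y := (norm_nonneg _).trans (hY a ha)
    have hr0 : 0 < (ρ - ε) / (Y + 1) := div_pos (by linarith) (by linarith)
    filter_upwards [Ioo_mem_nhdsGT hr0] with s hs
    have hreg : ∀ t ∈ Icc a b, ε ≤ ‖x t + s • y t‖ := by
      intro t ht
      have h1 : ‖x t‖ ≤ ‖x t + s • y t‖ + ‖s • y t‖ := by
        have := norm_sub_le (x t + s • y t) (s • y t)
        rwa [add_sub_cancel_right] at this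
      have h2 : ‖s • y t‖ ≤ ρ - ε := by
        rw [norm_smul, Real.norm_eq_abs, abs_of_pos hs.1]
        have h3 := (lt_div_iff₀ (by linarith)).1 hs.2
        have h4 := mul_le_mul_of_nonneg_left (hY t ht) hs.1.le
        nlinarith [hs.1]
      have h3 : ρ ≤ ‖x t‖ := hρ (mem_image_of_mem _ ht)
      linarith
    have hfin := ParabolicMin.action_ne_top h.continuousOn h.nonneg hab.le (hxH.add_smul hyH s)
      (fun t ht => norm_pos_iff.1 (hε.trans_le (hreg t ht)))
    rw [← ENNReal.ofReal_toReal hfin]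
    refine h.action_le_of_reach hε hx hab htc' htc ENNReal.toReal_nonneg
      ⟨a, b, _, hab, hxH.add_smul hyH s, ?_, ?_, hreg, ?_⟩
    · simp [hya]
    · simp [hyb]
    · rw [ENNReal.ofReal_toReal hfin]
  have hvar := first_variation h.pot.contDiffOn h.nonneg hab hxH hyH hε (fun t _ => hx.le_norm t) hmin
  have hibp := hWH.integral_inner hab.le hyH
  rw [hya, hyb, inner_zero_right, inner_zero_right, sub_zero] at hibp
  have hi1 : IntervalIntegrable (fun t => (inner ℝ (u t) (u t) : ℝ)) volume a b :=
    memLp_inner_integrable hab.le hum hum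
  have hi2 : IntervalIntegrable (fun t => (inner ℝ c (u t) : ℝ)) volume a b :=
    memLp_inner_integrable hab.le hcm hum
  have hi3 : IntervalIntegrable (fun t => (inner ℝ (W t) (deriv y t) : ℝ) +
      inner ℝ (deriv W t) (y t)) volume a b :=
    (memLp_inner_integrable hab.le hWH.memLp hyH.memLp_deriv).add
      (memLp_inner_integrable hab.le hWH.memLp_deriv hyH.memLp)
  have hcint : ∫ t in a..b, (inner ℝ c (u t) : ℝ) = 0 := by
    have := ((innerSL ℝ c).intervalIntegral_comp_comm
      (memLp_two_intervalIntegrable hum ha hb)).trans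
      (show innerSL ℝ c (∫ t in a..b, u t) = 0 by
        have e : ∫ t in a..b, u t = 0 := hyb
        rw [e, map_zero])
    simpa using this
  have hsum : ∫ t in a..b, (inner ℝ (deriv x t) (deriv y t) + fderiv ℝ V (x t) (y t)) =
      - ∫ t in a..b, (inner ℝ (u t) (u t) : ℝ) := by
    have e : ∫ t in a..b, (inner ℝ (deriv x t) (deriv y t) + fderiv ℝ V (x t) (y t)) =
        ∫ t in a..b, (((inner ℝ (W t) (deriv y t) : ℝ) + inner ℝ (deriv W t) (y t)) +
          (inner ℝ c (u t) - inner ℝ (u t) (u t))) := by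
      refine integral_congr_ae_Icc ?_ ha hb
      filter_upwards [hyd] with t ht
      rw [(hWd t).deriv, hGin, ht, ← inner_sub_left]
      have : c - u t = deriv x t - W t := by simp [hu]
      rw [this, inner_sub_left]; ring
    rw [e, intervalIntegral.integral_add hi3 (hi2.sub hi1), hibp,
      intervalIntegral.integral_sub hi2 hi1, hcint]
    ring
  rw [hsum] at hvar
  have hu2 : ∫ t in a..b, (inner ℝ (u t) (u t) : ℝ) = 0 :=
    le_antisymm (by linarith) (intervalIntegral.integral_nonneg hab.le
      fun t _ => real_inner_self_nonneg)
  have hu0' : ∀ᵐ t ∂(volume.restrict (Icc a b)), u t = 0 := by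
    rw [intervalIntegral.integral_of_le hab.le, ← integral_Icc_eq_integral_Ioc,
      integral_eq_zero_iff_of_nonneg (fun t => real_inner_self_nonneg)
      ((intervalIntegrable_iff_integrableOn_Icc_of_le hab.le).1 hi1)] at hu2
    filter_upwards [hu2] with t ht
    simpa using ht
  have hderiv : deriv x =ᵐ[volume.restrict (Icc a b)] fun t => c + W t := by
    filter_upwards [hu0'] with t ht
    have : c - (deriv x t - W t) = 0 := ht
    rw [sub_eq_zero] at this
    rw [this]; abel
  have hcW : Continuous fun t => c + W t :=
    continuous_const.add (continuous_iff_continuousAt.2 fun t => (hWd t).continuousAt)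
  have hd1 : ∀ t ∈ Ioo a b, HasDerivAt x (c + W t) t := by
    intro t ht
    have h1 : HasDerivAt (fun s => x a + ∫ τ in a..s, (c + W τ)) (c + W t) t :=
      (intervalIntegral.integral_hasDerivAt_right (hcW.intervalIntegrable _ _)
        (hcW.stronglyMeasurableAtFilter _ _) hcW.continuousAt).const_add (x a)
    refine h1.congr_of_eventuallyEq ?_
    filter_upwards [Icc_mem_nhds ht.1 ht.2] with s hs
    have := hxH.sub_eq ha hs
    rw [integral_congr_ae_Icc hderiv ha hs] at this
    rw [← this]; abel
  intro t ht
  have h1 := hd1 t ht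
  refine ⟨by rwa [h1.deriv], ?_⟩
  refine ((hWd t).const_add c).congr_of_eventuallyEq ?_
  filter_upwards [Ioo_mem_nhds ht.1 ht.2] with s hs using (hd1 s hs).deriv

lemma Setting.euler_lagrange (h : Setting ξm ξp Vmin V α p κ) (hε : 0 < ε)
    (hx : IsConstrainedMorseMin ξm ξp V ε x) {t : ℝ} (ht : ε < ‖x t‖) :
    HasDerivAt x (deriv x t) t ∧ HasDerivAt (deriv x) (gradient V (x t)) t := by
  have h1 : {s | ε < ‖x s‖} ∈ 𝓝 t :=
    hx.continuous.norm.continuousAt.eventually (lt_mem_nhds ht)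
  obtain ⟨r, hr, hball⟩ := Metric.nhds_basis_closedBall.mem_iff.1 h1
  rw [Real.closedBall_eq_Icc] at hball
  exact h.euler_lagrange_Ioo hε hx (a := t - r) (b := t + r) (by linarith) hball t
    ⟨by linarith, by linarith⟩

lemma Setting.energy (h : Setting ξm ξp Vmin V α p κ) (hε : 0 < ε)
    (hx : IsConstrainedMorseMin ξm ξp V ε x) {t : ℝ} (ht : ε < ‖x t‖) :
    ‖deriv x t‖ ^ 2 = 2 * V (x t) := by
  have hopen : IsOpen {s | ε < ‖x s‖} := isOpen_lt continuous_const hx.continuous.norm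
  have := Measure.eqOn_open_of_ae_eq (μ := volume) (f := fun t => ‖deriv x t‖ ^ 2)
    (g := fun t => 2 * V (x t)) (ae_restrict_of_ae (h.energy_ae hε hx)) hopen
    (fun s hs => ((h.euler_lagrange hε hx hs).2.continuousAt.norm.pow 2).continuousWithinAt)
    (continuous_const.mul (h.continuousOn.comp_continuous hx.continuous
      (hx.ne_zero hε))).continuousOn
  exact this ht

lemma Setting.fderiv_self (h : Setting ξm ξp Vmin V α p κ) {y : E d} (hy : y ≠ 0) :
    fderiv ℝ V y y = -α * V y := by
  have h1 : HasFDerivAt V (fderiv ℝ V y) ((1 : ℝ) • y) := by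
    rw [one_smul]
    exact ((h.pot.contDiffOn.contDiffAt (isOpen_compl_singleton.mem_nhds hy)).differentiableAt
      (by norm_num)).hasFDerivAt
  have h2 : HasDerivAt (fun l : ℝ => V (l • y)) (fderiv ℝ V y y) 1 := by
    have h3 : HasDerivAt (fun l : ℝ => l • y) y 1 := by
      simpa using (hasDerivAt_id (1 : ℝ)).smul_const y
    exact h1.comp_hasDerivAt 1 h3
  have h4 : HasDerivAt (fun l : ℝ => l ^ (-α) * V y) (-α * V y) 1 := by
    have := (Real.hasDerivAt_rpow_const (x := 1) (p := -α) (Or.inl one_ne_zero)).mul_const (V y)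
    simpa using this
  refine h2.unique (h4.congr_of_eventuallyEq ?_)
  filter_upwards [lt_mem_nhds (show (0 : ℝ) < 1 by norm_num)] with l hl using h.smul hl hy

/-- Lagrange-Jacobi identity: |x'|² = 2V at zero energy and x·∇V = -αV by Euler's identity. -/
lemma Setting.hasDerivAt_inner (h : Setting ξm ξp Vmin V α p κ) (hε : 0 < ε)
    (hx : IsConstrainedMorseMin ξm ξp V ε x) {t : ℝ} (ht : ε < ‖x t‖) :
    HasDerivAt (fun t => (inner ℝ (x t) (deriv x t) : ℝ)) (2 * κ * V (x t)) t := by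
  obtain ⟨h1, h2⟩ := h.euler_lagrange hε hx ht
  refine (h1.inner ℝ h2).congr_deriv ?_
  have h3 : (inner ℝ (x t) (gradient V (x t)) : ℝ) = -α * V (x t) := by
    rw [← h.fderiv_self (hx.ne_zero hε t), real_inner_comm]
    simp [gradient]
  rw [h3, real_inner_self_eq_norm_sq, h.energy hε hx ht, h.κ_eq]
  ring

/-- Between two contact times, a maximum of |x| above ε would have x·x' = 0 with x·x' increasing, so
|x|² would increase just after it. -/
lemma Setting.contact_ordConnected (h : Setting ξm ξp Vmin V α p κ) (hε : 0 < ε)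
    (hx : IsConstrainedMorseMin ξm ξp V ε x) {a b : ℝ} (ha : ‖x a‖ = ε) (hb : ‖x b‖ = ε) {t : ℝ}
    (ht : t ∈ Icc a b) : ‖x t‖ = ε := by
  by_contra hcon
  have hab : a ≤ b := ht.1.trans ht.2
  obtain ⟨s, hs, hmax⟩ := isCompact_Icc.exists_isMaxOn (nonempty_Icc.2 hab)
    (hx.continuous.norm.continuousOn (s := Icc a b))
  have hlt : ε < ‖x s‖ :=
    ((hx.le_norm t).lt_of_ne (Ne.symm hcon)).trans_le (hmax ht)
  have hsab : s ∈ Ioo a b := by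
    refine ⟨hs.1.lt_of_ne ?_, hs.2.lt_of_ne ?_⟩
    · rintro rfl; linarith
    · rintro rfl; linarith
  have hnh : {u | ε < ‖x u‖} ∩ Ioo a b ∈ 𝓝 s :=
    inter_mem (hx.continuous.norm.continuousAt.eventually (lt_mem_nhds hlt))
      (Ioo_mem_nhds hsab.1 hsab.2)
  have hsq : ∀ u, ε < ‖x u‖ → HasDerivAt (fun u => ‖x u‖ ^ 2) (2 * inner ℝ (x u) (deriv x u)) u :=
    fun u hu => (h.euler_lagrange hε hx hu).1.norm_sq
  have hlmax : IsLocalMax (fun u => ‖x u‖ ^ 2) s := by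
    filter_upwards [hnh] with u hu
    have := hmax (Ioo_subset_Icc_self hu.2)
    simp only [mem_ofPred_eq] at this
    gcongr
  have h0 : (inner ℝ (x s) (deriv x s) : ℝ) = 0 := by
    have := hlmax.hasDerivAt_eq_zero (hsq s hlt)
    linarith
  have hV := h.pos (hx.ne_zero hε s)
  have hκ := h.κ_pos
  have hpos : ∀ᶠ u in 𝓝[>] s, 0 < (inner ℝ (x u) (deriv x u) : ℝ) := by
    have h2 := (hasDerivWithinAt_iff_tendsto_slope' (lt_irrefl s)).1
      ((h.hasDerivAt_inner hε hx hlt).hasDerivWithinAt (s := Ioi s))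
    filter_upwards [h2.eventually (lt_mem_nhds (show 0 < 2 * κ * V (x s) by positivity)),
      self_mem_nhdsWithin] with u hu hus
    have hus' : 0 < u - s := sub_pos.2 hus
    rw [slope_def_field, h0, sub_zero] at hu
    exact (div_pos_iff_of_pos_right hus').1 hu
  obtain ⟨w, hw, hwsub⟩ := (mem_nhdsGT_iff_exists_Ioc_subset).1
    (inter_mem hpos (mem_nhdsWithin_of_mem_nhds hnh))
  have hsw : s < w := hw
  have hmono : StrictMonoOn (fun u => ‖x u‖ ^ 2) (Icc s w) := by
    refine strictMonoOn_of_deriv_pos (convex_Icc s w) (hx.continuous.norm.pow 2).continuousOn ?_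
    intro u hu
    rw [interior_Icc] at hu
    obtain ⟨h1, h2⟩ := hwsub (Ioo_subset_Ioc_self hu)
    rw [(hsq u h2.1).deriv]
    have : 0 < (inner ℝ (x u) (deriv x u) : ℝ) := h1
    linarith
  have h5 := hmono (left_mem_Icc.2 hsw.le) (right_mem_Icc.2 hsw.le) hsw
  have h6 := hmax (Ioo_subset_Icc_self (hwsub (right_mem_Ioc.2 hsw)).2.2)
  simp only [mem_ofPred_eq] at h5 h6
  have : ‖x w‖ ^ 2 ≤ ‖x s‖ ^ 2 := by gcongr
  linarith

end

section
variable {ξm ξp : E d} {Vmin : ℝ} {V : E d → ℝ} {α p κ ε : ℝ} {x : ℝ → E d}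

/-! ### The contact set -/

lemma Setting.exists_contact_interval (h : Setting ξm ξp Vmin V α p κ) (hε : 0 < ε)
    (hx : IsConstrainedMorseMin ξm ξp V ε x) :
    ∃ t₁ t₂, t₁ ≤ t₂ ∧ {t | ‖x t‖ = ε} = Icc t₁ t₂ := by
  set S : Set ℝ := {t | ‖x t‖ = ε} with hS
  have hne : S.Nonempty := hx.exists_contact
  have hord : OrdConnected S := ⟨fun a ha b hb t ht => h.contact_ordConnected hε hx ha hb ht⟩
  have hcl : IsClosed S := isClosed_eq hx.continuous.norm continuous_const
  obtain ⟨T₁, hT₁⟩ := eventually_atTop.1 (hx.norm_atTop.eventually_gt_atTop ε)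
  obtain ⟨T₂, hT₂⟩ := eventually_atBot.1 (hx.norm_atBot.eventually_gt_atTop ε)
  have hsub : S ⊆ Icc T₂ T₁ := by
    intro t ht
    refine ⟨le_of_not_ge fun hcon => ?_, le_of_not_ge fun hcon => ?_⟩
    · exact (hT₂ t hcon).ne' ht
    · exact (hT₁ t hcon).ne' ht
  have hcomp : IsCompact S := isCompact_Icc.of_isClosed_subset hcl hsub
  have hconn : IsConnected S := ⟨hne, hord.isPreconnected⟩
  have := eq_Icc_of_connected_compact hconn hcomp
  refine ⟨sInf S, sSup S, ?_, this⟩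
  rw [this] at hne
  exact nonempty_Icc.1 hne

/-! ### The outgoing half of a constrained minimizer -/

variable {t₂ : ℝ}

/-- On the free side x' is a primitive of ∇V(x), which is continuous through t₂. -/
lemma Setting.exists_tendsto_deriv (h : Setting ξm ξp Vmin V α p κ) (hε : 0 < ε)
    (hx : IsConstrainedMorseMin ξm ξp V ε x) (hfree : ∀ t > t₂, ε < ‖x t‖) :
    ∃ vp, Tendsto (deriv x) (𝓝[>] t₂) (𝓝 vp) := by
  have hV' : ContinuousOn (fderiv ℝ V) {0}ᶜ :=
    h.pot.contDiffOn.continuousOn_fderiv_of_isOpen isOpen_compl_singleton (by norm_num)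
  have hGc : Continuous fun t => gradient V (x t) :=
    (InnerProductSpace.toDual ℝ (E d)).symm.continuous.comp
      (hV'.comp_continuous hx.continuous (hx.ne_zero hε))
  set W : ℝ → E d := fun t => deriv x (t₂ + 1) + ∫ τ in (t₂ + 1)..t, gradient V (x τ) with hW
  have hWc : Continuous W := continuous_const.add
    (intervalIntegral.continuous_primitive (fun a b => hGc.intervalIntegrable a b) _)
  refine ⟨W t₂, (hWc.tendsto t₂).mono_left nhdsWithin_le_nhds |>.congr' ?_⟩
  filter_upwards [self_mem_nhdsWithin] with t ht
  have ht' : t₂ < t := ht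
  simp only [hW]
  rw [intervalIntegral.integral_eq_sub_of_hasDerivAt (fun s hs => (h.euler_lagrange hε hx
    (hfree s (lt_of_lt_of_le (lt_min (by linarith) ht') hs.1))).2)
    (hGc.intervalIntegrable _ _)]
  abel

lemma Setting.hasDerivAt_norm_sq (h : Setting ξm ξp Vmin V α p κ) (hε : 0 < ε)
    (hx : IsConstrainedMorseMin ξm ξp V ε x) {t : ℝ} (ht : ε < ‖x t‖) :
    HasDerivAt (fun t => ‖x t‖ ^ 2) (2 * inner ℝ (x t) (deriv x t)) t :=
  (h.euler_lagrange hε hx ht).1.norm_sq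

lemma Setting.hasDerivAt_norm (h : Setting ξm ξp Vmin V α p κ) (hε : 0 < ε)
    (hx : IsConstrainedMorseMin ξm ξp V ε x) {t : ℝ} (ht : ε < ‖x t‖) :
    HasDerivAt (fun t => ‖x t‖) ((inner ℝ (x t) (deriv x t) : ℝ) / ‖x t‖) t := by
  have h1 := (h.hasDerivAt_norm_sq hε hx ht).sqrt (by
    have : 0 < ‖x t‖ := hε.trans ht
    positivity)
  simp only [Real.sqrt_sq (norm_nonneg _)] at h1
  refine h1.congr_deriv ?_
  rw [mul_div_mul_left _ _ two_ne_zero]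

lemma Setting.tendsto_inner (hx : IsConstrainedMorseMin ξm ξp V ε x) {vp : E d}
    (hvp : Tendsto (deriv x) (𝓝[>] t₂) (𝓝 vp)) :
    Tendsto (fun t => (inner ℝ (x t) (deriv x t) : ℝ)) (𝓝[>] t₂) (𝓝 (inner ℝ vp (x t₂))) := by
  rw [real_inner_comm]
  exact ((hx.continuous.tendsto t₂).mono_left nhdsWithin_le_nhds).inner hvp

lemma Setting.inner_nonneg_of_tendsto (h : Setting ξm ξp Vmin V α p κ) (hε : 0 < ε)
    (hx : IsConstrainedMorseMin ξm ξp V ε x) (hfree : ∀ t > t₂, ε < ‖x t‖) (ht₂ : ‖x t₂‖ = ε)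
    {vp : E d} (hvp : Tendsto (deriv x) (𝓝[>] t₂) (𝓝 vp)) : 0 ≤ (inner ℝ vp (x t₂) : ℝ) := by
  by_contra hcon
  have h1 := (Setting.tendsto_inner hx hvp).eventually (gt_mem_nhds (not_le.1 hcon))
  obtain ⟨b, hb, hb'⟩ := (mem_nhdsGT_iff_exists_Ioc_subset).1 h1
  have hb0 : t₂ < b := hb
  have hanti : AntitoneOn (fun t => ‖x t‖ ^ 2) (Icc t₂ b) := by
    refine antitoneOn_of_deriv_nonpos (convex_Icc _ _)
      (hx.continuous.norm.pow 2).continuousOn ?_ ?_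
    · intro t ht
      rw [interior_Icc] at ht
      exact (h.hasDerivAt_norm_sq hε hx (hfree t ht.1)).differentiableAt.differentiableWithinAt
    · intro t ht
      rw [interior_Icc] at ht
      rw [(h.hasDerivAt_norm_sq hε hx (hfree t ht.1)).deriv]
      have : (inner ℝ (x t) (deriv x t) : ℝ) < 0 := hb' ⟨ht.1, ht.2.le⟩
      linarith
  have h2 := hanti (left_mem_Icc.2 hb0.le) (right_mem_Icc.2 hb0.le) hb0.le
  simp only [ht₂] at h2
  have h3 := hfree b hb0
  nlinarith

/-- At zero energy the Lagrangian is 2V = (x·x')'/κ. -/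
lemma Setting.action_eq_inner_sub (h : Setting ξm ξp Vmin V α p κ) (hε : 0 < ε)
    (hx : IsConstrainedMorseMin ξm ξp V ε x) (hfree : ∀ t > t₂, ε < ‖x t‖)
    {vp : E d} (hvp : Tendsto (deriv x) (𝓝[>] t₂) (𝓝 vp)) {b : ℝ} (hb : t₂ < b) :
    (action V t₂ b x).toReal = (inner ℝ (x b) (deriv x b) - inner ℝ vp (x t₂)) / κ := by
  have hne := hx.ne_zero hε
  have hVc : Continuous fun t => V (x t) := h.continuousOn.comp_continuous hx.continuous hne
  have hκ := h.κ_pos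
  rw [action_eq_ofReal h.continuousOn h.nonneg hb.le (hx.isH1 _ _) (fun t _ => hne t),
    ENNReal.toReal_ofReal (intervalIntegral.integral_nonneg hb.le fun t _ => by
      have := h.nonneg _ (hne t)
      positivity)]
  have e : ∫ t in t₂..b, (‖deriv x t‖ ^ 2 / 2 + V (x t)) =
      ∫ t in t₂..b, κ⁻¹ * (2 * κ * V (x t)) := by
    refine integral_congr_ae_Icc (a := t₂) (b := b) ?_ (left_mem_Icc.2 hb.le) (right_mem_Icc.2 hb.le)
    filter_upwards [ae_restrict_of_ae (h.energy_ae hε hx)] with t ht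
    rw [ht]; field_simp; ring
  rw [e, intervalIntegral.integral_const_mul,
    intervalIntegral.integral_eq_sub_of_hasDerivAt_of_tendsto hb
      (fun t ht => h.hasDerivAt_inner hε hx (hfree t ht.1))
      ((continuous_const.mul hVc).intervalIntegrable _ _) (Setting.tendsto_inner hx hvp)
      ((h.hasDerivAt_inner hε hx (hfree b hb)).continuousAt.tendsto.mono_left nhdsWithin_le_nhds)]
  field_simp

/-! ### Radial speed and asymptotics of the outgoing branch. -/

lemma Setting.val_eq_rpow_mul (h : Setting ξm ξp Vmin V α p κ) {y : E d} (hy : y ≠ 0) :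
    V y = ‖y‖ ^ (-α) * V (‖y‖⁻¹ • y) := by
  have h0 : 0 < ‖y‖ := norm_pos_iff.2 hy
  rw [h.pot.homogeneous y hy, Real.rpow_neg h0.le]
  field_simp

/-- `‖x‖^(-κ) ⟨x, x'⟩`, which is `‖x‖^(α/2)` times the radial velocity. -/
def radialSpeed (κ : ℝ) (x : ℝ → E d) (t : ℝ) : ℝ := ‖x t‖ ^ (-κ) * inner ℝ (x t) (deriv x t)

lemma Setting.inner_eq_radialSpeed (hε : 0 < ε) {t : ℝ} (ht : ε < ‖x t‖) :
    (inner ℝ (x t) (deriv x t) : ℝ) = ‖x t‖ ^ κ * radialSpeed κ x t := by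
  have h0 : 0 < ‖x t‖ := hε.trans ht
  rw [radialSpeed, ← mul_assoc, ← Real.rpow_add h0]
  simp

lemma Setting.hasDerivAt_radialSpeed (h : Setting ξm ξp Vmin V α p κ) (hε : 0 < ε)
    (hx : IsConstrainedMorseMin ξm ξp V ε x) {t : ℝ} (ht : ε < ‖x t‖) :
    HasDerivAt (radialSpeed κ x) (κ * ‖x t‖ ^ (-κ) * (‖deriv x t‖ ^ 2 -
      ((inner ℝ (x t) (deriv x t) : ℝ) / ‖x t‖) ^ 2)) t := by
  have h0 : 0 < ‖x t‖ := hε.trans ht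
  have h1 := ((h.hasDerivAt_norm hε hx ht).rpow_const (p := -κ) (Or.inl h0.ne')).mul
    (h.hasDerivAt_inner hε hx ht)
  refine h1.congr_deriv ?_
  rw [h.energy hε hx ht, Real.rpow_sub_one h0.ne']
  field_simp
  ring

lemma Setting.radialSpeed_sq_le (h : Setting ξm ξp Vmin V α p κ) (hε : 0 < ε)
    (hx : IsConstrainedMorseMin ξm ξp V ε x) {t : ℝ} (ht : ε < ‖x t‖) :
    radialSpeed κ x t ^ 2 ≤ 2 * V (‖x t‖⁻¹ • x t) := by
  have h0 : 0 < ‖x t‖ := hε.trans ht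
  have h1 := h.energy hε hx ht
  rw [h.val_eq_rpow_mul (hx.ne_zero hε t)] at h1
  have h2 : (inner ℝ (x t) (deriv x t) : ℝ) ^ 2 ≤ (‖x t‖ * ‖deriv x t‖) ^ 2 :=
    sq_le_sq' (by linarith [neg_abs_le (inner ℝ (x t) (deriv x t) : ℝ),
      abs_real_inner_le_norm (x t) (deriv x t)]) (real_inner_le_norm _ _)
  have h3 : ‖x t‖ ^ (-κ) * ‖x t‖ ^ (-κ) * ‖x t‖ ^ 2 * ‖x t‖ ^ (-α) = 1 := by
    rw [← Real.rpow_add h0, ← Real.rpow_natCast, ← Real.rpow_add h0, ← Real.rpow_add h0, h.κ_eq]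
    convert Real.rpow_zero _ using 2
    push_cast; ring
  calc radialSpeed κ x t ^ 2
      = ‖x t‖ ^ (-κ) * ‖x t‖ ^ (-κ) * (inner ℝ (x t) (deriv x t) : ℝ) ^ 2 := by
        rw [radialSpeed]; ring
    _ ≤ ‖x t‖ ^ (-κ) * ‖x t‖ ^ (-κ) * (‖x t‖ * ‖deriv x t‖) ^ 2 := by gcongr
    _ = (‖x t‖ ^ (-κ) * ‖x t‖ ^ (-κ) * ‖x t‖ ^ 2 * ‖x t‖ ^ (-α)) * (2 * V (‖x t‖⁻¹ • x t)) := by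
        rw [mul_pow, h1]; ring
    _ = _ := by rw [h3, one_mul]

/-- The radial speed is nondecreasing, its derivative being a positive multiple of the squared
tangential velocity. Its square is at most 2V at the direction of x, which tends to 2Vmin = p². -/
lemma Setting.radialSpeed_le (h : Setting ξm ξp Vmin V α p κ) (hε : 0 < ε)
    (hx : IsConstrainedMorseMin ξm ξp V ε x) (hfree : ∀ t > t₂, ε < ‖x t‖) {t : ℝ} (ht : t₂ < t) :
    radialSpeed κ x t ≤ p := by
  have hκ := h.κ_pos
  have hmono : MonotoneOn (radialSpeed κ x) (Ioi t₂) := by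
    refine monotoneOn_of_deriv_nonneg (convex_Ioi _) (fun s hs =>
      (h.hasDerivAt_radialSpeed hε hx (hfree s hs)).continuousAt.continuousWithinAt) ?_ ?_
    · intro s hs
      rw [interior_Ioi] at hs
      exact (h.hasDerivAt_radialSpeed hε hx (hfree s hs)).differentiableAt.differentiableWithinAt
    · intro s hs
      rw [interior_Ioi] at hs
      rw [(h.hasDerivAt_radialSpeed hε hx (hfree s hs)).deriv]
      have h0 : 0 < ‖x s‖ := hε.trans (hfree s hs)
      refine mul_nonneg (by positivity) (sub_nonneg.2 ?_)
      rw [div_pow, div_le_iff₀ (by positivity), ← mul_pow]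
      refine sq_le_sq' ?_ ?_
      · linarith [neg_abs_le (inner ℝ (x s) (deriv x s) : ℝ),
          abs_real_inner_le_norm (x s) (deriv x s), mul_comm ‖x s‖ ‖deriv x s‖]
      · rw [mul_comm]; exact real_inner_le_norm _ _
  by_contra hcon
  have hcon := not_le.1 hcon
  have hlim : Tendsto (fun s => 2 * V (‖x s‖⁻¹ • x s)) atTop (𝓝 (2 * V ξp)) :=
    ((h.continuousOn.continuousAt (isOpen_compl_singleton.mem_nhds
      (ne_zero_of_norm_one h.norm_ξp))).tendsto.comp hx.dir_atTop).const_mul 2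
  have h1 : radialSpeed κ x t ^ 2 ≤ 2 * V ξp := by
    refine ge_of_tendsto hlim ?_
    filter_upwards [eventually_ge_atTop t] with s hs
    have hs' : t₂ < s := ht.trans_le hs
    refine le_trans ?_ (h.radialSpeed_sq_le hε hx (hfree s hs'))
    have := hmono ht hs' hs
    nlinarith [h.p_pos]
  rw [h.pot.val_ξp, ← h.p_sq] at h1
  nlinarith [h.p_pos]

/-- The defect vanishes on homothetic motions. Its rate of decrease controls both the defect itself
and |x|^κ times the excess of V at the direction of x. -/
lemma Setting.hasDerivAt_radialDefect (h : Setting ξm ξp Vmin V α p κ) (hε : 0 < ε)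
    (hx : IsConstrainedMorseMin ξm ξp V ε x) {t : ℝ} (ht : ε < ‖x t‖) :
    HasDerivAt (fun t => p * ‖x t‖ ^ κ - inner ℝ (x t) (deriv x t))
      (-(κ * ‖x t‖ ^ (-α - κ) * (p * (p * ‖x t‖ ^ κ - inner ℝ (x t) (deriv x t)) +
        2 * ‖x t‖ ^ κ * (V (‖x t‖⁻¹ • x t) - Vmin)))) t := by
  have h0 : 0 < ‖x t‖ := hε.trans ht
  have h1 := (((h.hasDerivAt_norm hε hx ht).rpow_const (p := κ) (Or.inl h0.ne')).const_mul p).sub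
    (h.hasDerivAt_inner hε hx ht)
  refine h1.congr_deriv ?_
  have e1 : ‖x t‖ ^ (κ - 1) = ‖x t‖ ^ (-α - κ) * ‖x t‖ := by
    rw [← Real.rpow_add_one h0.ne']; congr 1; rw [h.κ_eq]; ring
  have e2 : ‖x t‖ ^ (-α - κ) * ‖x t‖ ^ κ = ‖x t‖ ^ (-α) := by
    rw [← Real.rpow_add h0]; congr 1; ring
  rw [h.val_eq_rpow_mul (hx.ne_zero hε t), e1, ← e2]
  have hp := h.p_sq
  generalize ‖x t‖ ^ (-α - κ) = A
  generalize ‖x t‖ ^ κ = B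
  field_simp
  linear_combination (κ * A * B) * hp

lemma Setting.hasDerivAt_log_norm (h : Setting ξm ξp Vmin V α p κ) (hε : 0 < ε)
    (hx : IsConstrainedMorseMin ξm ξp V ε x) {t : ℝ} (ht : ε < ‖x t‖) :
    HasDerivAt (fun t => Real.log ‖x t‖) (‖x t‖ ^ (-α - κ) * radialSpeed κ x t) t := by
  have h0 : 0 < ‖x t‖ := hε.trans ht
  refine ((h.hasDerivAt_norm hε hx ht).log h0.ne').congr_deriv ?_
  rw [radialSpeed, ← mul_assoc, ← Real.rpow_add h0]
  have : -α - κ + -κ = -2 := by rw [h.κ_eq]; ring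
  rw [this, Real.rpow_neg h0.le]
  norm_num
  field_simp

/-- Along a sequence of times going to infinity, an outgoing branch is asymptotic to the
homothetic motion in the direction `ξp`. -/
lemma Setting.exists_time_near_homothetic (h : Setting ξm ξp Vmin V α p κ) (hε : 0 < ε)
    (hx : IsConstrainedMorseMin ξm ξp V ε x) (hfree : ∀ t > t₂, ε < ‖x t‖) {η : ℝ} (hη : 0 < η)
    (R : ℝ) : ∃ b > t₂, R ≤ ‖x b‖ ∧ (inner ℝ (x b) (deriv x b) : ℝ) ≤ p * ‖x b‖ ^ κ ∧
      p * ‖x b‖ ^ κ - η ≤ (inner ℝ (x b) (deriv x b) : ℝ) ∧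
      ‖x b‖ ^ κ * ‖‖x b‖⁻¹ • x b - ξp‖ ^ 2 ≤ η := by
  have hκ := h.κ_pos
  have hp := h.p_pos
  obtain ⟨δ, hδ, μ, hμ, hnd⟩ := h.pot.nondegenerate
  have hev : ∀ᶠ t in atTop, t₂ < t ∧ R ≤ ‖x t‖ ∧ ‖‖x t‖⁻¹ • x t - ξp‖ < δ := by
    refine (eventually_gt_atTop t₂).and ((hx.norm_atTop.eventually_ge_atTop R).and ?_)
    have := hx.dir_atTop.eventually (Metric.ball_mem_nhds ξp hδ)
    simpa [dist_eq_norm] using this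
  obtain ⟨T, hT⟩ := eventually_atTop.1 hev
  have hD : ∀ t, T ≤ t → 0 ≤ p * ‖x t‖ ^ κ - inner ℝ (x t) (deriv x t) := by
    intro t ht
    have h1 := (hT t ht).1
    rw [Setting.inner_eq_radialSpeed (κ := κ) hε (hfree t h1), mul_comm p]
    have := h.radialSpeed_le hε hx hfree h1
    have h3 : 0 ≤ ‖x t‖ ^ κ := by positivity
    nlinarith
  -- The quantity made smaller than η' is a sum of two nonnegative terms: the first gives the bound
  -- on the defect, the second, through nondegeneracy with constant μ, the bound on the angle.
  set η' := min (p * η) (2 * μ * η) with hη'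
  have hη0 : 0 < η' := lt_min (by positivity) (by positivity)
  obtain ⟨b, hb, hQ⟩ : ∃ b ≥ T, p * (p * ‖x b‖ ^ κ - inner ℝ (x b) (deriv x b)) +
        2 * ‖x b‖ ^ κ * (V (‖x b‖⁻¹ • x b) - Vmin) < η' := by
    -- Otherwise the defect plus (κη'/p) log‖x‖ would be nonincreasing, since the derivative of
    -- log‖x‖ is at most p‖x‖^(-α-κ); but the defect is nonnegative and log‖x‖ → ∞.
    by_contra! hcon
    have hanti : AntitoneOn (fun t => (p * ‖x t‖ ^ κ - inner ℝ (x t) (deriv x t)) +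
        κ * η' / p * Real.log ‖x t‖) (Ici T) := by
      have hdiff : ∀ t, T ≤ t → _ := fun t ht =>
        (h.hasDerivAt_radialDefect hε hx (hfree t (hT t ht).1)).add
          ((h.hasDerivAt_log_norm hε hx (hfree t (hT t ht).1)).const_mul (κ * η' / p))
      refine antitoneOn_of_deriv_nonpos (convex_Ici _)
        (fun t ht => (hdiff t ht).continuousAt.continuousWithinAt)
        (fun t ht => (hdiff t (interior_subset ht)).differentiableAt.differentiableWithinAt) ?_
      intro t ht
      have ht := interior_subset ht
      have e := (hdiff t ht).deriv
      refine (le_of_eq e).trans ?_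
      have h1 := hcon t ht
      have h2 := h.radialSpeed_le hε hx hfree (hT t ht).1
      have h3 : 0 ≤ κ * ‖x t‖ ^ (-α - κ) := by positivity
      have h4 := mul_le_mul_of_nonneg_left h1 h3
      have h5 : κ * η' / p * (‖x t‖ ^ (-α - κ) * radialSpeed κ x t) ≤
          κ * η' / p * (‖x t‖ ^ (-α - κ) * p) := by gcongr
      have h6 : κ * η' / p * (‖x t‖ ^ (-α - κ) * p) = κ * ‖x t‖ ^ (-α - κ) * η' := by field_simp
      linarith
    have hlog : Tendsto (fun t => κ * η' / p * Real.log ‖x t‖) atTop atTop :=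
      (Real.tendsto_log_atTop.comp hx.norm_atTop).const_mul_atTop (by positivity)
    obtain ⟨t, ht1, ht2⟩ := ((hlog.eventually_gt_atTop
      ((p * ‖x T‖ ^ κ - inner ℝ (x T) (deriv x T)) +
        κ * η' / p * Real.log ‖x T‖)).and (eventually_ge_atTop T)).exists
    have h1 := hanti (mem_Ici.2 le_rfl) (mem_Ici.2 ht2) ht2
    have h2 := hD t ht2
    simp only at h1
    linarith
  obtain ⟨h1, h2, h3⟩ := hT b hb
  have hb0 : 0 < ‖x b‖ := hε.trans (hfree b h1)
  have hs1 : ‖‖x b‖⁻¹ • x b‖ = 1 := by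
    rw [norm_smul, norm_inv, norm_norm, inv_mul_cancel₀ hb0.ne']
  have hnd' := (hnd _ hs1).2 h3
  rw [h.pot.val_ξp] at hnd'
  have hr : 0 < ‖x b‖ ^ κ := by positivity
  have hV0 : 0 ≤ 2 * ‖x b‖ ^ κ * (V (‖x b‖⁻¹ • x b) - Vmin) :=
    mul_nonneg (by positivity) (sub_nonneg.2 (h.pot.le_val _ hs1))
  have hDb := hD b hb
  have hpD := mul_nonneg hp.le hDb
  refine ⟨b, h1, h2, by linarith, ?_, ?_⟩
  · have := min_le_left (p * η) (2 * μ * η)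
    have h4 : p * (p * ‖x b‖ ^ κ - inner ℝ (x b) (deriv x b)) ≤ p * η := by linarith
    have := le_of_mul_le_mul_left h4 hp
    linarith
  · have := min_le_right (p * η) (2 * μ * η)
    have h4 := mul_le_mul_of_nonneg_left hnd' (by positivity : 0 ≤ 2 * ‖x b‖ ^ κ)
    refine le_of_mul_le_mul_left ?_ (by positivity : 0 < 2 * μ)
    linarith

end

section
variable {ξm ξp : E d} {Vmin : ℝ} {V : E d → ℝ} {α p κ ε : ℝ} {x : ℝ → E d} {t₁ t₂ : ℝ}

/-! ### No velocity jump at the end of a non-degenerate contact interval -/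

lemma Setting.exists_lipschitz (h : Setting ξm ξp Vmin V α p κ) (hε : 0 < ε)
    (hx : IsConstrainedMorseMin ξm ξp V ε x) (a b : ℝ) :
    ∃ K, ∀ s ∈ Icc a b, ∀ t ∈ Icc a b, ‖x s - x t‖ ≤ K * |s - t| := by
  have hVc : Continuous fun t => V (x t) :=
    h.continuousOn.comp_continuous hx.continuous (hx.ne_zero hε)
  obtain ⟨C, hC⟩ := isCompact_Icc.exists_bound_of_continuousOn (s := Icc a b) hVc.continuousOn
  refine ⟨√(2 * C), fun s hs t ht => ?_⟩
  rw [(hx.isH1 a b).sub_eq ht hs]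
  refine intervalIntegral.norm_integral_le_of_norm_le_const_ae ?_
  filter_upwards [h.energy_ae hε hx] with τ hτ hmem
  have h1 := hC τ (uIcc_subset_Icc ht hs (uIoc_subset_uIcc hmem))
  refine Real.le_sqrt_of_sq_le ?_
  rw [hτ]
  linarith [le_abs_self (V (x τ)), Real.norm_eq_abs (V (x τ))]

lemma isH1_tent_smul {a b c η : ℝ} {x : ℝ → E d} {K : ℝ} (hη : 0 < η) (hx : ContinuousOn x (Icc a b))
    (hK : ∀ s ∈ Icc a b, ∀ t ∈ Icc a b, ‖x s - x t‖ ≤ K * |s - t|)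
    (hab : ∀ t ∈ Icc a b, |t - c| ≤ η) :
    IsH1 a b (fun t => (1 - |t - c| / η) • x t) := by
  obtain ⟨M, hM⟩ := isCompact_Icc.exists_bound_of_continuousOn hx
  refine isH1_of_lipschitz (K := K + M / η) fun s hs t ht => ?_
  have e : (1 - |s - c| / η) • x s - (1 - |t - c| / η) • x t =
      (1 - |s - c| / η) • (x s - x t) + ((|t - c| - |s - c|) / η) • x t := by
    rw [smul_sub, sub_add, ← sub_smul]
    congr 2; ring
  rw [e, add_mul]
  refine (norm_add_le _ _).trans (add_le_add ?_ ?_)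
  · rw [norm_smul, Real.norm_eq_abs, abs_of_nonneg (sub_nonneg.2 ((div_le_one hη).2 (hab s hs)))]
    have h1 : 0 ≤ |s - c| / η := by positivity
    have h2 := hK s hs t ht
    nlinarith [norm_nonneg (x s - x t)]
  · rw [norm_smul, Real.norm_eq_abs, abs_div, abs_of_pos hη, mul_comm]
    have h1 : abs (|t - c| - |s - c|) ≤ |s - t| := by
      refine (abs_abs_sub_abs_le _ _).trans (le_of_eq ?_)
      rw [abs_sub_comm]; congr 1; ring
    calc ‖x t‖ * (abs (|t - c| - |s - c|) / η) ≤ M * (|s - t| / η) := by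
          have := hM t ht
          have := (norm_nonneg _).trans this
          gcongr
      _ = _ := by ring

lemma inner_eq_zero_of_norm_eq {s t : ℝ} {v : E d} (hc : ∀ t ∈ Icc s t₂, ‖x t‖ = ε) (ht : t ∈ Ioo s t₂)
    (hv : HasDerivAt x v t) : (inner ℝ (x t) v : ℝ) = 0 := by
  have h1 := hv.norm_sq
  have h2 : HasDerivAt (fun t => ‖x t‖ ^ 2) 0 t := by
    refine (hasDerivAt_const t (ε ^ 2)).congr_of_eventuallyEq ?_
    filter_upwards [Icc_mem_nhds ht.1 ht.2] with u hu
    rw [hc u hu]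
  linarith [h1.unique h2]

/-- Outward variation by a tent multiple of x of half-width η centred at t₂. Before t₂ the slope
term drops out, because x·x' = 0 on the contact interval; after t₂ the slope -1/η meets x·x' ≥ f₀
and contributes at most -f₀ in total. The remaining terms contribute at most Cη on each side. -/
lemma Setting.inner_velocity_le (h : Setting ξm ξp Vmin V α p κ) (hε : 0 < ε)
    (hx : IsConstrainedMorseMin ξm ξp V ε x) (hfree : ∀ t > t₂, ε < ‖x t‖)
    (hc : ∀ t ∈ Icc t₁ t₂, ‖x t‖ = ε) {vp : E d} (hvp : Tendsto (deriv x) (𝓝[>] t₂) (𝓝 vp))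
    {C : ℝ} (hC : ∀ t ∈ Icc t₁ (t₂ + 1), 2 * κ * V (x t) ≤ C) {η : ℝ} (hη : 0 < η) (hη1 : η ≤ 1)
    (hηt : η ≤ t₂ - t₁) : (inner ℝ vp (x t₂) : ℝ) ≤ 2 * C * η := by
  have hκ := h.κ_pos
  have hne := hx.ne_zero hε
  have hV' : ContinuousOn (fderiv ℝ V) {0}ᶜ :=
    h.pot.contDiffOn.continuousOn_fderiv_of_isOpen isOpen_compl_singleton (by norm_num)
  set f₀ : ℝ := inner ℝ vp (x t₂) with hf₀
  set a := t₂ - η with ha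
  set b := t₂ + η with hb
  have hab : a < b := by linarith
  have hcI : t₂ ∈ Icc a b := ⟨by linarith, by linarith⟩
  have htent : ∀ t ∈ Icc a b, |t - t₂| ≤ η := fun t ht =>
    abs_le.2 ⟨by linarith [ht.1], by linarith [ht.2]⟩
  obtain ⟨K, hK⟩ := h.exists_lipschitz hε hx a b
  set y : ℝ → E d := fun t => (1 - |t - t₂| / η) • x t with hy
  have hyH : IsH1 a b y := isH1_tent_smul hη hx.continuous.continuousOn hK htent
  have hya : y a = 0 := by
    have : |a - t₂| = η := by rw [ha, sub_sub_cancel_left, abs_neg, abs_of_pos hη]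
    simp [hy, this, hη.ne']
  have hyb : y b = 0 := by
    have : |b - t₂| = η := by rw [hb, add_sub_cancel_left, abs_of_pos hη]
    simp [hy, this, hη.ne']
  have hφ0 : ∀ t ∈ Icc a b, 0 ≤ 1 - |t - t₂| / η := fun t ht =>
    sub_nonneg.2 ((div_le_one hη).2 (htent t ht))
  have hmin : ∀ᶠ s in 𝓝[>] (0 : ℝ), action V a b x ≤ action V a b (fun t => x t + s • y t) := by
    filter_upwards [self_mem_nhdsWithin] with s hs
    have hs : 0 < s := hs
    have hreg : ∀ t ∈ Icc a b, ε ≤ ‖x t + s • y t‖ := by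
      intro t ht
      have e : x t + s • y t = (1 + s * (1 - |t - t₂| / η)) • x t := by
        simp only [hy]; rw [add_smul, one_smul, smul_smul]
      have h1 := mul_nonneg hs.le (hφ0 t ht)
      rw [e, norm_smul, Real.norm_eq_abs, abs_of_nonneg (by linarith)]
      nlinarith [hx.le_norm t, norm_nonneg (x t)]
    have hfin := ParabolicMin.action_ne_top h.continuousOn h.nonneg hab.le
      ((hx.isH1 a b).add_smul hyH s) (fun t ht => norm_pos_iff.1 (hε.trans_le (hreg t ht)))
    rw [← ENNReal.ofReal_toReal hfin]
    refine h.action_le_of_reach hε hx hab (c := t₁) (fun hmem => ?_)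
      (hc t₁ (left_mem_Icc.2 (by linarith))) ENNReal.toReal_nonneg
      ⟨a, b, _, hab, (hx.isH1 a b).add_smul hyH s, ?_, ?_, hreg, ?_⟩
    · linarith [hmem.1]
    · simp [hya]
    · simp [hyb]
    · rw [ENNReal.ofReal_toReal hfin]
  have hvar := first_variation h.pot.contDiffOn h.nonneg hab (hx.isH1 a b) hyH hε
    (fun t _ => hx.le_norm t) hmin
  set g : ℝ → ℝ := fun t => inner ℝ (deriv x t) (deriv y t) + fderiv ℝ V (x t) (y t) with hg
  have hgi : IntervalIntegrable g volume a b := by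
    refine (memLp_inner_integrable hab.le (hx.isH1 a b).memLp_deriv hyH.memLp_deriv).add
      (ContinuousOn.intervalIntegrable ?_)
    rw [uIcc_of_le hab.le]
    exact (hV'.comp_continuous hx.continuous hne).continuousOn.clm_apply hyH.continuousOn
  have hgi1 : IntervalIntegrable g volume a t₂ := hgi.mono_set (by
    rw [uIcc_of_le hab.le, uIcc_of_le hcI.1]; exact Icc_subset_Icc le_rfl hcI.2)
  have hgi2 : IntervalIntegrable g volume t₂ b := hgi.mono_set (by
    rw [uIcc_of_le hab.le, uIcc_of_le hcI.2]; exact Icc_subset_Icc hcI.1 le_rfl)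
  have hbound : ∀ t ∈ Icc a b, ‖deriv x t‖ ^ 2 = 2 * V (x t) →
      (1 - |t - t₂| / η) * (‖deriv x t‖ ^ 2 + fderiv ℝ V (x t) (x t)) ≤ C := by
    intro t ht he
    rw [h.fderiv_self (hne t), he]
    have h1 : 2 * V (x t) + -α * V (x t) = 2 * κ * V (x t) := by rw [h.κ_eq]; ring
    rw [h1]
    have h2 := hC t ⟨by linarith [ht.1], by linarith [ht.2]⟩
    have h3 : 0 ≤ 2 * κ * V (x t) := by
      have := h.nonneg _ (hne t)
      positivity
    have h4 : 0 ≤ |t - t₂| / η := by positivity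
    nlinarith [hφ0 t ht]
  have hlow : ∫ t in a..t₂, g t ≤ ∫ t in a..t₂, C := by
    refine intervalIntegral.integral_mono_ae_restrict hcI.1 hgi1 intervalIntegrable_const ?_
    have hsub : Icc a t₂ ⊆ Icc a b := Icc_subset_Icc le_rfl hcI.2
    rw [← restrict_Ioo_eq_restrict_Icc]
    filter_upwards [ae_restrict_of_ae_restrict_of_subset
      (Ioo_subset_Icc_self.trans hsub) (hx.isH1 a b).ae_hasDerivAt,
      ae_restrict_of_ae (h.energy_ae hε hx), ae_restrict_mem measurableSet_Ioo] with t hd he ht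
    have ht' : t ∈ Icc a b := hsub (Ioo_subset_Icc_self ht)
    have hd0 := inner_eq_zero_of_norm_eq (s := a)
      (fun u hu => hc u ⟨by linarith [hu.1], hu.2⟩) ht hd
    have hyd : HasDerivAt y ((1 - |t - t₂| / η) • deriv x t + (1 / η) • x t) t := by
      have h1 : HasDerivAt (fun t => 1 - (t₂ - t) / η) (1 / η) t := by
        refine ((((hasDerivAt_id t).const_sub t₂).div_const η).const_sub 1).congr_deriv ?_
        ring
      have h2 : (fun t => 1 - |t - t₂| / η) =ᶠ[𝓝 t] fun t => 1 - (t₂ - t) / η := by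
        filter_upwards [gt_mem_nhds ht.2] with u hu
        rw [abs_of_neg (by linarith)]; ring
      exact (h1.congr_of_eventuallyEq h2).smul hd
    simp only [hg]
    rw [hyd.deriv]
    simp only [hy]
    rw [map_smul, inner_add_right, inner_smul_right, inner_smul_right,
      real_inner_comm (x t) (deriv x t), hd0,
      real_inner_self_eq_norm_sq, smul_eq_mul, mul_zero, add_zero, ← mul_add]
    exact hbound t ht' he
  have hmono : ∀ t, t₂ < t → f₀ ≤ inner ℝ (x t) (deriv x t) := by
    intro t ht
    refine le_of_tendsto (Setting.tendsto_inner hx hvp) ?_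
    have hm : MonotoneOn (fun t => (inner ℝ (x t) (deriv x t) : ℝ)) (Ioi t₂) := by
      refine monotoneOn_of_deriv_nonneg (convex_Ioi _) (fun s hs =>
        (h.hasDerivAt_inner hε hx (hfree s hs)).continuousAt.continuousWithinAt) ?_ ?_
      · exact fun s hs => (h.hasDerivAt_inner hε hx
          (hfree s (interior_subset hs))).differentiableAt.differentiableWithinAt
      · intro s hs
        rw [(h.hasDerivAt_inner hε hx (hfree s (interior_subset hs))).deriv]
        have := h.nonneg _ (hne s)
        positivity
    filter_upwards [Ioo_mem_nhdsGT ht] with s hs using hm hs.1 ht hs.2.le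
  have hhigh : ∫ t in t₂..b, g t ≤ ∫ t in t₂..b, (C - f₀ / η) := by
    refine intervalIntegral.integral_mono_ae_restrict hcI.2 hgi2 intervalIntegrable_const ?_
    have hsub : Icc t₂ b ⊆ Icc a b := Icc_subset_Icc hcI.1 le_rfl
    rw [← restrict_Ioo_eq_restrict_Icc]
    filter_upwards [ae_restrict_mem measurableSet_Ioo] with t ht
    have ht' : t ∈ Icc a b := hsub (Ioo_subset_Icc_self ht)
    have hd := (h.euler_lagrange hε hx (hfree t ht.1)).1
    have he := h.energy hε hx (hfree t ht.1)
    have hyd : HasDerivAt y ((1 - |t - t₂| / η) • deriv x t + (-(1 / η)) • x t) t := by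
      have h1 : HasDerivAt (fun t => 1 - (t - t₂) / η) (-(1 / η)) t := by
        refine ((((hasDerivAt_id t).sub_const t₂).div_const η).const_sub 1).congr_deriv ?_
        ring
      have h2 : (fun t => 1 - |t - t₂| / η) =ᶠ[𝓝 t] fun t => 1 - (t - t₂) / η := by
        filter_upwards [lt_mem_nhds ht.1] with u hu
        rw [abs_of_pos (by linarith)]
      exact (h1.congr_of_eventuallyEq h2).smul hd
    simp only [hg]
    rw [hyd.deriv]
    simp only [hy]
    rw [map_smul, inner_add_right, inner_smul_right, inner_smul_right,
      real_inner_comm (x t) (deriv x t), real_inner_self_eq_norm_sq, smul_eq_mul]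
    have h1 := hbound t ht' he
    have h2 := div_le_div_of_nonneg_right (hmono t ht.1) hη.le
    have h3 : -(1 / η) * (inner ℝ (x t) (deriv x t) : ℝ) =
      - ((inner ℝ (x t) (deriv x t) : ℝ) / η) := by ring
    rw [h3]
    linarith
  rw [← intervalIntegral.integral_add_adjacent_intervals hgi1 hgi2] at hvar
  rw [intervalIntegral.integral_const, smul_eq_mul] at hlow hhigh
  have e1 : t₂ - a = η := by rw [ha]; ring
  have e2 : b - t₂ = η := by rw [hb]; ring
  rw [e1] at hlow
  rw [e2, mul_sub, mul_div_cancel₀ _ hη.ne'] at hhigh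
  linarith

lemma Setting.inner_velocity_eq_zero (h : Setting ξm ξp Vmin V α p κ) (hε : 0 < ε)
    (hx : IsConstrainedMorseMin ξm ξp V ε x) (hfree : ∀ t > t₂, ε < ‖x t‖) (ht : t₁ < t₂)
    (hc : ∀ t ∈ Icc t₁ t₂, ‖x t‖ = ε) {vp : E d} (hvp : Tendsto (deriv x) (𝓝[>] t₂) (𝓝 vp)) :
    (inner ℝ vp (x t₂) : ℝ) = 0 := by
  refine le_antisymm ?_ (h.inner_nonneg_of_tendsto hε hx hfree (hc t₂ (right_mem_Icc.2 ht.le)) hvp)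
  have hVc : Continuous fun t => 2 * κ * V (x t) :=
    continuous_const.mul (h.continuousOn.comp_continuous hx.continuous (hx.ne_zero hε))
  obtain ⟨C, hC⟩ := isCompact_Icc.exists_bound_of_continuousOn (s := Icc t₁ (t₂ + 1))
    hVc.continuousOn
  have hlim : Tendsto (fun η : ℝ => 2 * C * η) (𝓝[>] 0) (𝓝 0) := by
    have : Continuous fun η : ℝ => 2 * C * η := by fun_prop
    simpa using (this.tendsto 0).mono_left nhdsWithin_le_nhds
  refine ge_of_tendsto hlim ?_
  filter_upwards [Ioo_mem_nhdsGT (lt_min one_pos (sub_pos.2 ht))] with η hη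
  exact h.inner_velocity_le hε hx hfree hc hvp
    (fun t ht => (le_abs_self _).trans (hC t ht)) hη.1 (hη.2.le.trans (min_le_left _ _))
    (hη.2.le.trans (min_le_right _ _))

end

section
variable {ξm ξp : E d} {Vmin : ℝ} {V : E d → ℝ} {α p κ ε : ℝ} {x : ℝ → E d} {t₁ t₂ : ℝ}

/-! ### The renormalized action of a constrained minimizer -/

/-- Along suitable intervals exhausting the line, the action of `x` exceeds the action
`(p/κ) (‖x a‖^κ + ‖x b‖^κ)` of the two homothetic motions by `m` in the limit. -/
def HasRenormAction (ξm ξp : E d) (V : E d → ℝ) (p κ ε : ℝ) (x : ℝ → E d) (m : ℝ) : Prop :=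
  ∀ η > 0, ∀ R : ℝ, ∃ a b, a < b ∧ (∃ t ∈ Icc a b, ‖x t‖ = ε) ∧ R ≤ ‖x a‖ ∧ R ≤ ‖x b‖ ∧
    ‖x a‖ ^ κ * ‖‖x a‖⁻¹ • x a - ξm‖ ^ 2 ≤ η ∧ ‖x b‖ ^ κ * ‖‖x b‖⁻¹ • x b - ξp‖ ^ 2 ≤ η ∧
    |(action V a b x).toReal - p / κ * (‖x a‖ ^ κ + ‖x b‖ ^ κ) - m| ≤ η

lemma Setting.exists_outgoing (h : Setting ξm ξp Vmin V α p κ) (hε : 0 < ε)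
    (hx : IsConstrainedMorseMin ξm ξp V ε x) (hfree : ∀ t > t₂, ε < ‖x t‖) (ht₂ : ‖x t₂‖ = ε) :
    ∃ vp, Tendsto (deriv x) (𝓝[>] t₂) (𝓝 vp) ∧ 0 ≤ (inner ℝ vp (x t₂) : ℝ) ∧
      ∀ η > 0, ∀ R : ℝ, ∃ b > t₂, R ≤ ‖x b‖ ∧ ‖x b‖ ^ κ * ‖‖x b‖⁻¹ • x b - ξp‖ ^ 2 ≤ η ∧
        |(action V t₂ b x).toReal - p / κ * ‖x b‖ ^ κ + inner ℝ vp (x t₂) / κ| ≤ η := by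
  have hκ := h.κ_pos
  obtain ⟨vp, hvp⟩ := h.exists_tendsto_deriv hε hx hfree
  refine ⟨vp, hvp, h.inner_nonneg_of_tendsto hε hx hfree ht₂ hvp, fun η hη R => ?_⟩
  obtain ⟨b, hb, h1, h2, h3, h4⟩ := h.exists_time_near_homothetic hε hx hfree
    (lt_min hη (mul_pos hκ hη)) R
  refine ⟨b, hb, h1, h4.trans (min_le_left _ _), ?_⟩
  have h5 := min_le_right η (κ * η)
  rw [h.action_eq_inner_sub hε hx hfree hvp hb]
  have e : ((inner ℝ (x b) (deriv x b) : ℝ) - inner ℝ vp (x t₂)) / κ - p / κ * ‖x b‖ ^ κ +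
      inner ℝ vp (x t₂) / κ = (inner ℝ (x b) (deriv x b) - p * ‖x b‖ ^ κ) / κ := by ring
  rw [e, abs_le, le_div_iff₀ hκ, div_le_iff₀ hκ]
  constructor <;> nlinarith

lemma action_self (V : E d → ℝ) (a : ℝ) (x : ℝ → E d) : action V a a x = 0 := by
  have : volume.restrict (Icc a a) = 0 := by rw [Measure.restrict_eq_zero]; simp
  rw [action, this, lintegral_zero_measure]

/-- Every constrained minimizer has a nonnegative velocity jump, and the jump determines the sign of
the renormalized action. -/
lemma Setting.exists_velJump (h : Setting ξm ξp Vmin V α p κ) (hε : 0 < ε)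
    (hx : IsConstrainedMorseMin ξm ξp V ε x) :
    ∃ m δ, 0 ≤ δ ∧ HasVelJump α ε x δ ∧ HasRenormAction ξm ξp V p κ ε x m ∧
      (0 < δ → m = -(δ * ε ^ κ / κ)) ∧ (δ = 0 → 0 ≤ m) := by
  have hκ := h.κ_pos
  obtain ⟨t₁, t₂, h12, hS⟩ := h.exists_contact_interval hε hx
  have hc : ∀ t ∈ Icc t₁ t₂, ‖x t‖ = ε := fun t ht => by rw [← hS] at ht; exact ht
  have hoff : ∀ t ∉ Icc t₁ t₂, ε < ‖x t‖ := fun t ht =>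
    (hx.le_norm t).lt_of_ne fun e => ht (by rw [← hS]; exact e.symm)
  have hfree : ∀ t > t₂, ε < ‖x t‖ := fun t ht => hoff t fun hmem => absurd hmem.2 (not_le.2 ht)
  have ht₂ := hc t₂ (right_mem_Icc.2 h12)
  have ht₁ := hc t₁ (left_mem_Icc.2 h12)
  -- The incoming branch is the outgoing branch of the reversed path; its limit velocity w is minus
  -- the incoming velocity, so the jump is a sum of two nonnegative terms.
  set y : ℝ → E d := fun t => x (-t) with hy
  have hy_min : IsConstrainedMorseMin ξp ξm V ε y := hx.comp_neg
  have hfree' : ∀ t > -t₁, ε < ‖y t‖ := fun t ht =>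
    hoff _ fun hmem => absurd hmem.1 (by linarith)
  have hyt : y (-t₁) = x t₁ := by simp [hy]
  obtain ⟨vp, hvp, hvp0, Hp⟩ := h.exists_outgoing hε hx hfree ht₂
  obtain ⟨w, hw, hw0, Hm⟩ := h.swap.exists_outgoing hε hy_min hfree' (by rw [hyt, ht₁])
  rw [hyt] at hw0 Hm
  have hvm : Tendsto (deriv x) (𝓝[<] t₁) (𝓝 (-w)) := by
    have h1 : Tendsto (fun t : ℝ => -t) (𝓝[<] t₁) (𝓝[>] (-t₁)) := tendsto_neg_nhdsLT
    refine (hw.comp h1).neg.congr fun t => ?_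
    simp [hy, deriv_comp_neg]
  set δ : ℝ := (inner ℝ vp (x t₂) - inner ℝ (-w) (x t₁)) / (ε ^ (-α / 2) * ε) with hδ
  have hpow : ε ^ (-α / 2) * ε = ε ^ κ := by
    rw [← Real.rpow_add_one hε.ne', h.κ_eq]; congr 1; ring
  have hεκ : 0 < ε ^ κ := Real.rpow_pos_of_pos hε _
  have hsum : δ * ε ^ κ = inner ℝ vp (x t₂) + inner ℝ w (x t₁) := by
    rw [hδ, hpow, div_mul_cancel₀ _ hεκ.ne', inner_neg_left, sub_neg_eq_add]
  set Ac := (action V t₁ t₂ x).toReal with hAc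
  have hAc0 : 0 ≤ Ac := ENNReal.toReal_nonneg
  have hδ0 : 0 ≤ δ := by
    have : 0 ≤ δ * ε ^ κ := by rw [hsum]; linarith
    exact nonneg_of_mul_nonneg_left this hεκ
  -- Contact action minus the boundary terms x·x'/κ of the two free branches at the contact times.
  refine ⟨Ac - δ * ε ^ κ / κ, δ, hδ0, ⟨t₁, t₂, -w, vp, h12, hS, fun t ht =>
    (h.euler_lagrange hε hx (hoff t ht)).1.differentiableAt, hvm, hvp, rfl⟩, ?_, ?_, ?_⟩
  · intro η hη R
    obtain ⟨b, hb, hb1, hb2, hb3⟩ := Hp (η / 2) (half_pos hη) R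
    obtain ⟨a, ha, ha1, ha2, ha3⟩ := Hm (η / 2) (half_pos hη) R
    have hy' : y a = x (-a) := rfl
    rw [hy'] at ha1 ha2 ha3
    rw [hy, action_comp_neg, neg_neg] at ha3
    refine ⟨-a, b, by linarith, ⟨t₁, ⟨by linarith, by linarith⟩, ht₁⟩, ha1, hb1, by linarith,
      by linarith, ?_⟩
    have hfin : ∀ {s t : ℝ}, s ≤ t → action V s t x ≠ ⊤ := fun hst => h.action_ne_top hε hx hst
    have e : (action V (-a) b x).toReal = (action V (-a) t₁ x).toReal + Ac +
        (action V t₂ b x).toReal := by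
      rw [action_add (h12.trans' (by linarith : -a ≤ t₁)) hb.le,
        action_add (by linarith : -a ≤ t₁) h12,
        ENNReal.toReal_add (ENNReal.add_ne_top.2 ⟨hfin (by linarith), hfin h12⟩) (hfin hb.le),
        ENNReal.toReal_add (hfin (by linarith)) (hfin h12)]
    rw [e, hsum]
    have e2 : (action V (-a) t₁ x).toReal + Ac + (action V t₂ b x).toReal -
        p / κ * (‖x (-a)‖ ^ κ + ‖x b‖ ^ κ) -
        (Ac - (inner ℝ vp (x t₂) + inner ℝ w (x t₁)) / κ) =
        ((action V (-a) t₁ x).toReal - p / κ * ‖x (-a)‖ ^ κ + inner ℝ w (x t₁) / κ) +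
        ((action V t₂ b x).toReal - p / κ * ‖x b‖ ^ κ + inner ℝ vp (x t₂) / κ) := by ring
    rw [e2]
    exact (abs_add_le _ _).trans (by linarith)
  · intro hpos
    rcases h12.eq_or_lt with heq | hlt
    · have : Ac = 0 := by rw [hAc, heq, action_self, ENNReal.toReal_zero]
      rw [this, zero_sub]
    -- On a nontrivial contact interval both radial velocities vanish, contradicting δ > 0.
    · exfalso
      have h1 := h.inner_velocity_eq_zero hε hx hfree hlt hc hvp
      have h2 := h.swap.inner_velocity_eq_zero (t₁ := -t₂) hε hy_min hfree' (by linarith)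
        (fun t ht => hc (-t) ⟨by linarith [ht.2], by linarith [ht.1]⟩) hw
      rw [hyt] at h2
      rw [h1, h2, add_zero] at hsum
      have := mul_pos hpos hεκ
      linarith
  · rintro h0
    rw [h0]
    simpa using hAc0

/-! ### Comparison of the renormalized action with other paths -/

/-- The path passes through the point 2‖z‖ ξp of the axis, so that each angular error is weighted by
the power of its own radius. A direct application of `Setting.exists_reach` would weight σ² by
‖w‖^κ, which is unbounded. The factor 4 leaves a ratio of at least 2 on each leg. -/
lemma Setting.exists_reach_join (h : Setting ξm ξp Vmin V α p κ) :
    ∃ C > 0, ∃ σ₀ > 0, σ₀ ≤ 1 / 2 ∧ ∀ (ε : ℝ) (z w : E d) (σ σ' : ℝ), 0 < ε →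
      ‖‖z‖⁻¹ • z - ξp‖ ≤ σ → ‖‖w‖⁻¹ • w - ξp‖ ≤ σ' → σ ≤ σ₀ → σ' ≤ σ₀ → ε ≤ ‖z‖ * (1 - σ) →
      4 * ‖z‖ ≤ ‖w‖ → Reach V ε z w (p / κ * (‖w‖ ^ κ - ‖z‖ ^ κ) +
        C * (‖z‖ ^ κ * σ ^ 2 + ‖w‖ ^ κ * σ' ^ 2)) := by
  obtain ⟨C, hC, σ₀, hσ₀, hσh, H⟩ := h.exists_reach
  have hκ := h.κ_pos
  have hp := h.p_pos
  refine ⟨p / κ * C * 2, by positivity, σ₀, hσ₀, hσh, fun ε z w σ σ' hε hz hw hσ hσ' hεz hzw => ?_⟩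
  have hσn : 0 ≤ σ := (norm_nonneg _).trans hz
  have hσn' : 0 ≤ σ' := (norm_nonneg _).trans hw
  have hz0 : 0 < ‖z‖ := by
    by_contra hcon
    nlinarith [norm_nonneg z]
  have hw0 : 0 < ‖w‖ := by linarith
  have hdir : ∀ u : E d, 0 < ‖u‖ → ‖‖u‖⁻¹ • u‖ = 1 ∧ ‖u‖ • (‖u‖⁻¹ • u) = u := fun u hu => by
    constructor
    · rw [norm_smul, norm_inv, norm_norm, inv_mul_cancel₀ hu.ne']
    · rw [smul_smul, mul_inv_cancel₀ hu.ne', one_smul]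
  have h1 := H ‖z‖ (2 * ‖z‖) σ (‖z‖⁻¹ • z) ξp hz0 le_rfl (hdir z hz0).1 h.norm_ξp hz
    (by simpa using hσn) hσ
  have h2 := H (2 * ‖z‖) ‖w‖ σ' ξp (‖w‖⁻¹ • w) (by positivity) (by linarith) h.norm_ξp
    (hdir w hw0).1 (by simpa using hσn') hw hσ'
  rw [(hdir z hz0).2] at h1
  rw [(hdir w hw0).2] at h2
  have hm1 : ‖z‖ ^ κ ≤ (2 * ‖z‖) ^ κ := by gcongr; linarith
  have hm2 : (2 * ‖z‖) ^ κ ≤ ‖w‖ ^ κ := by gcongr; linarith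
  have hm3 : (2 * ‖z‖) ^ κ ≤ 2 * ‖z‖ ^ κ := by
    rw [Real.mul_rpow two_pos.le hz0.le]
    gcongr
    calc (2 : ℝ) ^ κ ≤ 2 ^ (1 : ℝ) := Real.rpow_le_rpow_of_exponent_le one_le_two h.κ_lt_one.le
      _ = 2 := Real.rpow_one 2
  have hz' : 0 < ‖z‖ ^ κ := by positivity
  have hpκ : 0 < p / κ := by positivity
  have hn1 : 0 ≤ p / κ * ((2 * ‖z‖) ^ κ - ‖z‖ ^ κ) * (1 + C * σ ^ 2) :=
    mul_nonneg (mul_nonneg hpκ.le (sub_nonneg.2 hm1)) (by positivity)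
  have hn2 : 0 ≤ p / κ * (‖w‖ ^ κ - (2 * ‖z‖) ^ κ) * (1 + C * σ' ^ 2) :=
    mul_nonneg (mul_nonneg hpκ.le (sub_nonneg.2 hm2)) (by positivity)
  refine (Reach.trans hn1 hn2 (h1.le hεz le_rfl) (h2.le (by nlinarith) le_rfl)).le le_rfl ?_
  have hb1 : ((2 * ‖z‖) ^ κ - ‖z‖ ^ κ) * (C * σ ^ 2) ≤ 2 * ‖z‖ ^ κ * (C * σ ^ 2) :=
    mul_le_mul_of_nonneg_right (by linarith) (by positivity)
  have hb2 : (‖w‖ ^ κ - (2 * ‖z‖) ^ κ) * (C * σ' ^ 2) ≤ 2 * ‖w‖ ^ κ * (C * σ' ^ 2) :=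
    mul_le_mul_of_nonneg_right (by linarith) (by positivity)
  have hb3 := mul_le_mul_of_nonneg_left (add_le_add hb1 hb2) hpκ.le
  nlinarith [hb3]

lemma le_of_forall_small_le_add {a b K : ℝ} {η₀ : ℝ} (hη₀ : 0 < η₀)
    (H : ∀ η, 0 < η → η ≤ η₀ → a ≤ b + K * η) : a ≤ b := by
  have hlim : Tendsto (fun η : ℝ => b + K * η) (𝓝[>] 0) (𝓝 b) := by
    have : Continuous fun η : ℝ => b + K * η := by fun_prop
    simpa using (this.tendsto 0).mono_left nhdsWithin_le_nhds
  refine ge_of_tendsto hlim ?_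
  filter_upwards [Ioo_mem_nhdsGT hη₀] with η hη using H η hη.1 hη.2.le

lemma angle_le_of_rpow_mul_sq_le {r σ η σ₀ : ℝ} (hκ : 0 ≤ κ) (hr : 1 ≤ r) (hσ₀ : 0 ≤ σ₀)
    (h : r ^ κ * σ ^ 2 ≤ η) (hη : η ≤ σ₀ ^ 2) : σ ≤ σ₀ := by
  have h1 : 1 ≤ r ^ κ := Real.one_le_rpow hr hκ
  exact le_of_sq_le_sq (by nlinarith [sq_nonneg σ]) hσ₀

/-- The touching path from y to z is prolonged by almost radial joins to far points x a and x b of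
the minimizer. The terms (p/κ)‖x a‖^κ and (p/κ)‖x b‖^κ of the joins cancel those subtracted in the
renormalization, and the angular errors at x a and x b are arbitrarily small. -/
lemma Setting.exists_renorm_le (h : Setting ξm ξp Vmin V α p κ) :
    ∃ C > 0, ∃ σ₀ > 0, σ₀ ≤ 1 / 2 ∧ ∀ (ε : ℝ) (x : ℝ → E d) (m : ℝ), 0 < ε →
      IsConstrainedMorseMin ξm ξp V ε x → HasRenormAction ξm ξp V p κ ε x m →
      ∀ (y z : E d) (A σ₁ σ₂ : ℝ), 0 ≤ A → TouchReach V ε y z A →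
      ‖‖y‖⁻¹ • y - ξm‖ ≤ σ₁ → ‖‖z‖⁻¹ • z - ξp‖ ≤ σ₂ → σ₁ ≤ σ₀ → σ₂ ≤ σ₀ →
      ε ≤ ‖y‖ * (1 - σ₁) → ε ≤ ‖z‖ * (1 - σ₂) →
      m ≤ A - p / κ * (‖y‖ ^ κ + ‖z‖ ^ κ) + C * (‖y‖ ^ κ * σ₁ ^ 2 + ‖z‖ ^ κ * σ₂ ^ 2) := by
  have hκ := h.κ_pos
  have hp := h.p_pos
  obtain ⟨C, hC, σp, hσp, hσp2, Hp⟩ := h.exists_reach_join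
  obtain ⟨C', hC', σm, hσm, hσm2, Hm⟩ := h.swap.exists_reach_join
  refine ⟨max C C', lt_max_of_lt_left hC, min σp σm, lt_min hσp hσm,
    (min_le_left _ _).trans hσp2, ?_⟩
  intro ε x m hε hx hm y z A σ₁ σ₂ hA hT hy hz hσ₁ hσ₂ hεy hεz
  have hl := min_le_left σp σm
  have hr := min_le_right σp σm
  set σ₀ := min σp σm with hσ₀
  have hσ₀p : 0 < σ₀ := lt_min hσp hσm
  refine le_of_forall_small_le_add (η₀ := σ₀ ^ 2) (K := 1 + C + C') (by positivity) ?_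
  intro η hη hησ
  obtain ⟨a, b, hab, hcon, ha, hb, ha2, hb2, hact⟩ := hm η hη (max (4 * max ‖y‖ ‖z‖) 1)
  have hy4 : 4 * ‖y‖ ≤ ‖x a‖ := le_trans (by gcongr; exact le_max_left _ _)
    ((le_max_left _ _).trans ha)
  have hz4 : 4 * ‖z‖ ≤ ‖x b‖ := le_trans (by gcongr; exact le_max_right _ _)
    ((le_max_left _ _).trans hb)
  have hra := angle_le_of_rpow_mul_sq_le hκ.le ((le_max_right _ _).trans ha) hσ₀p.le ha2 hησ
  have hrb := angle_le_of_rpow_mul_sq_le hκ.le ((le_max_right _ _).trans hb) hσ₀p.le hb2 hησ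
  have r1 := Hm ε y (x a) σ₁ _ hε hy le_rfl (hσ₁.trans hr) (hra.trans hr) hεy hy4
  have r2 := Hp ε z (x b) σ₂ _ hε hz le_rfl (hσ₂.trans hl) (hrb.trans hl) hεz hz4
  have hpκ : 0 < p / κ := by positivity
  have hmono : ∀ u v : E d, 4 * ‖u‖ ≤ ‖v‖ → 0 ≤ p / κ * (‖v‖ ^ κ - ‖u‖ ^ κ) := fun u v huv => by
    refine mul_nonneg hpκ.le (sub_nonneg.2 ?_)
    gcongr
    linarith [norm_nonneg u]
  have hn1 := hmono y (x a) hy4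
  have hn2 := hmono z (x b) hz4
  have hn1' := add_nonneg hn1 (by positivity : 0 ≤ C' * (‖y‖ ^ κ * σ₁ ^ 2 +
    ‖x a‖ ^ κ * ‖‖x a‖⁻¹ • x a - ξm‖ ^ 2))
  have hn2' := add_nonneg hn2 (by positivity : 0 ≤ C * (‖z‖ ^ κ * σ₂ ^ 2 +
    ‖x b‖ ^ κ * ‖‖x b‖⁻¹ • x b - ξp‖ ^ 2))
  have hT2 := (TouchReach.trans (add_nonneg hA hn2') hn1'
    (TouchReach.trans hA hn2' hT r2).symm r1).symm
  have h1 := hx.action_le_of_touchReach hab hcon hT2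
  have h2 : (action V a b x).toReal ≤ _ := ENNReal.toReal_le_of_le_ofReal (by positivity) h1
  have h3 := (abs_le.1 hact).1
  have h4 : C' * (‖y‖ ^ κ * σ₁ ^ 2) ≤ max C C' * (‖y‖ ^ κ * σ₁ ^ 2) := by
    gcongr; exact le_max_right _ _
  have h5 : C * (‖z‖ ^ κ * σ₂ ^ 2) ≤ max C C' * (‖z‖ ^ κ * σ₂ ^ 2) := by
    gcongr; exact le_max_left _ _
  have h6 := mul_le_mul_of_nonneg_left ha2 hC'.le
  have h7 := mul_le_mul_of_nonneg_left hb2 hC.le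
  nlinarith

/-- The renormalized action scales like `ε^κ`. -/
lemma Setting.renorm_le_mul (h : Setting ξm ξp Vmin V α p κ) {ε' : ℝ} {x' : ℝ → E d} {m m' : ℝ}
    (hε : 0 < ε) (hε' : 0 < ε') (hx : IsConstrainedMorseMin ξm ξp V ε x)
    (hx' : IsConstrainedMorseMin ξm ξp V ε' x') (hm : HasRenormAction ξm ξp V p κ ε x m)
    (hm' : HasRenormAction ξm ξp V p κ ε' x' m') : m ≤ (ε / ε') ^ κ * m' := by
  have hκ := h.κ_pos
  obtain ⟨C, hC, σ₀, hσ₀, hσ2, H⟩ := h.exists_renorm_le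
  set l := ε / ε' with hl
  have hl0 : 0 < l := div_pos hε hε'
  have hlκ : 0 < l ^ κ := by positivity
  refine le_of_forall_small_le_add (η₀ := σ₀ ^ 2) (K := l ^ κ * (1 + 2 * C)) (by positivity) ?_
  intro η hη hησ
  obtain ⟨a, b, hab, ⟨t, ht, hte⟩, ha, hb, ha2, hb2, hact⟩ := hm' η hη (max (2 * ε') 1)
  have hra := angle_le_of_rpow_mul_sq_le hκ.le ((le_max_right _ _).trans ha) hσ₀.le ha2 hησ
  have hrb := angle_le_of_rpow_mul_sq_le hκ.le ((le_max_right _ _).trans hb) hσ₀.le hb2 hησ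
  have hT : TouchReach V ε' (x' a) (x' b) (action V a b x').toReal := by
    refine ⟨a, b, x', hab, hx'.isH1 a b, rfl, rfl, ⟨⟨t, ht, hte⟩, ?_⟩, ?_⟩
    · rintro _ ⟨s, -, rfl⟩
      exact hx'.le_norm s
    · rw [ENNReal.ofReal_toReal (h.action_ne_top hε' hx' hab.le)]
  have hT2 := h.touchReach_smul hl0 hT
  rw [hl, div_mul_cancel₀ _ hε'.ne', ← hl] at hT2
  have hdir : ∀ u : E d, ‖l • u‖⁻¹ • (l • u) = ‖u‖⁻¹ • u := fun u => by
    rw [norm_smul, Real.norm_eq_abs, abs_of_pos hl0, smul_smul, mul_inv, mul_right_comm,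
      inv_mul_cancel₀ hl0.ne', one_mul]
  have hnorm : ∀ u : E d, ‖l • u‖ = l * ‖u‖ := fun u => by
    rw [norm_smul, Real.norm_eq_abs, abs_of_pos hl0]
  have hlev : ∀ (r σ : ℝ), 2 * ε' ≤ r → σ ≤ σ₀ → ε ≤ l * r * (1 - σ) := by
    intro r σ h1 h2
    have e : ε = l * ε' := by rw [hl, div_mul_cancel₀ _ hε'.ne']
    rw [e, mul_assoc]
    gcongr
    nlinarith
  have key := H ε x m hε hx hm (l • x' a) (l • x' b) _ _ _ (by positivity) hT2
    (by rw [hdir]) (by rw [hdir]) hra hrb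
    (by rw [hnorm]; exact hlev _ _ ((le_max_left _ _).trans ha) hra)
    (by rw [hnorm]; exact hlev _ _ ((le_max_left _ _).trans hb) hrb)
  rw [hnorm, hnorm, Real.mul_rpow hl0.le (norm_nonneg _), Real.mul_rpow hl0.le (norm_nonneg _)]
    at key
  have h3 := mul_le_mul_of_nonneg_left (abs_le.1 hact).2 hlκ.le
  have h4 := mul_le_mul_of_nonneg_left (add_le_add ha2 hb2) (by positivity : 0 ≤ C * l ^ κ)
  nlinarith

end

section
variable {ξm ξp : E d} {Vmin : ℝ} {V : E d → ℝ} {α p κ ε : ℝ} {x : ℝ → E d} {m : ℝ}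

/-! ### The level `c(V)` and the renormalized action -/

/-- Before the first zero s the path avoids the origin, and calibration by (p/κ)|x|^κ applies to the
reversed path on [a, t] with t < s; then t → s. -/
lemma Setting.le_action_of_collision (h : Setting ξm ξp Vmin V α p κ) {a b : ℝ} (hab : a ≤ b)
    (hx : IsH1 a b x) (ha : ‖x a‖ = 1) (hb : x b = 0) :
    ENNReal.ofReal (p / κ) ≤ action V a b x := by
  have hκ := h.κ_pos
  have hp := h.p_pos
  set Z : Set ℝ := Icc a b ∩ x ⁻¹' {0} with hZ
  have hZc : IsCompact Z := isCompact_Icc.of_isClosed_subset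
    (hx.continuousOn.preimage_isClosed_of_isClosed isClosed_Icc isClosed_singleton)
    inter_subset_left
  obtain ⟨s, hs, hleast⟩ := hZc.exists_isLeast ⟨b, right_mem_Icc.2 hab, hb⟩
  have has : a < s := hs.1.1.lt_of_ne fun e => by
    have : x a = 0 := by rw [e]; exact hs.2
    rw [this, norm_zero] at ha
    exact zero_ne_one ha
  have hne : ∀ t ∈ Ico a s, x t ≠ 0 := fun t ht h0 =>
    absurd (hleast ⟨⟨ht.1, ht.2.le.trans hs.1.2⟩, h0⟩) (not_le.2 ht.2)
  have hstep : ∀ t ∈ Ioo a s, ENNReal.ofReal (p / κ - p / κ * ‖x t‖ ^ κ) ≤ action V a b x := by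
    intro t ht
    have hH : IsH1 a t x := hx.mono le_rfl (ht.2.le.trans hs.1.2)
    have h1 := h.coneFun_sub_le_action h.norm_ξm (η := 0) le_rfl (by positivity)
      (neg_le_neg ht.1.le) (x := fun t => x (-t)) (IsH1.comp_neg (by simpa using hH))
      (fun u hu => hne _ ⟨by linarith [hu.2], by linarith [hu.1, ht.2]⟩)
    rw [coneFun_zero, coneFun_zero, action_comp_neg] at h1
    simp only [neg_neg, ha, Real.one_rpow, mul_one] at h1
    refine h1.trans (action_mono le_rfl ?_)
    exact ht.2.le.trans hs.1.2
  have hcont : Tendsto (fun t => p / κ - p / κ * ‖x t‖ ^ κ) (𝓝[Ioo a s] s) (𝓝 (p / κ)) := by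
    have h1 : Tendsto (fun t => ‖x t‖) (𝓝[Ioo a s] s) (𝓝 0) := by
      have := ((hx.continuousOn s hs.1).mono (s := Ioo a s)
        (fun t ht => ⟨ht.1.le, ht.2.le.trans hs.1.2⟩)).norm.tendsto
      rwa [show x s = 0 from hs.2, norm_zero] at this
    have h2 := (h1.rpow_const (p := κ) (Or.inr hκ.le)).const_mul (p / κ) |>.const_sub (p / κ)
    simpa [Real.zero_rpow hκ.ne'] using h2
  have : (𝓝[Ioo a s] s).NeBot := by
    rw [nhdsWithin_Ioo_eq_nhdsLT has]; infer_instance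
  refine le_of_tendsto (ENNReal.tendsto_ofReal hcont) ?_
  filter_upwards [self_mem_nhdsWithin] with t ht using hstep t ht

lemma Setting.le_action_of_exists_zero (h : Setting ξm ξp Vmin V α p κ) {a b c : ℝ}
    (hc : c ∈ Icc a b) (hx : IsH1 a b x) (ha : ‖x a‖ = 1) (hb : ‖x b‖ = 1) (h0 : x c = 0) :
    ENNReal.ofReal (2 * p / κ) ≤ action V a b x := by
  have hpκ : 0 ≤ p / κ := (div_pos h.p_pos h.κ_pos).le
  have h1 := h.le_action_of_collision hc.1 (hx.mono le_rfl hc.2) ha h0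
  have h2 := h.le_action_of_collision (neg_le_neg hc.2) (x := fun t => x (-t))
    (IsH1.comp_neg (by simpa using hx.mono hc.1 le_rfl)) (by simpa using hb) (by simpa using h0)
  rw [action_comp_neg, neg_neg, neg_neg] at h2
  have e : 2 * p / κ = p / κ + p / κ := by ring
  rw [action_add hc.1 hc.2, e, ENNReal.ofReal_add hpκ hpκ]
  exact add_le_add h1 h2

/-- A level below that of the collision path makes the renormalized action negative. -/
lemma Setting.renorm_neg_of_bolzaLevel_lt (h : Setting ξm ξp Vmin V α p κ) (hε : 0 < ε)
    (hx : IsConstrainedMorseMin ξm ξp V ε x) (hm : HasRenormAction ξm ξp V p κ ε x m)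
    (hc : bolzaLevel ξm ξp V < ENNReal.ofReal (2 * p / κ)) : m < 0 := by
  have hκ := h.κ_pos
  have hp := h.p_pos
  obtain ⟨A, ⟨a, b, z, hab, hz, hza, hzb, rfl⟩, hA⟩ := sInf_lt_iff.1 hc
  have hz1 : ‖z a‖ = 1 := by rw [hza, h.norm_ξm]
  have hz2 : ‖z b‖ = 1 := by rw [hzb, h.norm_ξp]
  have hne : ∀ t ∈ Icc a b, z t ≠ 0 := fun t ht h0 =>
    absurd (h.le_action_of_exists_zero ht hz hz1 hz2 h0) (not_le.2 hA)
  obtain ⟨ρ, hρ⟩ : ∃ ρ, IsLeast ((fun t => ‖z t‖) '' Icc a b) ρ :=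
    (isCompact_Icc.image_of_continuousOn hz.continuousOn.norm).exists_isLeast
      ((nonempty_Icc.2 hab.le).image _)
  have hρ0 : 0 < ρ := by
    obtain ⟨t, ht, hte⟩ := hρ.1
    rw [← hte]; exact norm_pos_iff.2 (hne t ht)
  have hρ1 : ρ ≤ 1 := by
    rw [← hz1]; exact hρ.2 (mem_image_of_mem (fun t => ‖z t‖) (left_mem_Icc.2 hab.le))
  have hT : TouchReach V ρ ξm ξp (action V a b z).toReal :=
    ⟨a, b, z, hab, hz, hza, hzb, hρ, by rw [ENNReal.ofReal_toReal hA.ne_top]⟩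
  have hA' : (action V a b z).toReal < 2 * p / κ :=
    ENNReal.toReal_lt_of_lt_ofReal hA
  -- This dilation makes the minimal norm equal to ε. The ends become l ξ±, exactly on the axes, so
  -- there is no angular error.
  set l := ε / ρ with hl
  have hl0 : 0 < l := div_pos hε hρ0
  have hlε : ε ≤ l := by rw [hl, le_div_iff₀ hρ0]; nlinarith
  have hT2 := h.touchReach_smul hl0 hT
  rw [hl, div_mul_cancel₀ _ hρ0.ne', ← hl] at hT2
  obtain ⟨C, hC, σ₀, hσ₀, -, H⟩ := h.exists_renorm_le
  have n1 := norm_smul_of_norm_one hl0.le h.norm_ξm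
  have n2 := norm_smul_of_norm_one hl0.le h.norm_ξp
  have hdir : ∀ ξ : E d, l⁻¹ • l • ξ = ξ := fun ξ => by
    rw [smul_smul, inv_mul_cancel₀ hl0.ne', one_smul]
  have key := H ε x m hε hx hm (l • ξm) (l • ξp) _ 0 0 (by positivity) hT2
    (by rw [n1, hdir, sub_self, norm_zero]) (by rw [n2, hdir, sub_self, norm_zero])
    hσ₀.le hσ₀.le (by rw [n1]; linarith) (by rw [n2]; linarith)
  rw [n1, n2] at key
  have hlκ : 0 < l ^ κ := by positivity
  have h5 := mul_lt_mul_of_pos_left hA' hlκ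
  have e : l ^ κ * (2 * p / κ) = p / κ * (l ^ κ + l ^ κ) := by ring
  rw [e] at h5
  refine key.trans_lt ?_
  norm_num
  linarith

/-- An arc of the minimizer is prolonged to R ξ⁻ and R ξ⁺ and shrunk by 1/R. Letting R → ∞ gives
c(V) ≤ 2p/κ whatever the sign of m; one fixed R gives strict inequality when m < 0. -/
lemma Setting.exists_bolzaLevel_le (h : Setting ξm ξp Vmin V α p κ) (hε : 0 < ε)
    (hx : IsConstrainedMorseMin ξm ξp V ε x) (hm : HasRenormAction ξm ξp V p κ ε x m) {η : ℝ}
    (hη : 0 < η) : ∃ R₀ > 0, ∀ R ≥ R₀,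
      bolzaLevel ξm ξp V ≤ ENNReal.ofReal (2 * p / κ + R⁻¹ ^ κ * (m + η)) := by
  have hκ := h.κ_pos
  have hp := h.p_pos
  obtain ⟨C, hC, σp, hσp, hσp2, Hp⟩ := h.exists_reach_join
  obtain ⟨C', hC', σm, hσm, hσm2, Hm⟩ := h.swap.exists_reach_join
  -- The first bound absorbs the errors of the action and of both joins into η; the second brings
  -- the directions within the range of the joins.
  set η' := min (η / (1 + C + C')) (min σp σm ^ 2) with hη'
  have hmin : 0 < min σp σm := lt_min hσp hσm
  have hη0 : 0 < η' := lt_min (by positivity) (by positivity)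
  obtain ⟨a, b, hab, ⟨t, ht, hte⟩, ha, hb, ha2, hb2, hact⟩ := hm η' hη0 (max (2 * ε) 1)
  have hra := (angle_le_of_rpow_mul_sq_le hκ.le ((le_max_right _ _).trans ha) hmin.le ha2
    (min_le_right _ _)).trans (min_le_right _ _)
  have hrb := (angle_le_of_rpow_mul_sq_le hκ.le ((le_max_right _ _).trans hb) hmin.le hb2
    (min_le_right _ _)).trans (min_le_left _ _)
  have ha0 := (le_max_left _ _).trans ha
  have hb0 := (le_max_left _ _).trans hb
  refine ⟨4 * max ‖x a‖ ‖x b‖, by have := le_max_left ‖x a‖ ‖x b‖; linarith, fun R hR => ?_⟩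
  have hRa : 4 * ‖x a‖ ≤ R := le_trans (by gcongr; exact le_max_left _ _) hR
  have hRb : 4 * ‖x b‖ ≤ R := le_trans (by gcongr; exact le_max_right _ _) hR
  have hR0 : 0 < R := by linarith
  have n1 := norm_smul_of_norm_one hR0.le h.norm_ξm
  have n2 := norm_smul_of_norm_one hR0.le h.norm_ξp
  have hdir : ∀ ξ : E d, R⁻¹ • R • ξ = ξ := fun ξ => by
    rw [smul_smul, inv_mul_cancel₀ hR0.ne', one_smul]
  have r1 := Hm ε (x a) (R • ξm) _ 0 hε le_rfl (by rw [n1, hdir, sub_self, norm_zero]) hra hσm.le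
    (by nlinarith) (by rwa [n1])
  have r2 := Hp ε (x b) (R • ξp) _ 0 hε le_rfl (by rw [n2, hdir, sub_self, norm_zero]) hrb hσp.le
    (by nlinarith) (by rwa [n2])
  rw [n1] at r1
  rw [n2] at r2
  have hT : TouchReach V ε (x a) (x b) (action V a b x).toReal := by
    refine ⟨a, b, x, hab, hx.isH1 a b, rfl, rfl, ⟨⟨t, ht, hte⟩, ?_⟩, ?_⟩
    · rintro _ ⟨s, -, rfl⟩
      exact hx.le_norm s
    · rw [ENNReal.ofReal_toReal (h.action_ne_top hε hx hab.le)]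
  have hpκ : 0 < p / κ := by positivity
  have hn : ∀ (c σ r : ℝ), 0 < c → 0 ≤ r → 4 * r ≤ R →
      0 ≤ p / κ * (R ^ κ - r ^ κ) + c * (r ^ κ * σ ^ 2 + R ^ κ * 0 ^ 2) := by
    intro c σ r hc hr0 hr
    refine add_nonneg (mul_nonneg hpκ.le (sub_nonneg.2 ?_)) (by positivity)
    gcongr
    linarith
  have hn1 := hn C' ‖‖x a‖⁻¹ • x a - ξm‖ ‖x a‖ hC' (norm_nonneg _) hRa
  have hn2 := hn C ‖‖x b‖⁻¹ • x b - ξp‖ ‖x b‖ hC (norm_nonneg _) hRb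
  have hT2 := (TouchReach.trans (add_nonneg ENNReal.toReal_nonneg hn2) hn1
    (TouchReach.trans ENNReal.toReal_nonneg hn2 hT r2).symm r1).symm
  obtain ⟨a', b', z, hab', hz, hza, hzb, -, hzA⟩ := h.touchReach_smul (inv_pos.2 hR0) hT2
  rw [hdir] at hza hzb
  have hle : bolzaLevel ξm ξp V ≤ action V a' b' z :=
    sInf_le ⟨a', b', z, hab', hz, hza, hzb, rfl⟩
  refine hle.trans (hzA.trans (ENNReal.ofReal_le_ofReal ?_))
  have hRκ : 0 < R⁻¹ ^ κ := by positivity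
  have e : R⁻¹ ^ κ * R ^ κ = 1 := by
    rw [← Real.mul_rpow (by positivity) hR0.le, inv_mul_cancel₀ hR0.ne', Real.one_rpow]
  have e2 : 2 * p / κ + R⁻¹ ^ κ * (m + η) = R⁻¹ ^ κ * (2 * (p / κ) * R ^ κ + m + η) := by
    linear_combination (-(2 * p / κ)) * e
  rw [e2]
  refine mul_le_mul_of_nonneg_left ?_ hRκ.le
  have h3 := (abs_le.1 hact).2
  have h6 := mul_le_mul_of_nonneg_left ha2 hC'.le
  have h7 := mul_le_mul_of_nonneg_left hb2 hC.le
  have h8 : (1 + C + C') * η' ≤ η := by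
    have := min_le_left (η / (1 + C + C')) (min σp σm ^ 2)
    rw [le_div_iff₀ (by positivity)] at this
    linarith
  nlinarith

lemma Setting.bolzaLevel_le (h : Setting ξm ξp Vmin V α p κ) (hε : 0 < ε)
    (hx : IsConstrainedMorseMin ξm ξp V ε x) (hm : HasRenormAction ξm ξp V p κ ε x m) :
    bolzaLevel ξm ξp V ≤ ENNReal.ofReal (2 * p / κ) := by
  obtain ⟨R₀, hR₀, H⟩ := h.exists_bolzaLevel_le hε hx hm one_pos
  have hlim : Tendsto (fun R : ℝ => 2 * p / κ + R⁻¹ ^ κ * (m + 1)) atTop (𝓝 (2 * p / κ)) := by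
    have h1 := (tendsto_inv_atTop_zero (𝕜 := ℝ)).rpow_const (p := κ) (Or.inr h.κ_pos.le)
    rw [Real.zero_rpow h.κ_pos.ne'] at h1
    simpa using (h1.mul_const (m + 1)).const_add (2 * p / κ)
  refine ge_of_tendsto (ENNReal.tendsto_ofReal hlim) ?_
  filter_upwards [eventually_ge_atTop R₀] with R hR using H R hR

lemma Setting.bolzaLevel_lt_iff (h : Setting ξm ξp Vmin V α p κ) (hε : 0 < ε)
    (hx : IsConstrainedMorseMin ξm ξp V ε x) (hm : HasRenormAction ξm ξp V p κ ε x m) :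
    bolzaLevel ξm ξp V < ENNReal.ofReal (2 * p / κ) ↔ m < 0 := by
  refine ⟨h.renorm_neg_of_bolzaLevel_lt hε hx hm, fun hneg => ?_⟩
  obtain ⟨R₀, hR₀, H⟩ := h.exists_bolzaLevel_le hε hx hm (η := -m / 2) (by linarith)
  refine (H R₀ le_rfl).trans_lt ?_
  have h1 : 0 < 2 * p / κ := div_pos (by linarith [h.p_pos]) h.κ_pos
  rw [ENNReal.ofReal_lt_ofReal_iff h1]
  have h2 : 0 < R₀⁻¹ ^ κ := by positivity
  nlinarith

/-! ### The velocity jump -/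

lemma HasVelJump.unique {δ δ' : ℝ} (h : HasVelJump α ε x δ) (h' : HasVelJump α ε x δ') :
    δ = δ' := by
  obtain ⟨t₁, t₂, vm, vp, h12, hS, -, hvm, hvp, rfl⟩ := h
  obtain ⟨t₁', t₂', vm', vp', h12', hS', -, hvm', hvp', rfl⟩ := h'
  have e : Icc t₁ t₂ = Icc t₁' t₂' := hS.symm.trans hS'
  have e1 : t₁ = t₁' := by rw [← csInf_Icc h12, e, csInf_Icc h12']
  have e2 : t₂ = t₂' := by rw [← csSup_Icc h12, e, csSup_Icc h12']
  subst e1 e2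
  rw [tendsto_nhds_unique hvm hvm', tendsto_nhds_unique hvp hvp']

/-- If δ > 0, scaling gives m' ≤ -δ ε'^κ/κ < 0. Hence δ' ≠ 0, m' is given by δ', and the two jumps
can be compared. -/
lemma Setting.velJump_le {ε' m' δ δ' : ℝ} {x' : ℝ → E d} (h : Setting ξm ξp Vmin V α p κ)
    (hε : 0 < ε) (hε' : 0 < ε') (hx : IsConstrainedMorseMin ξm ξp V ε x)
    (hx' : IsConstrainedMorseMin ξm ξp V ε' x') (hm : HasRenormAction ξm ξp V p κ ε x m)
    (hm' : HasRenormAction ξm ξp V p κ ε' x' m') (hδ : 0 ≤ δ) (hδ' : 0 ≤ δ')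
    (h1 : 0 < δ → m = -(δ * ε ^ κ / κ)) (h1' : 0 < δ' → m' = -(δ' * ε' ^ κ / κ))
    (h2' : δ' = 0 → 0 ≤ m') : δ ≤ δ' := by
  have hκ := h.κ_pos
  rcases hδ.eq_or_lt with rfl | hpos
  · exact hδ'
  have key := h.renorm_le_mul hε' hε hx' hx hm' hm
  have hεκ : 0 < ε ^ κ := by positivity
  have hεκ' : 0 < ε' ^ κ := by positivity
  have e : (ε' / ε) ^ κ * m = -(δ * ε' ^ κ / κ) := by
    rw [h1 hpos, Real.div_rpow hε'.le hε.le]; field_simp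
  rw [e] at key
  have hneg : 0 < δ * ε' ^ κ / κ := by positivity
  rcases hδ'.eq_or_lt with h0 | hpos'
  · linarith [h2' h0.symm]
  · rw [h1' hpos', neg_le_neg_iff, div_le_div_iff_of_pos_right hκ] at key
    exact le_of_mul_le_mul_right key hεκ'

lemma Setting.exists_isVelJump (h : Setting ξm ξp Vmin V α p κ) (hd : 2 ≤ d) :
    ∃ δ, 0 ≤ δ ∧ IsVelJump ξm ξp V α δ ∧
      bolzaLevel ξm ξp V ≤ ENNReal.ofReal (2 * p / κ) ∧
      (bolzaLevel ξm ξp V < ENNReal.ofReal (2 * p / κ) ↔ 0 < δ) := by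
  obtain ⟨x, hx⟩ := h.exists_minimizer hd one_pos
  obtain ⟨m, δ, hδ, -, hm, h1, h2⟩ := h.exists_velJump one_pos hx
  refine ⟨δ, hδ, fun ε hε => ⟨h.exists_minimizer hd hε, fun y hy => ?_⟩,
    h.bolzaLevel_le one_pos hx hm, (h.bolzaLevel_lt_iff one_pos hx hm).trans ⟨fun hneg => ?_,
    fun hpos => ?_⟩⟩
  · obtain ⟨m', δ', hδ', hJ, hm', h1', h2'⟩ := h.exists_velJump hε hy
    have e : δ = δ' := le_antisymm
      (h.velJump_le one_pos hε hx hy hm hm' hδ hδ' h1 h1' h2')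
      (h.velJump_le hε one_pos hy hx hm' hm hδ' hδ h1' h1 h2)
    rwa [e]
  · refine hδ.lt_of_ne fun h0 => ?_
    linarith [h2 h0.symm]
  · rw [h1 hpos]
    have : 0 < δ * 1 ^ κ / κ := by
      have := h.κ_pos
      positivity
    linarith

end

end ParabolicMin

end

/-! ### Conclusion. -/

theorem mainTheorem6 {d : ℕ} (hd : 2 ≤ d) (ξm ξp : ParabolicMin.E d)
    (hξm : ‖ξm‖ = 1) (hξp : ‖ξp‖ = 1) (hξ : ξp ≠ ξm) (Vmin : ℝ) (hVmin : 0 < Vmin)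
    (V : ParabolicMin.E d → ℝ) (α : ℝ)
    (hV : (V, α) ∈ ParabolicMin.potentialClass ξm ξp Vmin) :
    ParabolicMin.IsVelJump ξm ξp V α (ParabolicMin.deltaVel ξm ξp V α) ∧
    ((V, α) ∈ ParabolicMin.inSet ξm ξp Vmin ↔ ParabolicMin.deltaVel ξm ξp V α = 0) ∧
    ((V, α) ∈ ParabolicMin.outSet ξm ξp Vmin ↔ 0 < ParabolicMin.deltaVel ξm ξp V α) := by
  have hP : ParabolicMin.IsPotential ξm ξp Vmin V α := hV
  have hS : ParabolicMin.Setting ξm ξp Vmin V α √(2 * Vmin) (1 - α / 2) :=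
    ⟨hP, hξm, hξp, hVmin, Real.sqrt_pos.2 (by linarith), Real.sq_sqrt (by linarith), rfl⟩
  obtain ⟨δ, hδ, hJ, hle, hlt⟩ := hS.exists_isVelJump hd
  have hspec : ParabolicMin.IsVelJump ξm ξp V α (ParabolicMin.deltaVel ξm ξp V α) :=
    Classical.epsilon_spec (p := ParabolicMin.IsVelJump ξm ξp V α) ⟨δ, hJ⟩
  -- The chosen value and δ are both jumps of one and the same minimizer with ε = 1, and the jump of
  -- a path is unique.
  have e : ParabolicMin.deltaVel ξm ξp V α = δ := by
    obtain ⟨x, hx⟩ := (hJ 1 one_pos).1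
    exact ((hspec 1 one_pos).2 x hx).unique ((hJ 1 one_pos).2 x hx)
  have hlevel : 4 * √(2 * Vmin) / (2 - α) = 2 * √(2 * Vmin) / (1 - α / 2) := by
    have h2 : 2 - α ≠ 0 := (sub_pos.2 hP.alpha_lt_two).ne'
    have h3 : 1 - α / 2 ≠ 0 := by
      intro h0
      exact h2 (by linarith)
    rw [div_eq_div_iff h2 h3]
    ring
  refine ⟨hspec, ?_, ?_⟩
  · rw [e]
    constructor
    · rintro ⟨-, hin⟩
      have hin : ParabolicMin.bolzaLevel ξm ξp V = _ := hin
      rw [hlevel] at hin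
      by_contra hne
      exact absurd hin (hlt.2 (hδ.lt_of_ne (Ne.symm hne))).ne
    · intro h0
      refine ⟨hV, ?_⟩
      change ParabolicMin.bolzaLevel ξm ξp V = _
      rw [hlevel]
      refine hle.eq_of_not_lt fun hcon => ?_
      exact (hlt.1 hcon).ne' h0
  · rw [e]
    constructor
    · rintro ⟨-, hout⟩
      have hout : ParabolicMin.bolzaLevel ξm ξp V < _ := hout
      rw [hlevel] at hout
      exact hlt.1 hout
    · intro hpos
      refine ⟨hV, ?_⟩
      change ParabolicMin.bolzaLevel ξm ξp V < _
      rw [hlevel]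
      exact hlt.2 hpos
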